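/- **Theorem.** Let $\mathbb K=\mathbb R$ or $\mathbb C$, and let $V$ and $W$ be finite-dimensional vector superspaces over $\mathbb K$, regarded as supermanifolds (if the odd parts are zero, these are ordinary vector spaces regarded as manifolds). Supermanifolds are smooth if $\mathbb K=\mathbb R$ and holomorphic if $\mathbb K=\mathbb C$, and formulas in terms of points refer to points with values in an arbitrary finitely generated Grassmann algebra over $\mathbb K$. For a vector superspace $V$ or a super vector bundle $E$, let $V_0$ or $E_0$ denote the open subspace of non-zero vectors (those whose underlying ordinary vector is non-zero). Let $P(V)=V_0/\mathbb K^*$ be the projectivization of $V$ and let $E_V\to P(V)$ be its tautological line bundle. Define the weighted projective superspace $$P_{+1,-1}(V\oplus W):=(V_0\times W_0)/\mathbb K^*,\qquad \lambda\cdot(v,w)=(\lambda v,\lambda^{-1}w),$$ with the quotient structure (a map into the quotient is smooth if locally it lifts to a smooth map into $V_0\times W_0$), and let $[v\|w]$ denote the class of $(v,w)$. Then: 1. $P_{+1,-1}(V\oplus W)$ is a supermanifold. 2. The map $\pi_V\colon P_{+1,-1}(V\oplus W)\to P(V)$, $[v\|w]\mapsto[v]$, is well defined and smooth, and it is a locally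 trivial fibre bundle of supermanifolds with fibre $W_0$. The map $[v\|w]\mapsto v\otimes w$, where $v\otimes w$ is regarded as a non-zero vector of the fibre of $E_V\otimes W$ over $[v]$, is an isomorphism over $P(V)$ from this bundle to the bundle $(E_V\otimes W)_0\to P(V)$. 3. The map $\pi_W\colon P_{+1,-1}(V\oplus W)\to P(W)$, $[v\|w]\mapsto[w]$, is well defined and smooth, and it is a locally trivial fibre bundle of supermanifolds with fibre $V_0$. The map $[v\|w]\mapsto w\otimes v$ (that is, $v\otimes w$ under the identification $V\otimes W\cong W\otimes V$), where $w\otimes v$ is regarded as a non-zero vector of the fibre of $E_W\otimes V$ over $[w]$, is an isomorphism over $P(W)$ from this bundle to the bundle $(E_W\otimes V)_0\to P(W)$. -/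

import Mathlib

open scoped TensorProduct ContDiff Topology
open TopologicalSpace (Opens)

noncomputable section

namespace Super

universe u v w x

/-! ### Grassmann algebras -/

/-- The Grassmann algebra with `n` odd generators over `𝕜`. -/
abbrev Gr (𝕜 : Type u) [RCLike 𝕜] (n : ℕ) : Type u := ExteriorAlgebra 𝕜 (Fin n → 𝕜)

/-- The even part of the Grassmann algebra. -/
abbrev grEven (𝕜 : Type u) [RCLike 𝕜] (n : ℕ) : Submodule 𝕜 (Gr 𝕜 n) :=
  CliffordAlgebra.evenOdd (0 : QuadraticForm 𝕜 (Fin n → 𝕜)) 0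

/-- The odd part of the Grassmann algebra. -/
abbrev grOdd (𝕜 : Type u) [RCLike 𝕜] (n : ℕ) : Submodule 𝕜 (Gr 𝕜 n) :=
  CliffordAlgebra.evenOdd (0 : QuadraticForm 𝕜 (Fin n → 𝕜)) 1

/-- The augmentation (body map) of the Grassmann algebra: it kills the generators. -/
abbrev body {𝕜 : Type u} [RCLike 𝕜] {n : ℕ} : Gr 𝕜 n →ₐ[𝕜] 𝕜 := ExteriorAlgebra.algebraMapInv

/-- The Grassmann algebra is finite-dimensional, so that it has only one norm up to equivalence;
we take the maximum of the coordinates in the standard monomial basis. -/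
instance grNormedAddCommGroup (𝕜 : Type u) [RCLike 𝕜] (n : ℕ) : NormedAddCommGroup (Gr 𝕜 n) :=
  NormedAddCommGroup.induced (Gr 𝕜 n) (Finset (Fin n) → 𝕜)
    (Pi.basisFun 𝕜 (Fin n)).ExteriorAlgebra.equivFun
    (Pi.basisFun 𝕜 (Fin n)).ExteriorAlgebra.equivFun.injective

instance grNormedSpace (𝕜 : Type u) [RCLike 𝕜] (n : ℕ) : NormedSpace 𝕜 (Gr 𝕜 n) :=
  NormedSpace.induced 𝕜 (Gr 𝕜 n) (Finset (Fin n) → 𝕜)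
    (Pi.basisFun 𝕜 (Fin n)).ExteriorAlgebra.equivFun

instance grFiniteDimensional (𝕜 : Type u) [RCLike 𝕜] (n : ℕ) : FiniteDimensional 𝕜 (Gr 𝕜 n) :=
  Module.Finite.of_basis (Pi.basisFun 𝕜 (Fin n)).ExteriorAlgebra

section GrHom

variable {𝕜 : Type u} [RCLike 𝕜]

theorem eq_zero_of_eq_neg {E : Type*} [AddCommGroup E] [Module 𝕜 E] {y : E} (h : y = -y) :
    y = 0 := by
  have h2 : (2 : 𝕜) • y = 0 := by
    rw [two_smul]
    nth_rewrite 1 [h]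
    exact neg_add_cancel y
  exact (smul_eq_zero.1 h2).resolve_left two_ne_zero

theorem mem_grEven {n : ℕ} {a : Gr 𝕜 n} : a ∈ grEven 𝕜 n ↔ CliffordAlgebra.involute a = a := by
  refine ⟨CliffordAlgebra.involute_eq_of_mem_even, fun h => ?_⟩
  obtain ⟨b, hb, c, hc, rfl⟩ := Submodule.mem_sup.1
    ((CliffordAlgebra.evenOdd_isCompl (0 : QuadraticForm 𝕜 (Fin n → 𝕜))).sup_eq_top.ge
      (Submodule.mem_top (x := a)))
  rw [map_add, CliffordAlgebra.involute_eq_of_mem_even hb,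
    CliffordAlgebra.involute_eq_of_mem_odd hc, add_right_inj] at h
  simpa [eq_zero_of_eq_neg (𝕜 := 𝕜) h.symm] using hb

theorem mem_grOdd {n : ℕ} {a : Gr 𝕜 n} : a ∈ grOdd 𝕜 n ↔ CliffordAlgebra.involute a = -a := by
  refine ⟨CliffordAlgebra.involute_eq_of_mem_odd, fun h => ?_⟩
  obtain ⟨b, hb, c, hc, rfl⟩ := Submodule.mem_sup.1
    ((CliffordAlgebra.evenOdd_isCompl (0 : QuadraticForm 𝕜 (Fin n → 𝕜))).sup_eq_top.ge
      (Submodule.mem_top (x := a)))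
  rw [map_add, CliffordAlgebra.involute_eq_of_mem_even hb,
    CliffordAlgebra.involute_eq_of_mem_odd hc, neg_add, add_left_inj] at h
  simpa [eq_zero_of_eq_neg (𝕜 := 𝕜) h] using hc

theorem mul_mem_grEven {n : ℕ} {a b : Gr 𝕜 n} (ha : a ∈ grEven 𝕜 n) (hb : b ∈ grEven 𝕜 n) :
    a * b ∈ grEven 𝕜 n := by
  rw [mem_grEven] at *
  rw [map_mul, ha, hb]

theorem mul_mem_grOdd {n : ℕ} {a b : Gr 𝕜 n} (ha : a ∈ grEven 𝕜 n) (hb : b ∈ grOdd 𝕜 n) :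
    a * b ∈ grOdd 𝕜 n := by
  rw [mem_grEven] at ha
  rw [mem_grOdd] at *
  rw [map_mul, ha, hb, mul_neg]

theorem grEven_comm {n : ℕ} {a : Gr 𝕜 n} (ha : a ∈ grEven 𝕜 n) (b : Gr 𝕜 n) : a * b = b * a := by
  have key (v w : Fin n → 𝕜) : ExteriorAlgebra.ι 𝕜 v * ExteriorAlgebra.ι 𝕜 w =
      -(ExteriorAlgebra.ι 𝕜 w * ExteriorAlgebra.ι 𝕜 v) :=
    eq_neg_of_add_eq_zero_left (ExteriorAlgebra.ι_add_mul_swap v w)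
  have h2 (v w : Fin n → 𝕜) (b : Gr 𝕜 n) :
      ExteriorAlgebra.ι 𝕜 v * ExteriorAlgebra.ι 𝕜 w * b =
        b * (ExteriorAlgebra.ι 𝕜 v * ExteriorAlgebra.ι 𝕜 w) := by
    induction b using ExteriorAlgebra.induction with
    | algebraMap r => exact (Algebra.commutes r _).symm
    | ι x => rw [mul_assoc, key w x, mul_neg, ← mul_assoc, key v x, neg_mul, neg_neg, mul_assoc]
    | mul y z hy hz => rw [← mul_assoc, hy, mul_assoc, hz, mul_assoc]
    | add y z hy hz => rw [mul_add, add_mul, hy, hz]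
  induction a, ha using CliffordAlgebra.even_induction with
  | algebraMap r => exact Algebra.commutes r b
  | add x y _ _ hx hy => rw [add_mul, mul_add, hx, hy]
  | ι_mul_ι_mul v w x _ hx =>
    have h := h2 v w
    simp only [ExteriorAlgebra.ι] at h
    rw [mul_assoc, hx, ← mul_assoc, h b, mul_assoc]

theorem algebraMap_mem_grEven {n : ℕ} (c : 𝕜) : algebraMap 𝕜 (Gr 𝕜 n) c ∈ grEven 𝕜 n := by
  rw [mem_grEven, AlgHom.commutes]

theorem body_involute {n : ℕ} (a : Gr 𝕜 n) : body (CliffordAlgebra.involute a) = body a := by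
  have : (body (𝕜 := 𝕜) (n := n)).comp CliffordAlgebra.involute = body := by
    apply CliffordAlgebra.hom_ext
    ext i
    simp [ExteriorAlgebra.algebraMapInv, ExteriorAlgebra.lift]
  exact DFunLike.congr_fun this a

theorem body_odd {n : ℕ} {a : Gr 𝕜 n} (ha : a ∈ grOdd 𝕜 n) : body a = 0 := by
  have h := body_involute a
  rw [mem_grOdd.1 ha, map_neg] at h
  exact eq_zero_of_eq_neg (𝕜 := 𝕜) h.symm

theorem ι_mem_grOdd {n : ℕ} (v : Fin n → 𝕜) : ExteriorAlgebra.ι 𝕜 v ∈ grOdd 𝕜 n :=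
  CliffordAlgebra.ι_mem_evenOdd_one _ v

theorem ι_fin_zero (v : Fin 0 → 𝕜) : ExteriorAlgebra.ι 𝕜 v = 0 := by
  rw [Subsingleton.elim v 0, map_zero]

theorem gr_zero_eq (a : Gr 𝕜 0) : a = algebraMap 𝕜 _ (body a) := by
  have : AlgHom.id 𝕜 (Gr 𝕜 0) = (Algebra.ofId 𝕜 (Gr 𝕜 0)).comp body := by
    apply ExteriorAlgebra.hom_ext
    ext i
    simp [ι_fin_zero]
  exact DFunLike.congr_fun this a

theorem odd_zero_eq {a : Gr 𝕜 0} (ha : a ∈ grOdd 𝕜 0) : a = 0 := by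
  rw [gr_zero_eq a, body_odd ha, map_zero]

/-- Morphisms of Grassmann algebras: parity-preserving algebra homomorphisms. -/
structure GrHom (𝕜 : Type u) [RCLike 𝕜] (n m : ℕ) where
  toAlgHom : Gr 𝕜 n →ₐ[𝕜] Gr 𝕜 m
  map_even : ∀ a ∈ grEven 𝕜 n, toAlgHom a ∈ grEven 𝕜 m
  map_odd : ∀ a ∈ grOdd 𝕜 n, toAlgHom a ∈ grOdd 𝕜 m

namespace GrHom

theorem ext_ι {n m : ℕ} {ρ σ : GrHom 𝕜 n m}
    (h : ∀ v, ρ.toAlgHom (ExteriorAlgebra.ι 𝕜 v) = σ.toAlgHom (ExteriorAlgebra.ι 𝕜 v)) :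
    ρ = σ := by
  obtain ⟨ρ, _, _⟩ := ρ
  obtain ⟨σ, _, _⟩ := σ
  have : ρ = σ := ExteriorAlgebra.hom_ext (LinearMap.ext h)
  subst this
  rfl

/-- The identity morphism. -/
def id (𝕜 : Type u) [RCLike 𝕜] (n : ℕ) : GrHom 𝕜 n n := ⟨AlgHom.id 𝕜 _, fun _ h => h, fun _ h => h⟩

/-- Composition of morphisms. -/
def comp {n m k : ℕ} (σ : GrHom 𝕜 m k) (ρ : GrHom 𝕜 n m) : GrHom 𝕜 n k :=
  ⟨σ.toAlgHom.comp ρ.toAlgHom, fun a h => σ.map_even _ (ρ.map_even a h),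
    fun a h => σ.map_odd _ (ρ.map_odd a h)⟩

theorem involute_map {n m : ℕ} (ρ : GrHom 𝕜 n m) (a : Gr 𝕜 n) :
    ρ.toAlgHom (CliffordAlgebra.involute a) = CliffordAlgebra.involute (ρ.toAlgHom a) := by
  obtain ⟨b, hb, c, hc, rfl⟩ := Submodule.mem_sup.1
    ((CliffordAlgebra.evenOdd_isCompl (0 : QuadraticForm 𝕜 (Fin n → 𝕜))).sup_eq_top.ge
      (Submodule.mem_top (x := a)))
  simp only [map_add, CliffordAlgebra.involute_eq_of_mem_even hb,
    CliffordAlgebra.involute_eq_of_mem_odd hc, CliffordAlgebra.involute_eq_of_mem_even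
    (ρ.map_even b hb), CliffordAlgebra.involute_eq_of_mem_odd (ρ.map_odd c hc), map_neg]

theorem body_map {n m : ℕ} (ρ : GrHom 𝕜 n m) (a : Gr 𝕜 n) : body (ρ.toAlgHom a) = body a := by
  have : (body (𝕜 := 𝕜) (n := m)).comp ρ.toAlgHom = body := by
    apply ExteriorAlgebra.hom_ext
    ext i
    have h := ρ.map_odd _ (ι_mem_grOdd (Pi.single i 1))
    change body (ρ.toAlgHom (ExteriorAlgebra.ι 𝕜 (Pi.single i 1))) =
      body (ExteriorAlgebra.ι 𝕜 (Pi.single i 1))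
    rw [body_odd h, body_odd (ι_mem_grOdd _)]
  exact DFunLike.congr_fun this a

theorem map_involute {n m : ℕ} (f : (Fin n → 𝕜) →ₗ[𝕜] (Fin m → 𝕜)) (a : Gr 𝕜 n) :
    ExteriorAlgebra.map f (CliffordAlgebra.involute a) =
      CliffordAlgebra.involute (ExteriorAlgebra.map f a) := by
  have : (ExteriorAlgebra.map f).comp CliffordAlgebra.involute =
      (CliffordAlgebra.involute (Q := (0 : QuadraticForm 𝕜 (Fin m → 𝕜)))).comp
        (ExteriorAlgebra.map f) := by
    apply CliffordAlgebra.hom_ext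
    ext i
    have h (k : ℕ) (v : Fin k → 𝕜) : CliffordAlgebra.involute (ExteriorAlgebra.ι 𝕜 v) =
        -ExteriorAlgebra.ι 𝕜 v := CliffordAlgebra.involute_eq_of_mem_odd (ι_mem_grOdd v)
    change ExteriorAlgebra.map f (CliffordAlgebra.involute (ExteriorAlgebra.ι 𝕜 (Pi.single i 1))) =
      CliffordAlgebra.involute (ExteriorAlgebra.map f (ExteriorAlgebra.ι 𝕜 (Pi.single i 1)))
    rw [h, map_neg, ExteriorAlgebra.map_apply_ι, h]
  exact DFunLike.congr_fun this a

/-- The morphism that kills all generators. -/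
def zero (𝕜 : Type u) [RCLike 𝕜] (n m : ℕ) : GrHom 𝕜 n m :=
  ⟨ExteriorAlgebra.map 0, fun a ha => by rw [mem_grEven] at *; rw [← map_involute, ha],
    fun a ha => by rw [mem_grOdd] at *; rw [← map_involute, ha, map_neg]⟩

/-- The augmentation, as a morphism to the Grassmann algebra without generators. -/
abbrev aug (𝕜 : Type u) [RCLike 𝕜] (n : ℕ) : GrHom 𝕜 n 0 := zero 𝕜 n 0

/-- The inclusion of the scalars. -/
abbrev scalars (𝕜 : Type u) [RCLike 𝕜] (n : ℕ) : GrHom 𝕜 0 n := zero 𝕜 0 n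

theorem to_zero_eq {n : ℕ} (ρ : GrHom 𝕜 n 0) : ρ = aug 𝕜 n :=
  ext_ι fun v => by rw [odd_zero_eq (ρ.map_odd _ (ι_mem_grOdd v)),
    odd_zero_eq ((aug 𝕜 n).map_odd _ (ι_mem_grOdd v))]

theorem from_zero_eq {n : ℕ} (ρ : GrHom 𝕜 0 n) : ρ = scalars 𝕜 n :=
  ext_ι fun v => by rw [ι_fin_zero, map_zero, map_zero]

end GrHom

end GrHom

/-! ### Functors on Grassmann algebras and superdomains -/

section Functors

/-- A covariant functor from Grassmann algebras to sets ("functor of points"). The points with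
values in the Grassmann algebra without generators are the ordinary points. -/
structure GrFunctor (𝕜 : Type u) [RCLike 𝕜] where
  pts : ℕ → Type w
  map : ∀ {n m : ℕ}, GrHom 𝕜 n m → pts n → pts m
  map_id : ∀ {n : ℕ} (x : pts n), map (GrHom.id 𝕜 n) x = x
  map_comp : ∀ {n m k : ℕ} (σ : GrHom 𝕜 m k) (ρ : GrHom 𝕜 n m) (x : pts n),
    map (σ.comp ρ) x = map σ (map ρ x)

variable {𝕜 : Type u} [RCLike 𝕜]

/-- Natural transformations. -/
structure GrFunctor.Hom (M : GrFunctor.{u, v} 𝕜) (N : GrFunctor.{u, w} 𝕜) where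
  app : ∀ n, M.pts n → N.pts n
  natural : ∀ {n m : ℕ} (ρ : GrHom 𝕜 n m) (y : M.pts n), app m (M.map ρ y) = N.map ρ (app n y)

/-- Composition of natural transformations. -/
def GrFunctor.Hom.comp {M : GrFunctor.{u, v} 𝕜} {N : GrFunctor.{u, w} 𝕜} {K : GrFunctor.{u, x} 𝕜}
    (g : N.Hom K) (f : M.Hom N) : M.Hom K :=
  ⟨fun n y => g.app n (f.app n y), fun ρ y => by rw [f.natural, g.natural]⟩

/-- The underlying ordinary point of a point with values in a Grassmann algebra. -/
def GrFunctor.base (M : GrFunctor.{u, w} 𝕜) {n : ℕ} (y : M.pts n) : M.pts 0 :=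
  M.map (GrHom.aug 𝕜 n) y

theorem GrFunctor.base_map (M : GrFunctor.{u, w} 𝕜) {n m : ℕ} (ρ : GrHom 𝕜 n m) (y : M.pts n) :
    M.base (M.map ρ y) = M.base y := by
  unfold GrFunctor.base
  rw [← M.map_comp, GrHom.to_zero_eq ((GrHom.aug 𝕜 m).comp ρ)]

/-- The space of points of the standard superspace `𝕜^{p|q}` with values in a Grassmann algebra:
`p` even and `q` odd elements. -/
abbrev Coord (𝕜 : Type u) [RCLike 𝕜] (p q n : ℕ) : Type u :=
  (Fin p → grEven 𝕜 n) × (Fin q → grOdd 𝕜 n)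

/-- The points of `𝕜^{p|q}` whose underlying ordinary point lies in `U`. -/
def domSet {p : ℕ} (U : Opens (Fin p → 𝕜)) (q n : ℕ) : Set (Coord 𝕜 p q n) :=
  {y | (fun i => body (y.1 i : Gr 𝕜 n)) ∈ U}

/-- The superdomain of dimension `p|q` over the open set `U ⊆ 𝕜^p`. -/
def superdomain {p : ℕ} (U : Opens (Fin p → 𝕜)) (q : ℕ) : GrFunctor.{u, u} 𝕜 where
  pts n := domSet U q n
  map ρ y := ⟨(fun i => ⟨ρ.toAlgHom (y.1.1 i), ρ.map_even _ (y.1.1 i).2⟩,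
    fun j => ⟨ρ.toAlgHom (y.1.2 j), ρ.map_odd _ (y.1.2 j).2⟩), by
      have h := y.2
      simp only [domSet, Set.mem_ofPred_eq, GrHom.body_map] at h ⊢
      exact h⟩
  map_id _ := rfl
  map_comp _ _ _ := rfl

/-- The inclusion of a smaller superdomain. -/
def superdomainIncl {p : ℕ} {U' U : Opens (Fin p → 𝕜)} (h : U' ≤ U) (q : ℕ) :
    (superdomain U' q).Hom (superdomain U q) :=
  ⟨fun _ y => ⟨y.1, h y.2⟩, fun _ _ => rfl⟩

/-- The ordinary point `a ∈ U` of a superdomain. -/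
def superdomainPt {p : ℕ} (U : Opens (Fin p → 𝕜)) (q : ℕ) (a : U) : (superdomain U q).pts 0 :=
  ⟨(fun i => ⟨algebraMap 𝕜 _ (a.1 i), algebraMap_mem_grEven _⟩, 0), by
    simp only [domSet, Set.mem_ofPred_eq, AlgHom.commutes]
    exact a.2⟩

/-- A superfunction on a superdomain: a natural family of functions with values in the Grassmann
algebras, each of which is smooth (holomorphic if `𝕜 = ℂ`) with a derivative that is linear over
the even part of the Grassmann algebra. -/
def IsSuperfunction {p : ℕ} (U : Opens (Fin p → 𝕜)) (q : ℕ)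
    (f : ∀ n, (superdomain U q).pts n → Gr 𝕜 n) : Prop :=
  (∀ (n m : ℕ) (ρ : GrHom 𝕜 n m) (y : (superdomain U q).pts n),
    f m ((superdomain U q).map ρ y) = ρ.toAlgHom (f n y)) ∧
  ∀ n, ∃ g : Coord 𝕜 p q n → Gr 𝕜 n,
    (∀ y : (superdomain U q).pts n, g y.1 = f n y) ∧
    ContDiffOn 𝕜 ∞ g (domSet U q n) ∧
    ∀ y ∈ domSet U q n, ∀ a ∈ grEven 𝕜 n, ∀ h h' : Coord 𝕜 p q n,
      (∀ i, (h'.1 i : Gr 𝕜 n) = a * h.1 i) → (∀ j, (h'.2 j : Gr 𝕜 n) = a * h.2 j) →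
      fderiv 𝕜 g y h' = a * fderiv 𝕜 g y h

/-- A morphism of superdomains: all its coordinates are superfunctions. -/
def IsSupersmooth {p q r s : ℕ} {U : Opens (Fin p → 𝕜)} {U' : Opens (Fin r → 𝕜)}
    (f : (superdomain U q).Hom (superdomain U' s)) : Prop :=
  (∀ i, IsSuperfunction U q fun n y => ((f.app n y).1.1 i : Gr 𝕜 n)) ∧
  ∀ j, IsSuperfunction U q fun n y => ((f.app n y).1.2 j : Gr 𝕜 n)

/-- The constant map from a superdomain with value an ordinary point. -/
def constHom {p : ℕ} (U : Opens (Fin p → 𝕜)) (q : ℕ) (M : GrFunctor.{u, w} 𝕜) (a : M.pts 0) :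
    (superdomain U q).Hom M :=
  ⟨fun n _ => M.map (GrHom.scalars 𝕜 n) a, fun ρ _ => by
    rw [← M.map_comp, GrHom.from_zero_eq (ρ.comp _)]⟩

/-- The product of two functors. -/
def GrFunctor.prod (M : GrFunctor.{u, v} 𝕜) (N : GrFunctor.{u, w} 𝕜) : GrFunctor.{u, max v w} 𝕜 where
  pts n := M.pts n × N.pts n
  map ρ y := (M.map ρ y.1, N.map ρ y.2)
  map_id y := by rw [M.map_id, N.map_id]
  map_comp σ ρ y := by rw [M.map_comp, N.map_comp]

/-- A subfunctor. -/
def GrFunctor.sub (M : GrFunctor.{u, w} 𝕜) (S : ∀ n, Set (M.pts n))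
    (hS : ∀ (n m : ℕ) (ρ : GrHom 𝕜 n m), ∀ y ∈ S n, M.map ρ y ∈ S m) : GrFunctor.{u, w} 𝕜 where
  pts n := S n
  map ρ y := ⟨M.map ρ y.1, hS _ _ ρ y.1 y.2⟩
  map_id y := Subtype.ext (M.map_id y.1)
  map_comp σ ρ y := Subtype.ext (M.map_comp σ ρ y.1)

/-- The inclusion of a subfunctor. -/
def GrFunctor.subIncl (M : GrFunctor.{u, w} 𝕜) (S : ∀ n, Set (M.pts n))
    (hS : ∀ (n m : ℕ) (ρ : GrHom 𝕜 n m), ∀ y ∈ S n, M.map ρ y ∈ S m) : (M.sub S hS).Hom M :=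
  ⟨fun _ y => y.1, fun _ _ => rfl⟩

/-- The quotient of a functor by a compatible family of equivalence relations. -/
def GrFunctor.quot (M : GrFunctor.{u, w} 𝕜) (r : ∀ n, Setoid (M.pts n))
    (hr : ∀ (n m : ℕ) (ρ : GrHom 𝕜 n m) (y z : M.pts n), r n y z → r m (M.map ρ y) (M.map ρ z)) :
    GrFunctor.{u, w} 𝕜 where
  pts n := Quotient (r n)
  map ρ := Quotient.map (M.map ρ) (hr _ _ ρ)
  map_id := by rintro n ⟨y⟩; exact congrArg (Quotient.mk (r n)) (M.map_id y)
  map_comp := by rintro n m k σ ρ ⟨y⟩; exact congrArg (Quotient.mk (r k)) (M.map_comp σ ρ y)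

/-- The projection to a quotient. -/
def GrFunctor.quotMk (M : GrFunctor.{u, w} 𝕜) (r : ∀ n, Setoid (M.pts n))
    (hr : ∀ (n m : ℕ) (ρ : GrHom 𝕜 n m) (y z : M.pts n), r n y z → r m (M.map ρ y) (M.map ρ z)) :
    M.Hom (M.quot r hr) :=
  ⟨fun n y => Quotient.mk (r n) y, fun _ _ => rfl⟩

/-! ### Elementary facts on superfunctions -/

theorem isOpen_domSet {p : ℕ} (U : Opens (Fin p → 𝕜)) (q n : ℕ) : IsOpen (domSet U q n) := by
  refine U.isOpen.preimage (continuous_pi fun i => ?_)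
  exact (LinearMap.continuous_of_finiteDimensional (body (𝕜 := 𝕜) (n := n)).toLinearMap).comp
    (continuous_subtype_val.comp ((continuous_apply i).comp continuous_fst))

theorem isSuperfunction_const {p : ℕ} (U : Opens (Fin p → 𝕜)) (q : ℕ) (f : ∀ n, Gr 𝕜 n)
    (hf : ∀ (n m : ℕ) (ρ : GrHom 𝕜 n m), f m = ρ.toAlgHom (f n)) :
    IsSuperfunction U q fun n _ => f n := by
  refine ⟨fun n m ρ _ => hf n m ρ, fun n => ⟨fun _ => f n, fun _ => rfl, contDiffOn_const, ?_⟩⟩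
  intro y _ a _ h h' _ _
  rw [fderiv_const_apply]
  simp

theorem IsSuperfunction.local {p : ℕ} {U : Opens (Fin p → 𝕜)} {q : ℕ}
    {f : ∀ n, (superdomain U q).pts n → Gr 𝕜 n}
    (hf : ∀ a ∈ U, ∃ (U' : Opens (Fin p → 𝕜)) (h : U' ≤ U), a ∈ U' ∧
      IsSuperfunction U' q fun n y => f n ((superdomainIncl h q).app n y)) :
    IsSuperfunction U q f := by
  classical
  constructor
  · intro n m ρ y
    obtain ⟨U', h, ha, hf', -⟩ := hf _ y.2
    exact hf' n m ρ ⟨y.1, ha⟩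
  · intro n
    refine ⟨fun y => if h : y ∈ domSet U q n then f n ⟨y, h⟩ else 0, fun y => ?_, ?_, ?_⟩
    · exact dif_pos y.2
    · intro y hy
      obtain ⟨U', h, ha, -, hf'⟩ := hf _ hy
      obtain ⟨g, hg, hg', -⟩ := hf' n
      have ha' : y ∈ domSet U' q n := ha
      refine ContDiffAt.contDiffWithinAt ?_
      refine (hg'.contDiffAt ((isOpen_domSet U' q n).mem_nhds ha')).congr_of_eventuallyEq ?_
      filter_upwards [(isOpen_domSet U' q n).mem_nhds ha'] with z hz
      exact (dif_pos (show z ∈ domSet U q n from h hz)).trans (hg ⟨z, hz⟩).symm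
    · intro y hy
      obtain ⟨U', h, ha, -, hf'⟩ := hf _ hy
      obtain ⟨g, hg, -, hg'⟩ := hf' n
      have ha' : y ∈ domSet U' q n := ha
      have : (fun y => if h : y ∈ domSet U q n then f n ⟨y, h⟩ else 0) =ᶠ[nhds y] g := by
        filter_upwards [(isOpen_domSet U' q n).mem_nhds ha'] with z hz
        exact (dif_pos (show z ∈ domSet U q n from h hz)).trans (hg ⟨z, hz⟩).symm
      rw [this.fderiv_eq]
      exact hg' y ha'

theorem IsSuperfunction.comp {p q r s : ℕ} {U : Opens (Fin p → 𝕜)} {U' : Opens (Fin r → 𝕜)}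
    {F : ∀ n, (superdomain U' s).pts n → Gr 𝕜 n} (hF : IsSuperfunction U' s F)
    {f : (superdomain U q).Hom (superdomain U' s)} (hf : IsSupersmooth f) :
    IsSuperfunction U q fun n y => F n (f.app n y) := by
  refine ⟨fun n m ρ y => (congrArg (F m) (f.natural ρ y)).trans (hF.1 n m ρ _), fun n => ?_⟩
  obtain ⟨g, hg, hgs, hgd⟩ := hF.2 n
  choose e he hes hed using fun i => (hf.1 i).2 n
  choose o ho hos hod using fun j => (hf.2 j).2 n
  have hc := CliffordAlgebra.evenOdd_isCompl (0 : QuadraticForm 𝕜 (Fin n → 𝕜))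
  let π₀ : Gr 𝕜 n →L[𝕜] grEven 𝕜 n :=
    LinearMap.toContinuousLinearMap (Submodule.projectionOnto _ _ hc)
  let π₁ : Gr 𝕜 n →L[𝕜] grOdd 𝕜 n :=
    LinearMap.toContinuousLinearMap (Submodule.projectionOnto _ _ hc.symm)
  have hπ₀ (z : grEven 𝕜 n) : π₀ z = z := Submodule.projectionOnto_apply_left hc z
  have hπ₁ (z : grOdd 𝕜 n) : π₁ z = z := Submodule.projectionOnto_apply_left hc.symm z
  have hπ₀' (z : grOdd 𝕜 n) : π₀ z = 0 := Submodule.projectionOnto_apply_right hc z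
  have hπ₁' (z : grEven 𝕜 n) : π₁ z = 0 := Submodule.projectionOnto_apply_right hc.symm z
  have key (a : Gr 𝕜 n) (ha : a ∈ grEven 𝕜 n) (z : Gr 𝕜 n) :
      (π₀ (a * z) : Gr 𝕜 n) = a * π₀ z ∧ (π₁ (a * z) : Gr 𝕜 n) = a * π₁ z := by
    obtain ⟨b, hb, c, hc, rfl⟩ := Submodule.mem_sup.1
      (hc.sup_eq_top.ge (Submodule.mem_top (x := z)))
    have h1 := hπ₀ ⟨_, mul_mem_grEven ha hb⟩
    have h2 := hπ₀' ⟨_, mul_mem_grOdd ha hc⟩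
    have h3 := hπ₁ ⟨_, mul_mem_grOdd ha hc⟩
    have h4 := hπ₁' ⟨_, mul_mem_grEven ha hb⟩
    have h5 := hπ₀ ⟨_, hb⟩
    have h6 := hπ₀' ⟨_, hc⟩
    have h7 := hπ₁ ⟨_, hc⟩
    have h8 := hπ₁' ⟨_, hb⟩
    dsimp only at h1 h2 h3 h4 h5 h6 h7 h8
    rw [mul_add, map_add, map_add, map_add, map_add, h1, h2, h3, h4, h5, h6, h7, h8]
    simp
  let G : Coord 𝕜 p q n → Coord 𝕜 r s n :=
    fun y => (fun i => π₀ (e i y), fun j => π₁ (o j y))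
  have hG (y : (superdomain U q).pts n) : G y.1 = (f.app n y).1 := by
    refine Prod.ext (funext fun i => ?_) (funext fun j => ?_)
    · exact (congrArg π₀ (he i y)).trans (hπ₀ _)
    · exact (congrArg π₁ (ho j y)).trans (hπ₁ _)
  have hGm (y) (hy : y ∈ domSet U q n) : G y ∈ domSet U' s n := by
    rw [hG ⟨y, hy⟩]
    exact (f.app n ⟨y, hy⟩).2
  have hGs : ContDiffOn 𝕜 ∞ G (domSet U q n) :=
    (contDiffOn_pi.2 fun i => π₀.contDiff.comp_contDiffOn (hes i)).prodMk
      (contDiffOn_pi.2 fun j => π₁.contDiff.comp_contDiffOn (hos j))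
  refine ⟨fun y => g (G y), fun y => ?_, hgs.comp hGs hGm, ?_⟩
  · change g (G y.1) = F n (f.app n y)
    rw [hG, hg]
  · intro y hy a ha h h' h0 h1
    have hyn := (isOpen_domSet U q n).mem_nhds hy
    have hne : (∞ : WithTop ℕ∞) ≠ 0 := by simp
    have dG : DifferentiableAt 𝕜 G y := (hGs.contDiffAt hyn).differentiableAt hne
    have dg : DifferentiableAt 𝕜 g (G y) := (hgs.contDiffAt
      ((isOpen_domSet U' s n).mem_nhds (hGm y hy))).differentiableAt hne
    have de (i) : DifferentiableAt 𝕜 (e i) y := ((hes i).contDiffAt hyn).differentiableAt hne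
    have dd (j) : DifferentiableAt 𝕜 (o j) y := ((hos j).contDiffAt hyn).differentiableAt hne
    have hd : HasFDerivAt G ((ContinuousLinearMap.pi fun i => π₀.comp (fderiv 𝕜 (e i) y)).prod
        (ContinuousLinearMap.pi fun j => π₁.comp (fderiv 𝕜 (o j) y))) y :=
      (hasFDerivAt_pi.2 fun i => π₀.hasFDerivAt.comp y (de i).hasFDerivAt).prodMk
        (hasFDerivAt_pi.2 fun j => π₁.hasFDerivAt.comp y (dd j).hasFDerivAt)
    have hcomp : fderiv 𝕜 (fun y => g (G y)) y = (fderiv 𝕜 g (G y)).comp (fderiv 𝕜 G y) :=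
      fderiv_comp y dg dG
    rw [hcomp, hd.fderiv]
    refine hgd (G y) (hGm y hy) a ha _ _ (fun i => ?_) (fun j => ?_)
    · change (π₀ (fderiv 𝕜 (e i) y h') : Gr 𝕜 n) = a * π₀ (fderiv 𝕜 (e i) y h)
      rw [hed i y hy a ha h h' h0 h1, (key a ha _).1]
    · change (π₁ (fderiv 𝕜 (o j) y h') : Gr 𝕜 n) = a * π₁ (fderiv 𝕜 (o j) y h)
      rw [hod j y hy a ha h h' h0 h1, (key a ha _).2]

theorem IsSuperfunction.restrict {p q : ℕ} {U U' : Opens (Fin p → 𝕜)} (h : U' ≤ U)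
    {f : ∀ n, (superdomain U q).pts n → Gr 𝕜 n} (hf : IsSuperfunction U q f) :
    IsSuperfunction U' q fun n y => f n ((superdomainIncl h q).app n y) := by
  refine ⟨fun n m ρ y => hf.1 n m ρ ((superdomainIncl h q).app n y), fun n => ?_⟩
  obtain ⟨g, hg, hgs, hgd⟩ := hf.2 n
  exact ⟨g, fun y => hg ((superdomainIncl h q).app n y), hgs.mono fun y hy => h hy, fun y hy => hgd y (h hy)⟩

/-- The map of ordinary points that underlies a map of superdomains. -/
def baseMap {p q r s : ℕ} {U : Opens (Fin p → 𝕜)} {U' : Opens (Fin r → 𝕜)}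
    (f : (superdomain U q).Hom (superdomain U' s)) (a : U) : Fin r → 𝕜 :=
  fun i => body ((f.app 0 (superdomainPt U q a)).1.1 i : Gr 𝕜 0)

theorem baseMap_body {p q r s : ℕ} {U : Opens (Fin p → 𝕜)} {U' : Opens (Fin r → 𝕜)}
    (f : (superdomain U q).Hom (superdomain U' s)) {n : ℕ} (y : (superdomain U q).pts n) :
    baseMap f ⟨_, y.2⟩ = fun i => body ((f.app n y).1.1 i : Gr 𝕜 n) := by
  have h : superdomainPt U q ⟨_, y.2⟩ = (superdomain U q).map (GrHom.aug 𝕜 n) y := by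
    refine Subtype.ext (Prod.ext (funext fun i => Subtype.ext ?_)
      (funext fun j => Subtype.ext ?_))
    · change algebraMap 𝕜 _ (body (y.1.1 i : Gr 𝕜 n)) = (GrHom.aug 𝕜 n).toAlgHom (y.1.1 i)
      rw [← GrHom.body_map (GrHom.aug 𝕜 n), ← gr_zero_eq]
    · exact (odd_zero_eq ((GrHom.aug 𝕜 n).map_odd _ (y.1.2 j).2)).symm
  unfold baseMap
  rw [h, f.natural]
  exact funext fun i => GrHom.body_map _ _

theorem continuous_baseMap {p q r s : ℕ} {U : Opens (Fin p → 𝕜)} {U' : Opens (Fin r → 𝕜)}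
    {f : (superdomain U q).Hom (superdomain U' s)} (hf : IsSupersmooth f) :
    Continuous (baseMap f) := by
  refine continuous_pi fun i => ?_
  obtain ⟨g, hg, hgs, -⟩ := (hf.1 i).2 0
  refine (LinearMap.continuous_of_finiteDimensional (body (𝕜 := 𝕜) (n := 0)).toLinearMap).comp ?_
  have h1 : Continuous fun a : U => (superdomainPt U q a).1 := by
    refine Continuous.prodMk (continuous_pi fun i => ?_) continuous_const
    refine Continuous.subtype_mk ?_ _
    exact (LinearMap.continuous_of_finiteDimensional (Algebra.linearMap 𝕜 (Gr 𝕜 0))).comp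
      ((continuous_apply i).comp continuous_subtype_val)
  have h2 := hgs.continuousOn.comp_continuous h1 fun a => (superdomainPt U q a).2
  exact h2.congr fun a => hg _

/-- The restriction of a map of superdomains to smaller superdomains. -/
def restrictHom {p q r s : ℕ} {U W : Opens (Fin p → 𝕜)} {U' W' : Opens (Fin r → 𝕜)}
    (f : (superdomain U q).Hom (superdomain U' s)) (hW : W ≤ U)
    (hf : ∀ a (ha : a ∈ W), baseMap f ⟨a, hW ha⟩ ∈ W') :
    (superdomain W q).Hom (superdomain W' s) :=
  ⟨fun n y => ⟨(f.app n ⟨y.1, hW y.2⟩).1, by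
    have h := hf _ y.2
    rw [baseMap_body f (n := n) ⟨y.1, hW y.2⟩] at h
    exact h⟩, fun {n _} ρ y => Subtype.ext
      (congrArg Subtype.val (f.natural ρ ((superdomainIncl hW q).app n y)) :)⟩

theorem IsSupersmooth.restrictHom {p q r s : ℕ} {U W : Opens (Fin p → 𝕜)}
    {U' W' : Opens (Fin r → 𝕜)} {f : (superdomain U q).Hom (superdomain U' s)}
    (hs : IsSupersmooth f) (hW : W ≤ U) (hf : ∀ a (ha : a ∈ W), baseMap f ⟨a, hW ha⟩ ∈ W') :
    IsSupersmooth (restrictHom f hW hf) :=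
  ⟨fun i => (hs.1 i).restrict hW, fun j => (hs.2 j).restrict hW⟩

/-! ### Smooth superspaces -/

/-- A (generalized) smooth superspace: a functor of points together with the class of its smooth
maps from superdomains ("plots"), which contains the constant maps, is stable under composition
with morphisms of superdomains and is local. Supermanifolds are the superspaces that are locally
isomorphic to superdomains, see `IsSupermanifold`. -/
structure Space (𝕜 : Type u) [RCLike 𝕜] extends GrFunctor.{u, w} 𝕜 where
  IsPlot : ∀ {p q : ℕ} {U : Opens (Fin p → 𝕜)}, (superdomain U q).Hom toGrFunctor → Prop
  plot_const : ∀ {p : ℕ} (U : Opens (Fin p → 𝕜)) (q : ℕ) (a : pts 0),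
    IsPlot (constHom U q toGrFunctor a)
  plot_comp : ∀ {p q r s : ℕ} {U : Opens (Fin p → 𝕜)} {U' : Opens (Fin r → 𝕜)}
    (f : (superdomain U q).Hom (superdomain U' s)) (φ : (superdomain U' s).Hom toGrFunctor),
    IsSupersmooth f → IsPlot φ → IsPlot (φ.comp f)
  plot_local : ∀ {p q : ℕ} {U : Opens (Fin p → 𝕜)} (φ : (superdomain U q).Hom toGrFunctor),
    (∀ a ∈ U, ∃ (U' : Opens (Fin p → 𝕜)) (h : U' ≤ U), a ∈ U' ∧
      IsPlot (φ.comp (superdomainIncl h q))) → IsPlot φ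

namespace Space

/-- The topology of the set of ordinary points: the finest one for which all plots are
continuous. -/
@[reducible] def topology (M : Space.{u, w} 𝕜) : TopologicalSpace (M.pts 0) :=
  ⨆ (p : ℕ) (q : ℕ) (U : Opens (Fin p → 𝕜))
    (φ : {φ : (superdomain U q).Hom M.toGrFunctor // M.IsPlot φ}),
    TopologicalSpace.coinduced (fun a : U => φ.1.app 0 (superdomainPt U q a)) inferInstance

/-- Smooth maps of superspaces: natural transformations that send plots to plots. -/
structure Hom (M : Space.{u, v} 𝕜) (N : Space.{u, w} 𝕜) extends
    GrFunctor.Hom M.toGrFunctor N.toGrFunctor where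
  smooth : ∀ {p q : ℕ} {U : Opens (Fin p → 𝕜)} (φ : (superdomain U q).Hom M.toGrFunctor),
    M.IsPlot φ → N.IsPlot (toHom.comp φ)

/-- Isomorphisms (diffeomorphisms, biholomorphisms) of superspaces. -/
structure Iso (M : Space.{u, v} 𝕜) (N : Space.{u, w} 𝕜) where
  hom : M.Hom N
  inv : N.Hom M
  inv_hom : ∀ (n : ℕ) (y : M.pts n), inv.app n (hom.app n y) = y
  hom_inv : ∀ (n : ℕ) (y : N.pts n), hom.app n (inv.app n y) = y

/-- A superdomain as a superspace: the plots are the morphisms of superdomains. -/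
def ofDomain {p : ℕ} (U : Opens (Fin p → 𝕜)) (q : ℕ) : Space.{u, u} 𝕜 where
  toGrFunctor := superdomain U q
  IsPlot f := IsSupersmooth f
  plot_const V r a :=
    ⟨fun i => isSuperfunction_const V r
        (fun n => (GrHom.scalars 𝕜 n).toAlgHom (a.1.1 i)) fun n m ρ => by
          rw [← GrHom.from_zero_eq (ρ.comp (GrHom.scalars 𝕜 n))]; rfl,
      fun j => isSuperfunction_const V r
        (fun n => (GrHom.scalars 𝕜 n).toAlgHom (a.1.2 j)) fun n m ρ => by
          rw [← GrHom.from_zero_eq (ρ.comp (GrHom.scalars 𝕜 n))]; rfl⟩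
  plot_comp _ _ hf hφ := ⟨fun i => (hφ.1 i).comp hf, fun j => (hφ.2 j).comp hf⟩
  plot_local _ h :=
    ⟨fun i => IsSuperfunction.local fun a ha =>
        let ⟨U', hU, ha', hφ⟩ := h a ha
        ⟨U', hU, ha', hφ.1 i⟩,
      fun j => IsSuperfunction.local fun a ha =>
        let ⟨U', hU, ha', hφ⟩ := h a ha
        ⟨U', hU, ha', hφ.2 j⟩⟩

/-- The product of two superspaces. -/
def prod (M : Space.{u, v} 𝕜) (N : Space.{u, w} 𝕜) : Space.{u, max v w} 𝕜 where
  toGrFunctor := M.toGrFunctor.prod N.toGrFunctor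
  IsPlot φ :=
    M.IsPlot ⟨fun n y => (φ.app n y).1, fun ρ y => congrArg Prod.fst (φ.natural ρ y)⟩ ∧
    N.IsPlot ⟨fun n y => (φ.app n y).2, fun ρ y => congrArg Prod.snd (φ.natural ρ y)⟩
  plot_const U q a := ⟨M.plot_const U q a.1, N.plot_const U q a.2⟩
  plot_comp f _ hf hφ := ⟨M.plot_comp f _ hf hφ.1, N.plot_comp f _ hf hφ.2⟩
  plot_local _ h :=
    ⟨M.plot_local _ fun a ha =>
        let ⟨U', hU, ha', hφ⟩ := h a ha
        ⟨U', hU, ha', hφ.1⟩,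
      N.plot_local _ fun a ha =>
        let ⟨U', hU, ha', hφ⟩ := h a ha
        ⟨U', hU, ha', hφ.2⟩⟩

/-- A subfunctor of a superspace, with the induced smooth structure: a plot is a plot of the
ambient superspace that takes values in the subfunctor. -/
def sub (M : Space.{u, w} 𝕜) (S : ∀ n, Set (M.pts n))
    (hS : ∀ (n m : ℕ) (ρ : GrHom 𝕜 n m), ∀ y ∈ S n, M.map ρ y ∈ S m) : Space.{u, w} 𝕜 where
  toGrFunctor := M.toGrFunctor.sub S hS
  IsPlot φ := M.IsPlot ((M.toGrFunctor.subIncl S hS).comp φ)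
  plot_const U q a := M.plot_const U q a.1
  plot_comp f _ hf hφ := M.plot_comp f _ hf hφ
  plot_local _ h := M.plot_local _ h

/-- The part of a superspace that lies over a set of ordinary points (an open subspace if the set
is open). -/
def restrict (M : Space.{u, w} 𝕜) (A : Set (M.pts 0)) : Space.{u, w} 𝕜 :=
  M.sub (fun _ => {y | M.base y ∈ A}) fun _ _ ρ y hy => by
    have h : M.base (M.map ρ y) = M.base y := M.base_map ρ y
    rw [Set.mem_ofPred_eq, h]
    exact hy

/-- The quotient of a superspace by a compatible family of equivalence relations, with the
quotient smooth structure: a plot is a map that lifts, locally, to a plot of the given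
superspace. -/
def quot (M : Space.{u, w} 𝕜) (r : ∀ n, Setoid (M.pts n))
    (hr : ∀ (n m : ℕ) (ρ : GrHom 𝕜 n m) (y z : M.pts n), r n y z → r m (M.map ρ y) (M.map ρ z)) :
    Space.{u, w} 𝕜 where
  toGrFunctor := M.toGrFunctor.quot r hr
  IsPlot {p q U} φ := ∀ a ∈ U, ∃ (U' : Opens (Fin p → 𝕜)) (h : U' ≤ U)
    (ψ : (superdomain U' q).Hom M.toGrFunctor), a ∈ U' ∧ M.IsPlot ψ ∧
      (M.toGrFunctor.quotMk r hr).comp ψ = φ.comp (superdomainIncl h q)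
  plot_const U q := by
    rintro ⟨b⟩ a ha
    exact ⟨U, le_rfl, constHom U q M.toGrFunctor b, ha, M.plot_const U q b, rfl⟩
  plot_comp {p q r s U U'} f φ hf hφ a ha := by
    have hb : baseMap f ⟨a, ha⟩ ∈ U' := (f.app 0 (superdomainPt U q ⟨a, ha⟩)).2
    obtain ⟨V, hV, ψ, hbV, hψ, hψφ⟩ := hφ _ hb
    let W : Opens (Fin p → 𝕜) := ⟨Subtype.val '' (baseMap f ⁻¹' V),
      U.isOpen.isOpenMap_subtype_val _ (V.isOpen.preimage (continuous_baseMap hf))⟩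
    have hW : W ≤ U := by
      rintro _ ⟨c, -, rfl⟩
      exact c.2
    have hfW : ∀ c (hc : c ∈ W), baseMap f ⟨c, hW hc⟩ ∈ V := by
      rintro _ ⟨c, hc, rfl⟩
      exact hc
    refine ⟨W, hW, ψ.comp (restrictHom f hW hfW), ⟨⟨a, ha⟩, hbV, rfl⟩,
      M.plot_comp _ _ (hf.restrictHom hW hfW) hψ, ?_⟩
    exact congrArg (fun χ => χ.comp (restrictHom f hW hfW)) hψφ
  plot_local φ h a ha := by
    obtain ⟨U', hU, ha', hφ⟩ := h a ha
    obtain ⟨U'', hU', ψ, ha'', hψ, hψφ⟩ := hφ a ha'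
    exact ⟨U'', hU'.trans hU, ψ, ha'', hψ, hψφ⟩

/-- A supermanifold (real and smooth if `𝕜 = ℝ`, holomorphic if `𝕜 = ℂ`): a superspace that is
locally isomorphic to superdomains and whose space of ordinary points is Hausdorff and
second-countable. -/
def IsSupermanifold (M : Space.{u, w} 𝕜) : Prop :=
  @T2Space _ M.topology ∧ @SecondCountableTopology _ M.topology ∧
  ∀ a : M.pts 0, ∃ A : Set (M.pts 0), IsOpen[M.topology] A ∧ a ∈ A ∧
    ∃ (p q : ℕ) (U : Opens (Fin p → 𝕜)), Nonempty ((ofDomain U q).Iso (M.restrict A))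

/-- A fibre bundle of supermanifolds with fibre `F`: over the members of an open cover of the base
the projection is isomorphic to the projection from the product with `F`. -/
def IsFiberBundle {E : Space.{u, v} 𝕜} {B : Space.{u, w} 𝕜} (π : E.Hom B) (F : Space.{u, x} 𝕜) :
    Prop :=
  E.IsSupermanifold ∧ B.IsSupermanifold ∧ F.IsSupermanifold ∧
  ∀ b : B.pts 0, ∃ A : Set (B.pts 0), IsOpen[B.topology] A ∧ b ∈ A ∧
    ∃ Θ : (E.restrict (π.app 0 ⁻¹' A)).Iso ((B.restrict A).prod F),
      ∀ (n : ℕ) (y : (E.restrict (π.app 0 ⁻¹' A)).pts n),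
        (Θ.hom.app n y).1.1 = π.app n y.1

end Space

end Functors

/-! ### Vector superspaces -/

/-- A (finite-dimensional) vector superspace: a vector space that is the direct sum of an even and
an odd subspace. -/
structure VectorSuperspace (𝕜 : Type u) [RCLike 𝕜] where
  carrier : Type v
  [addCommGroup : AddCommGroup carrier]
  [module : Module 𝕜 carrier]
  [finiteDimensional : FiniteDimensional 𝕜 carrier]
  even : Submodule 𝕜 carrier
  odd : Submodule 𝕜 carrier
  isCompl : IsCompl even odd

namespace VectorSuperspace

attribute [instance] addCommGroup module finiteDimensional

variable {𝕜 : Type u} [RCLike 𝕜]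

/-- The projection to the even part. -/
def evenProj (V : VectorSuperspace.{u, v} 𝕜) : V.carrier →ₗ[𝕜] V.carrier :=
  V.even.projection V.odd V.isCompl

/-- The projection to the odd part. -/
def oddProj (V : VectorSuperspace.{u, v} 𝕜) : V.carrier →ₗ[𝕜] V.carrier :=
  V.odd.projection V.even V.isCompl.symm

/-- The extension of scalars of a vector superspace to a Grassmann algebra. -/
abbrev Ext (V : VectorSuperspace.{u, v} 𝕜) (n : ℕ) : Type max u v := Gr 𝕜 n ⊗[𝕜] V.carrier

/-- The even part of the extension of scalars: these are the points of `V`, regarded as a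
supermanifold, with values in the Grassmann algebra. -/
def points (V : VectorSuperspace.{u, v} 𝕜) (n : ℕ) : Submodule 𝕜 (V.Ext n) :=
  LinearMap.range (TensorProduct.map (grEven 𝕜 n).subtype V.even.subtype) ⊔
  LinearMap.range (TensorProduct.map (grOdd 𝕜 n).subtype V.odd.subtype)

/-- Functoriality of the extension of scalars. -/
def extMap (V : VectorSuperspace.{u, v} 𝕜) {n m : ℕ} (ρ : GrHom 𝕜 n m) : V.Ext n →ₗ[𝕜] V.Ext m :=
  LinearMap.rTensor V.carrier ρ.toAlgHom.toLinearMap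

/-- The coordinate with values in the Grassmann algebra defined by a linear functional. -/
def coord (V : VectorSuperspace.{u, v} 𝕜) (b : V.carrier →ₗ[𝕜] 𝕜) (n : ℕ) : V.Ext n →ₗ[𝕜] Gr 𝕜 n :=
  (TensorProduct.rid 𝕜 (Gr 𝕜 n)).toLinearMap ∘ₗ LinearMap.lTensor (Gr 𝕜 n) b

theorem extMap_mem (V : VectorSuperspace.{u, v} 𝕜) {n m : ℕ} (ρ : GrHom 𝕜 n m) (y : V.Ext n)
    (hy : y ∈ V.points n) : V.extMap ρ y ∈ V.points m := by
  obtain ⟨_, ⟨b, rfl⟩, _, ⟨c, rfl⟩, rfl⟩ := Submodule.mem_sup.1 hy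
  clear hy
  rw [map_add]
  refine add_mem (Submodule.mem_sup_left ?_) (Submodule.mem_sup_right ?_)
  · refine ⟨TensorProduct.map (ρ.toAlgHom.toLinearMap.restrict ρ.map_even) LinearMap.id b, ?_⟩
    induction b with
    | zero => simp only [map_zero]
    | add b c hb hc => simp only [map_add, hb, hc]
    | tmul a z => rfl
  · refine ⟨TensorProduct.map (ρ.toAlgHom.toLinearMap.restrict ρ.map_odd) LinearMap.id c, ?_⟩
    induction c with
    | zero => simp only [map_zero]
    | add b c hb hc => simp only [map_add, hb, hc]
    | tmul a z => rfl

theorem coord_extMap (V : VectorSuperspace.{u, v} 𝕜) (b : V.carrier →ₗ[𝕜] 𝕜) {n m : ℕ}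
    (ρ : GrHom 𝕜 n m) (y : V.Ext n) : V.coord b m (V.extMap ρ y) = ρ.toAlgHom (V.coord b n y) := by
  induction y using TensorProduct.induction_on with
  | zero => simp only [map_zero]
  | add y z hy hz => simp only [map_add, hy, hz]
  | tmul a z => simp [coord, extMap]

theorem extMap_smul (V : VectorSuperspace.{u, v} 𝕜) {n m : ℕ} (ρ : GrHom 𝕜 n m) (a : Gr 𝕜 n)
    (y : V.Ext n) : V.extMap ρ (a • y) = ρ.toAlgHom a • V.extMap ρ y := by
  induction y using TensorProduct.induction_on with
  | zero => simp only [map_zero, smul_zero]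
  | add y z hy hz => simp only [map_add, smul_add, hy, hz]
  | tmul c z => simp [extMap, TensorProduct.smul_tmul']

/-- A vector superspace as a superspace: the functor of its points with values in Grassmann
algebras; a map from a superdomain is smooth if its coordinates are superfunctions. -/
def toSpace (V : VectorSuperspace.{u, v} 𝕜) : Space.{u, max u v} 𝕜 where
  pts n := V.points n
  map ρ y := ⟨V.extMap ρ y.1, V.extMap_mem ρ y.1 y.2⟩
  map_id y := Subtype.ext (LinearMap.rTensor_id_apply V.carrier _ y.1)
  map_comp σ ρ y := Subtype.ext (LinearMap.rTensor_comp_apply V.carrier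
    σ.toAlgHom.toLinearMap ρ.toAlgHom.toLinearMap y.1)
  IsPlot {p q U} φ := ∀ b : V.carrier →ₗ[𝕜] 𝕜,
    IsSuperfunction U q fun n y => V.coord b n (φ.app n y).1
  plot_const U q a b := isSuperfunction_const U q
    (fun n => V.coord b n (V.extMap (GrHom.scalars 𝕜 n) a.1)) fun n m ρ => by
      rw [coord_extMap, coord_extMap, ← GrHom.from_zero_eq (ρ.comp (GrHom.scalars 𝕜 n))]
      rfl
  plot_comp _ _ hf hφ b := (hφ b).comp hf
  plot_local _ h b := IsSuperfunction.local fun a ha =>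
    let ⟨U', hU, ha', hφ⟩ := h a ha
    ⟨U', hU, ha', hφ b⟩

/-- The open subspace of non-zero vectors of a vector superspace. -/
def nonzero (V : VectorSuperspace.{u, v} 𝕜) : Space.{u, max u v} 𝕜 :=
  V.toSpace.restrict {y | y.1 ≠ 0}

/-- The tensor product of two vector superspaces. -/
@[reducible] def tensor (V : VectorSuperspace.{u, v} 𝕜) (W : VectorSuperspace.{u, w} 𝕜) :
    VectorSuperspace.{u, max v w} 𝕜 where
  carrier := V.carrier ⊗[𝕜] W.carrier
  even := LinearMap.range (TensorProduct.map V.even.subtype W.even.subtype) ⊔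
    LinearMap.range (TensorProduct.map V.odd.subtype W.odd.subtype)
  odd := LinearMap.range (TensorProduct.map V.even.subtype W.odd.subtype) ⊔
    LinearMap.range (TensorProduct.map V.odd.subtype W.even.subtype)
  isCompl := by
    constructor
    · let σ := TensorProduct.map (V.evenProj - V.oddProj) (W.evenProj - W.oddProj)
      have hV0 (y : V.even) : (V.evenProj - V.oddProj) y = y := by
        simp [evenProj, oddProj]
      have hV1 (y : V.odd) : (V.evenProj - V.oddProj) y = -y := by
        simp [evenProj, oddProj]
      have hW0 (y : W.even) : (W.evenProj - W.oddProj) y = y := by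
        simp [evenProj, oddProj]
      have hW1 (y : W.odd) : (W.evenProj - W.oddProj) y = -y := by
        simp [evenProj, oddProj]
      rw [Submodule.disjoint_def]
      intro y h0 h1
      have e0 : σ y = y := by
        obtain ⟨_, ⟨b, rfl⟩, _, ⟨c, rfl⟩, rfl⟩ := Submodule.mem_sup.1 h0
        rw [map_add]
        congr 1
        · exact LinearMap.congr_fun (f := σ ∘ₗ TensorProduct.map V.even.subtype W.even.subtype)
            (g := TensorProduct.map V.even.subtype W.even.subtype)
            (TensorProduct.ext' fun y z => congrArg₂ (· ⊗ₜ[𝕜] ·) (hV0 y) (hW0 z)) _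
        · exact LinearMap.congr_fun (f := σ ∘ₗ TensorProduct.map V.odd.subtype W.odd.subtype)
            (g := TensorProduct.map V.odd.subtype W.odd.subtype)
            (TensorProduct.ext' fun y z => (congrArg₂ (· ⊗ₜ[𝕜] ·) (hV1 y) (hW1 z)).trans (by
              rw [TensorProduct.neg_tmul, TensorProduct.tmul_neg, neg_neg]; rfl)) _
      have e1 : σ y = -y := by
        obtain ⟨_, ⟨b, rfl⟩, _, ⟨c, rfl⟩, rfl⟩ := Submodule.mem_sup.1 h1
        rw [map_add, neg_add, ← LinearMap.neg_apply, ← LinearMap.neg_apply]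
        congr 1
        · exact LinearMap.congr_fun (f := σ ∘ₗ TensorProduct.map V.even.subtype W.odd.subtype)
            (g := -TensorProduct.map V.even.subtype W.odd.subtype)
            (TensorProduct.ext' fun y z => (congrArg₂ (· ⊗ₜ[𝕜] ·) (hV0 y) (hW1 z)).trans (by
              rw [TensorProduct.tmul_neg]; rfl)) _
        · exact LinearMap.congr_fun (f := σ ∘ₗ TensorProduct.map V.odd.subtype W.even.subtype)
            (g := -TensorProduct.map V.odd.subtype W.even.subtype)
            (TensorProduct.ext' fun y z => (congrArg₂ (· ⊗ₜ[𝕜] ·) (hV1 y) (hW0 z)).trans (by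
              rw [TensorProduct.neg_tmul]; rfl)) _
      exact eq_zero_of_eq_neg (𝕜 := 𝕜) (e0.symm.trans e1)
    · rw [codisjoint_iff, eq_top_iff, ← TensorProduct.span_tmul_eq_top, Submodule.span_le]
      rintro _ ⟨y, z, rfl⟩
      obtain ⟨y0, hy0, y1, hy1, rfl⟩ := Submodule.mem_sup.1
        (V.isCompl.sup_eq_top.ge (Submodule.mem_top (x := y)))
      obtain ⟨z0, hz0, z1, hz1, rfl⟩ := Submodule.mem_sup.1
        (W.isCompl.sup_eq_top.ge (Submodule.mem_top (x := z)))
      rw [TensorProduct.add_tmul, TensorProduct.tmul_add, TensorProduct.tmul_add]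
      refine add_mem (add_mem ?_ ?_) (add_mem ?_ ?_)
      · exact Submodule.mem_sup_left (Submodule.mem_sup_left ⟨⟨y0, hy0⟩ ⊗ₜ ⟨z0, hz0⟩, rfl⟩)
      · exact Submodule.mem_sup_right (Submodule.mem_sup_left ⟨⟨y0, hy0⟩ ⊗ₜ ⟨z1, hz1⟩, rfl⟩)
      · exact Submodule.mem_sup_right (Submodule.mem_sup_right ⟨⟨y1, hy1⟩ ⊗ₜ ⟨z0, hz0⟩, rfl⟩)
      · exact Submodule.mem_sup_left (Submodule.mem_sup_right ⟨⟨y1, hy1⟩ ⊗ₜ ⟨z1, hz1⟩, rfl⟩)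

/-- The product `v ⊗ w` of vectors of the extensions of `V` and `W` to a Grassmann algebra, with
values in the extension of `V ⊗ W`. It is bilinear over `𝕜` and satisfies the sign rule
`(a ⊗ v) (b ⊗ w) = (-1)^{|v| |b|} a b ⊗ (v ⊗ w)`. -/
def superTmul (V : VectorSuperspace.{u, v} 𝕜) (W : VectorSuperspace.{u, w} 𝕜) {n : ℕ} :
    V.Ext n →ₗ[𝕜] W.Ext n →ₗ[𝕜] (V.tensor W).Ext n :=
  TensorProduct.curry
    (TensorProduct.map (LinearMap.mul' 𝕜 (Gr 𝕜 n)) LinearMap.id ∘ₗ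
      (TensorProduct.tensorTensorTensorComm 𝕜 (Gr 𝕜 n) V.carrier (Gr 𝕜 n) W.carrier).toLinearMap ∘ₗ
        (TensorProduct.map (LinearMap.lTensor (Gr 𝕜 n) V.evenProj) LinearMap.id +
          TensorProduct.map (LinearMap.lTensor (Gr 𝕜 n) V.oddProj)
            (LinearMap.rTensor W.carrier CliffordAlgebra.involute.toLinearMap)))

theorem superTmul_tmul (V : VectorSuperspace.{u, v} 𝕜) (W : VectorSuperspace.{u, w} 𝕜) {n : ℕ}
    (a b : Gr 𝕜 n) (y : V.carrier) (z : W.carrier) :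
    V.superTmul W (a ⊗ₜ y) (b ⊗ₜ z) = (a * b) ⊗ₜ (V.evenProj y ⊗ₜ z) +
      (a * CliffordAlgebra.involute b) ⊗ₜ (V.oddProj y ⊗ₜ z) := by
  simp [superTmul]

theorem extMap_superTmul (V : VectorSuperspace.{u, v} 𝕜) (W : VectorSuperspace.{u, w} 𝕜) {n m : ℕ}
    (ρ : GrHom 𝕜 n m) (y : V.Ext n) (z : W.Ext n) :
    (V.tensor W).extMap ρ (V.superTmul W y z) = V.superTmul W (V.extMap ρ y) (W.extMap ρ z) := by
  induction y using TensorProduct.induction_on with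
  | zero => simp only [map_zero, LinearMap.zero_apply]
  | add y y' hy hy' => simp only [map_add, LinearMap.add_apply, hy, hy']
  | tmul a y =>
    induction z using TensorProduct.induction_on with
    | zero => simp only [map_zero]
    | add z z' hz hz' => simp only [map_add, hz, hz']
    | tmul b z =>
      simp only [superTmul_tmul, map_add, extMap, LinearMap.rTensor_tmul, AlgHom.toLinearMap_apply,
        map_mul, GrHom.involute_map]

end VectorSuperspace

/-! ### The weighted projective superspace -/

section Projective

variable {𝕜 : Type u} [RCLike 𝕜]

/-- The group `𝕜^*` with values in a Grassmann algebra: its invertible even elements. -/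
abbrev Gm (𝕜 : Type u) [RCLike 𝕜] (n : ℕ) : Type u :=
  (CliffordAlgebra.even (0 : QuadraticForm 𝕜 (Fin n → 𝕜)))ˣ

/-- The element of the Grassmann algebra given by an element of the group. -/
def Gm.val {n : ℕ} (c : Gm 𝕜 n) : Gr 𝕜 n :=
  ((c : CliffordAlgebra.even (0 : QuadraticForm 𝕜 (Fin n → 𝕜))) : Gr 𝕜 n)

theorem Gm.val_one {n : ℕ} : (1 : Gm 𝕜 n).val = 1 := rfl

theorem Gm.mul_comm' {n : ℕ} (c d : Gm 𝕜 n) : c * d = d * c :=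
  Units.ext (Subtype.ext (grEven_comm (Units.val c).2 _))

theorem Gm.val_mul {n : ℕ} (c d : Gm 𝕜 n) : (c * d).val = c.val * d.val := rfl

/-- Functoriality of the group. -/
def Gm.map {n m : ℕ} (ρ : GrHom 𝕜 n m) (c : Gm 𝕜 n) : Gm 𝕜 m where
  val := ⟨ρ.toAlgHom c.val, ρ.map_even _ (Units.val c).2⟩
  inv := ⟨ρ.toAlgHom c⁻¹.val, ρ.map_even _ (Units.val c⁻¹).2⟩
  val_inv := Subtype.ext (by
    change ρ.toAlgHom c.val * ρ.toAlgHom c⁻¹.val = 1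
    rw [← map_mul, ← Gm.val_mul, mul_inv_cancel, Gm.val_one, map_one])
  inv_val := Subtype.ext (by
    change ρ.toAlgHom c⁻¹.val * ρ.toAlgHom c.val = 1
    rw [← map_mul, ← Gm.val_mul, inv_mul_cancel, Gm.val_one, map_one])

theorem Gm.val_map {n m : ℕ} (ρ : GrHom 𝕜 n m) (c : Gm 𝕜 n) :
    (Gm.map ρ c).val = ρ.toAlgHom c.val := rfl

theorem Gm.val_map_inv {n m : ℕ} (ρ : GrHom 𝕜 n m) (c : Gm 𝕜 n) :
    (Gm.map ρ c)⁻¹.val = ρ.toAlgHom c⁻¹.val := rfl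

namespace VectorSuperspace

/-- Two non-zero vectors are proportional. -/
def projSetoid (V : VectorSuperspace.{u, v} 𝕜) (n : ℕ) : Setoid (V.nonzero.pts n) where
  r y z := ∃ c : Gm 𝕜 n, z.1.1 = c.val • y.1.1
  iseqv :=
    { refl := fun y => ⟨1, by rw [Gm.val_one, one_smul]⟩
      symm := by
        rintro y z ⟨c, hc⟩
        exact ⟨c⁻¹, by rw [hc, smul_smul, ← Gm.val_mul, inv_mul_cancel, Gm.val_one, one_smul]⟩
      trans := by
        rintro y z t ⟨c, hc⟩ ⟨d, hd⟩
        exact ⟨d * c, by rw [hd, hc, smul_smul, Gm.val_mul]⟩ }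

theorem projSetoid_map (V : VectorSuperspace.{u, v} 𝕜) (n m : ℕ) (ρ : GrHom 𝕜 n m)
    (y z : V.nonzero.pts n) (h : V.projSetoid n y z) :
    V.projSetoid m (V.nonzero.map ρ y) (V.nonzero.map ρ z) := by
  obtain ⟨c, hc⟩ := h
  exact ⟨Gm.map ρ c, (congrArg (V.extMap ρ) hc).trans (V.extMap_smul ρ _ _)⟩

/-- The projectivization `P(V)`: the quotient of the space of non-zero vectors by `𝕜^*`. -/
def proj (V : VectorSuperspace.{u, v} 𝕜) : Space.{u, max u v} 𝕜 :=
  V.nonzero.quot V.projSetoid V.projSetoid_map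

/-- The point `[v]` of `P(V)`. -/
def projMk (V : VectorSuperspace.{u, v} 𝕜) {n : ℕ} (y : V.nonzero.pts n) : V.proj.pts n :=
  Quotient.mk (V.projSetoid n) y

/-- The line (free submodule of rank one) that corresponds to a point of `P(V)`. It is the fibre of
the tautological bundle `E_V` at this point. -/
def line (V : VectorSuperspace.{u, v} 𝕜) {n : ℕ} (l : V.proj.pts n) :
    Submodule (Gr 𝕜 n) (V.Ext n) :=
  Quotient.lift (s := V.projSetoid n) (fun y => Submodule.span (Gr 𝕜 n) {y.1.1}) (by
    rintro y z ⟨c, hc⟩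
    refine le_antisymm ?_ ?_
    · rw [Submodule.span_singleton_le_iff_mem, Submodule.mem_span_singleton]
      exact ⟨c⁻¹.val, by rw [hc, smul_smul, ← Gm.val_mul, inv_mul_cancel, Gm.val_one, one_smul]⟩
    · rw [Submodule.span_singleton_le_iff_mem, Submodule.mem_span_singleton]
      exact ⟨c.val, hc.symm⟩) l

/-- The fibre of the bundle `E_V ⊗ W` at a point of `P(V)`, as a submodule of the extension of
`V ⊗ W`: it is generated by the products of the vectors of the line with the vectors of `W`. -/
def tautTensorFiber (V : VectorSuperspace.{u, v} 𝕜) (W : VectorSuperspace.{u, w} 𝕜) {n : ℕ}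
    (l : V.proj.pts n) : Submodule (Gr 𝕜 n) ((V.tensor W).Ext n) :=
  Submodule.span (Gr 𝕜 n) {t | ∃ y ∈ V.line l, ∃ z : W.Ext n, t = V.superTmul W y z}

theorem extMap_mem_tautTensorFiber (V : VectorSuperspace.{u, v} 𝕜) (W : VectorSuperspace.{u, w} 𝕜)
    {n m : ℕ} (ρ : GrHom 𝕜 n m) (l : V.proj.pts n) (t : (V.tensor W).Ext n)
    (ht : t ∈ V.tautTensorFiber W l) :
    (V.tensor W).extMap ρ t ∈ V.tautTensorFiber W (V.proj.map ρ l) := by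
  induction ht using Submodule.span_induction with
  | mem t ht =>
    obtain ⟨y, hy, z, rfl⟩ := ht
    refine Submodule.subset_span ⟨V.extMap ρ y, ?_, W.extMap ρ z, V.extMap_superTmul W ρ y z⟩
    obtain ⟨d⟩ := l
    obtain ⟨c, rfl⟩ := Submodule.mem_span_singleton.1 hy
    exact Submodule.mem_span_singleton.2 ⟨ρ.toAlgHom c, (V.extMap_smul ρ _ _).symm⟩
  | zero => rw [map_zero]; exact zero_mem _
  | add t t' _ _ ht ht' => rw [map_add]; exact add_mem ht ht'
  | smul c t _ ht => rw [extMap_smul]; exact Submodule.smul_mem _ _ ht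

/-- The total space of the vector bundle `E_V ⊗ W` over `P(V)`, as a subspace of the trivial bundle
`P(V) × (V ⊗ W)`. -/
def tautTensor (V : VectorSuperspace.{u, v} 𝕜) (W : VectorSuperspace.{u, w} 𝕜) :
    Space.{u, max u v w} 𝕜 :=
  (V.proj.prod (V.tensor W).toSpace).sub
    (fun _ => {t | t.2.1 ∈ V.tautTensorFiber W t.1})
    fun _ _ ρ t ht => V.extMap_mem_tautTensorFiber W ρ t.1 t.2.1 ht

/-- The total space `(E_V ⊗ W)_0` of the bundle of non-zero vectors of `E_V ⊗ W`. -/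
def tautTensorNonzero (V : VectorSuperspace.{u, v} 𝕜) (W : VectorSuperspace.{u, w} 𝕜) :
    Space.{u, max u v w} 𝕜 :=
  (V.tautTensor W).restrict {t | t.1.2.1 ≠ 0}

/-- The projection of `(E_V ⊗ W)_0` to `P(V)`. -/
def tautTensorProj (V : VectorSuperspace.{u, v} 𝕜) (W : VectorSuperspace.{u, w} 𝕜) :
    (V.tautTensorNonzero W).Hom V.proj where
  app _ t := t.1.1.1
  natural _ _ := rfl
  smooth _ hφ := hφ.1

/-- The equivalence relation `(v, w) ∼ (c v, c⁻¹ w)`. -/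
def wprojSetoid (V : VectorSuperspace.{u, v} 𝕜) (W : VectorSuperspace.{u, w} 𝕜) (n : ℕ) :
    Setoid ((V.nonzero.prod W.nonzero).pts n) where
  r y z := ∃ c : Gm 𝕜 n, z.1.1.1 = c.val • y.1.1.1 ∧ z.2.1.1 = c⁻¹.val • y.2.1.1
  iseqv :=
    { refl := fun y => ⟨1, by rw [Gm.val_one, one_smul], by rw [inv_one, Gm.val_one, one_smul]⟩
      symm := by
        rintro y z ⟨c, hc, hc'⟩
        exact ⟨c⁻¹, by rw [hc, smul_smul, ← Gm.val_mul, inv_mul_cancel, Gm.val_one, one_smul],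
          by rw [hc', smul_smul, ← Gm.val_mul, inv_mul_cancel, Gm.val_one, one_smul]⟩
      trans := by
        rintro y z t ⟨c, hc, hc'⟩ ⟨d, hd, hd'⟩
        exact ⟨c * d, by rw [hd, hc, smul_smul, Gm.mul_comm', Gm.val_mul],
          by rw [hd', hc', smul_smul, mul_inv_rev, Gm.val_mul]⟩ }

theorem wprojSetoid_map (V : VectorSuperspace.{u, v} 𝕜) (W : VectorSuperspace.{u, w} 𝕜) (n m : ℕ)
    (ρ : GrHom 𝕜 n m) (y z : (V.nonzero.prod W.nonzero).pts n) (h : V.wprojSetoid W n y z) :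
    V.wprojSetoid W m ((V.nonzero.prod W.nonzero).map ρ y) ((V.nonzero.prod W.nonzero).map ρ z) := by
  obtain ⟨c, hc, hc'⟩ := h
  exact ⟨Gm.map ρ c, (congrArg (V.extMap ρ) hc).trans (V.extMap_smul ρ _ _),
    (congrArg (W.extMap ρ) hc').trans (W.extMap_smul ρ _ _)⟩

/-- The weighted projective superspace `P_{+1,-1}(V ⊕ W)`: the quotient of the product of the
spaces of non-zero vectors by the action `c • (v, w) = (c v, c⁻¹ w)` of `𝕜^*`. -/
def wproj (V : VectorSuperspace.{u, v} 𝕜) (W : VectorSuperspace.{u, w} 𝕜) :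
    Space.{u, max u v w} 𝕜 :=
  (V.nonzero.prod W.nonzero).quot (V.wprojSetoid W) (V.wprojSetoid_map W)

/-- The point `[v‖w]` of the weighted projective superspace. -/
def wprojMk (V : VectorSuperspace.{u, v} 𝕜) (W : VectorSuperspace.{u, w} 𝕜) {n : ℕ}
    (y : V.nonzero.pts n) (z : W.nonzero.pts n) : (V.wproj W).pts n :=
  Quotient.mk (V.wprojSetoid W n) (y, z)

end VectorSuperspace

end Projective

end Super

end

/-! All arguments take place on points with values in Grassmann algebras. An even Grassmann element
is its body plus a nilpotent element, so it is invertible exactly when its body is nonzero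
(`isUnit_of_body_ne_zero`, `Gm.body_ne_zero`). The inverse is again even, and the inverse of an
invertible superfunction is a superfunction (`IsSuperfunction.inverse`). Hence the classical recipe
of dividing by an even coordinate `v_i` works wherever its body is nonzero. Every vector in `V_0`
has such a coordinate, because the underlying ordinary vector is purely even.

The heart of the matter is that the vector `v_i w` does not change under `(v, w) ↦ (λ v, λ⁻¹ w)`.
Where `v_i` is invertible, `[v]` and `v_i w` together determine `[v‖w]`, and `v_i w` can be any
vector of `W_0`. So `[v‖w] ↦ ([v], v_i w)` is a local trivialization (`affineTriv`). Plots are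
matched by lifting `[v]` locally to `v` and solving for `w` (`isPlot_wproj_of_scale`). The
normalization `v_i = 1` gives the affine charts of `P(V)` (`affineChart`); products of these with
the single chart of `W_0` form a finite atlas of the total space. The Hausdorff property comes from
complete continuous invariants of ordinary points: the Hermitian projection to the line of `v`,
together with the products `v_k w_l`.

The product `v ⊗ w` is invariant as well, and the fibre of `E_V ⊗ W` over `[v]` consists of the
vectors `v ⊗ z` (`exists_superTmul_of_mem_tautTensorFiber`). This uses that `v` is even in total
degree, so that scalars pass through it without sign (`superTmul_smul_right`). Contracting `v ⊗ w`
with the `i`-th even coordinate gives back `v_i w` (`contract_wprojTensor`): the fibre coordinate of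
the trivialization can be read off from the image. Injectivity and the smoothness of the inverse
follow.

The statement over `P(W)` is the statement over `P(V)` with the factors exchanged, transported along
`[v‖w] ↦ [w‖v]` (`wprojSwap`). -/

noncomputable section

namespace Super

universe u v w x

/-! ### Grassmann algebras -/

section Grassmann

variable {𝕜 : Type u} [RCLike 𝕜] {n m : ℕ}

theorem involute_mem_grEven {a : Gr 𝕜 n} (ha : a ∈ grEven 𝕜 n) :
    CliffordAlgebra.involute a = a := mem_grEven.1 ha

theorem involute_mem_grOdd {a : Gr 𝕜 n} (ha : a ∈ grOdd 𝕜 n) :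
    CliffordAlgebra.involute a = -a := mem_grOdd.1 ha

/-- Odd elements supercommute with all elements. -/
theorem grOdd_mul_involute {a : Gr 𝕜 n} (ha : a ∈ grOdd 𝕜 n) (b : Gr 𝕜 n) :
    a * CliffordAlgebra.involute b = b * a := by
  have key (v w : Fin n → 𝕜) : ExteriorAlgebra.ι 𝕜 v * ExteriorAlgebra.ι 𝕜 w =
      -(ExteriorAlgebra.ι 𝕜 w * ExteriorAlgebra.ι 𝕜 v) :=
    eq_neg_of_add_eq_zero_left (ExteriorAlgebra.ι_add_mul_swap v w)
  have h1 (v : Fin n → 𝕜) (b : Gr 𝕜 n) :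
      ExteriorAlgebra.ι 𝕜 v * CliffordAlgebra.involute b = b * ExteriorAlgebra.ι 𝕜 v := by
    induction b using ExteriorAlgebra.induction with
    | algebraMap r => rw [AlgHom.commutes]; exact (Algebra.commutes r _).symm
    | ι x => rw [involute_mem_grOdd (ι_mem_grOdd x), mul_neg, key x v]
    | mul y z hy hz => rw [map_mul, ← mul_assoc, hy, mul_assoc, hz, mul_assoc]
    | add y z hy hz => rw [map_add, mul_add, add_mul, hy, hz]
  -- An odd element is a sum of generators multiplied by even products, and even products are
  -- central; so the case of one generator suffices.
  induction a, ha using CliffordAlgebra.odd_induction with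
  | ι v => exact h1 v b
  | add x y _ _ hx hy => rw [add_mul, mul_add, hx, hy]
  | ι_mul_ι_mul v w x _ hx =>
    have h := grEven_comm (CliffordAlgebra.ι_mul_ι_mem_evenOdd_zero
      (0 : QuadraticForm 𝕜 (Fin n → 𝕜)) v w) b
    rw [mul_assoc, hx, ← mul_assoc, h, mul_assoc]

/-- Even elements commute, so nilpotency is stable under sums. A product `ι v * ι w * x` with `x`
even squares to zero, because centrality of `ι v * ι w` brings the two factors `ι v` together. -/
theorem isNilpotent_sub_body {a : Gr 𝕜 n} (ha : a ∈ grEven 𝕜 n) :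
    IsNilpotent (a - algebraMap 𝕜 _ (body a)) := by
  induction a, ha using CliffordAlgebra.even_induction with
  | algebraMap r =>
    rw [AlgHom.commutes]
    simp
  | add x y hx hy ihx ihy =>
    rw [map_add, map_add, add_sub_add_comm]
    refine Commute.isNilpotent_add ?_ ihx ihy
    exact grEven_comm (Submodule.sub_mem _ hx (algebraMap_mem_grEven _)) _
  | ι_mul_ι_mul v w x hx _ =>
    have hb : body (CliffordAlgebra.ι (0 : QuadraticForm 𝕜 (Fin n → 𝕜)) v *
        CliffordAlgebra.ι 0 w * x) = 0 := by
      rw [map_mul, map_mul, body_odd (CliffordAlgebra.ι_mem_evenOdd_one _ v), zero_mul, zero_mul]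
    rw [hb, map_zero, sub_zero]
    refine ⟨2, ?_⟩
    have h := grEven_comm (CliffordAlgebra.ι_mul_ι_mem_evenOdd_zero
      (0 : QuadraticForm 𝕜 (Fin n → 𝕜)) v w)
    have h0 : CliffordAlgebra.ι (0 : QuadraticForm 𝕜 (Fin n → 𝕜)) v * CliffordAlgebra.ι 0 v = 0 := by
      simp
    have h2 : CliffordAlgebra.ι (0 : QuadraticForm 𝕜 (Fin n → 𝕜)) v * CliffordAlgebra.ι 0 w *
        (CliffordAlgebra.ι 0 v * CliffordAlgebra.ι 0 w) = 0 := by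
      rw [← mul_assoc, h, ← mul_assoc, h0, zero_mul, zero_mul]
    rw [pow_two, mul_assoc, ← mul_assoc x, ← h x, mul_assoc _ x, ← mul_assoc, h2, zero_mul]

theorem isUnit_of_body_ne_zero {a : Gr 𝕜 n} (ha : a ∈ grEven 𝕜 n) (hb : body a ≠ 0) :
    IsUnit a := by
  have h := (isNilpotent_sub_body ha).isUnit_add_left_of_commute
    (u := algebraMap 𝕜 (Gr 𝕜 n) (body a)) ((IsUnit.mk0 _ hb).map _)
    (Algebra.commutes (body a) _).symm
  rwa [add_sub_cancel] at h

/-- Evenness means being fixed by the parity involution, and an automorphism that fixes a unit fixes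
its inverse. -/
theorem inverse_mem_grEven {a : Gr 𝕜 n} (ha : a ∈ grEven 𝕜 n) (hb : body a ≠ 0) :
    Ring.inverse a ∈ grEven 𝕜 n := by
  have h := isUnit_of_body_ne_zero ha hb
  rw [mem_grEven]
  refine h.mul_left_cancel ?_
  nth_rewrite 1 [← mem_grEven.1 ha]
  rw [← map_mul, Ring.mul_inverse_cancel a h, map_one]

theorem map_inverse (f : Gr 𝕜 n →ₐ[𝕜] Gr 𝕜 m) {a : Gr 𝕜 n} (h : IsUnit a) :
    f (Ring.inverse a) = Ring.inverse (f a) := by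
  refine (h.map f).mul_left_cancel ?_
  rw [← map_mul, Ring.mul_inverse_cancel a h, map_one, Ring.mul_inverse_cancel _ (h.map f)]

theorem body_inverse {a : Gr 𝕜 n} (h : IsUnit a) : body (Ring.inverse a) = (body a)⁻¹ := by
  have h1 : body a * body (Ring.inverse a) = 1 := by
    rw [← map_mul, Ring.mul_inverse_cancel a h, map_one]
  exact eq_inv_of_mul_eq_one_right h1

theorem exists_gm {a : Gr 𝕜 n} (ha : a ∈ grEven 𝕜 n) (hb : body a ≠ 0) :
    ∃ c : Gm 𝕜 n, c.val = a ∧ c⁻¹.val = Ring.inverse a := by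
  have h := isUnit_of_body_ne_zero ha hb
  exact ⟨⟨⟨a, ha⟩, ⟨_, inverse_mem_grEven ha hb⟩, Subtype.ext (Ring.mul_inverse_cancel a h),
    Subtype.ext (Ring.inverse_mul_cancel a h)⟩, rfl, rfl⟩

theorem Gm.val_mem (c : Gm 𝕜 n) : c.val ∈ grEven 𝕜 n := (Units.val c).2

theorem Gm.val_mul_inv (c : Gm 𝕜 n) : c.val * c⁻¹.val = 1 := by
  rw [← Gm.val_mul, mul_inv_cancel, Gm.val_one]

theorem Gm.inv_mul_val (c : Gm 𝕜 n) : c⁻¹.val * c.val = 1 := by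
  rw [← Gm.val_mul, inv_mul_cancel, Gm.val_one]

theorem Gm.body_ne_zero (c : Gm 𝕜 n) : body c.val ≠ 0 := fun h => by
  have := congrArg body c.val_mul_inv
  rw [map_mul, h, zero_mul, map_one] at this
  exact zero_ne_one this

/-- Multiplication in the Grassmann algebra as a continuous bilinear map. -/
def grMul (𝕜 : Type u) [RCLike 𝕜] (n : ℕ) : Gr 𝕜 n →L[𝕜] Gr 𝕜 n →L[𝕜] Gr 𝕜 n :=
  LinearMap.toContinuousLinearMap
    ((LinearMap.toContinuousLinearMap (𝕜 := 𝕜) (E := Gr 𝕜 n) (F' := Gr 𝕜 n)).toLinearMap ∘ₗ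
      LinearMap.mul 𝕜 (Gr 𝕜 n))

@[simp] theorem grMul_apply (a b : Gr 𝕜 n) : grMul 𝕜 n a b = a * b := rfl

/-- The Grassmann algebra is normed here only as a vector space. Left multiplication embeds it into
the Banach algebra of its continuous endomorphisms, where inversion is known to be smooth; this and
the next lemmas move inverses between the two. -/
theorem grMul_mul (a b : Gr 𝕜 n) : grMul 𝕜 n (a * b) = grMul 𝕜 n a * grMul 𝕜 n b :=
  ContinuousLinearMap.ext fun c => mul_assoc a b c

theorem grMul_one : grMul 𝕜 n 1 = 1 := ContinuousLinearMap.ext fun c => one_mul c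

theorem isUnit_grMul {a : Gr 𝕜 n} (h : IsUnit a) : IsUnit (grMul 𝕜 n a) :=
  ⟨⟨grMul 𝕜 n a, grMul 𝕜 n (Ring.inverse a),
    by rw [← grMul_mul, Ring.mul_inverse_cancel a h, grMul_one],
    by rw [← grMul_mul, Ring.inverse_mul_cancel a h, grMul_one]⟩, rfl⟩

theorem inverse_grMul {a : Gr 𝕜 n} (h : IsUnit a) :
    Ring.inverse (grMul 𝕜 n a) = grMul 𝕜 n (Ring.inverse a) := by
  refine (isUnit_grMul h).mul_left_cancel ?_
  rw [Ring.mul_inverse_cancel _ (isUnit_grMul h), ← grMul_mul, Ring.mul_inverse_cancel a h,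
    grMul_one]

end Grassmann

/-! ### Operations on superfunctions -/

section Superfunctions

variable {𝕜 : Type u} [RCLike 𝕜] {p q : ℕ} {U : Opens (Fin p → 𝕜)}
  {f g : ∀ n, (superdomain U q).pts n → Gr 𝕜 n}

theorem differentiableAt_of_contDiffOn {n : ℕ} {F : Coord 𝕜 p q n → Gr 𝕜 n}
    (hF : ContDiffOn 𝕜 ∞ F (domSet U q n)) {y : Coord 𝕜 p q n} (hy : y ∈ domSet U q n) :
    DifferentiableAt 𝕜 F y :=
  (hF.contDiffAt ((isOpen_domSet U q n).mem_nhds hy)).differentiableAt (by simp)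

theorem IsSuperfunction.congr (hf : IsSuperfunction U q f) (h : ∀ n y, g n y = f n y) :
    IsSuperfunction U q g := by
  obtain rfl : g = f := funext fun n => funext fun y => h n y
  exact hf

theorem IsSuperfunction.add (hf : IsSuperfunction U q f) (hg : IsSuperfunction U q g) :
    IsSuperfunction U q fun n y => f n y + g n y := by
  refine ⟨fun n m ρ y => by dsimp only; rw [hf.1, hg.1, map_add], fun n => ?_⟩
  obtain ⟨F, hF, hFs, hFd⟩ := hf.2 n
  obtain ⟨G, hG, hGs, hGd⟩ := hg.2 n
  refine ⟨fun y => F y + G y, fun y => congrArg₂ (· + ·) (hF y) (hG y), hFs.add hGs, ?_⟩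
  intro y hy a ha h h' h0 h1
  rw [fderiv_fun_add (differentiableAt_of_contDiffOn hFs hy) (differentiableAt_of_contDiffOn hGs hy),
    add_apply, add_apply, hFd y hy a ha h h' h0 h1,
    hGd y hy a ha h h' h0 h1, mul_add]

theorem fderiv_grMul {E : Type*} [NormedAddCommGroup E] [NormedSpace 𝕜 E] {n : ℕ}
    {F G : E → Gr 𝕜 n} {y : E} (hF : DifferentiableAt 𝕜 F y) (hG : DifferentiableAt 𝕜 G y) (k : E) :
    fderiv 𝕜 (fun y => grMul 𝕜 n (F y) (G y)) y k =
      F y * fderiv 𝕜 G y k + fderiv 𝕜 F y k * G y := by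
  rw [((grMul 𝕜 n).hasFDerivAt_of_bilinear hF.hasFDerivAt hG.hasFDerivAt).fderiv]
  rfl

theorem IsSuperfunction.mul (hf : IsSuperfunction U q f) (hg : IsSuperfunction U q g) :
    IsSuperfunction U q fun n y => f n y * g n y := by
  refine ⟨fun n m ρ y => by dsimp only; rw [hf.1, hg.1, map_mul], fun n => ?_⟩
  obtain ⟨F, hF, hFs, hFd⟩ := hf.2 n
  obtain ⟨G, hG, hGs, hGd⟩ := hg.2 n
  refine ⟨fun y => grMul 𝕜 n (F y) (G y), fun y => congrArg₂ (· * ·) (hF y) (hG y),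
    ((grMul 𝕜 n).contDiff.comp_contDiffOn hFs).clm_apply hGs, ?_⟩
  intro y hy a ha h h' h0 h1
  have hdF := differentiableAt_of_contDiffOn hFs hy
  have hdG := differentiableAt_of_contDiffOn hGs hy
  rw [fderiv_grMul hdF hdG, fderiv_grMul hdF hdG]
  -- In the Leibniz rule the scalar `a` has to be moved to the left of `F y`, which is possible
  -- because `a` is even.
  rw [hFd y hy a ha h h' h0 h1, hGd y hy a ha h h' h0 h1, mul_add, ← mul_assoc, ← mul_assoc,
    ← mul_assoc, grEven_comm ha (F y)]

/-- Superfunctions can be composed with natural operations that are linear over the even part of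
the Grassmann algebra. -/
theorem IsSuperfunction.map (hf : IsSuperfunction U q f) (T : ∀ n, Gr 𝕜 n →ₗ[𝕜] Gr 𝕜 n)
    (hT : ∀ (n m : ℕ) (ρ : GrHom 𝕜 n m) (a : Gr 𝕜 n), T m (ρ.toAlgHom a) = ρ.toAlgHom (T n a))
    (hT' : ∀ (n : ℕ), ∀ a ∈ grEven 𝕜 n, ∀ b, T n (a * b) = a * T n b) :
    IsSuperfunction U q fun n y => T n (f n y) := by
  refine ⟨fun n m ρ y => by dsimp only; rw [hf.1, hT], fun n => ?_⟩
  obtain ⟨F, hF, hFs, hFd⟩ := hf.2 n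
  let T' : Gr 𝕜 n →L[𝕜] Gr 𝕜 n := LinearMap.toContinuousLinearMap (T n)
  refine ⟨fun y => T' (F y), fun y => congrArg T' (hF y), T'.contDiff.comp_contDiffOn hFs, ?_⟩
  intro y hy a ha h h' h0 h1
  have hd : fderiv 𝕜 (fun y => T' (F y)) y = T'.comp (fderiv 𝕜 F y) :=
    (T'.hasFDerivAt.comp y (differentiableAt_of_contDiffOn hFs hy).hasFDerivAt).fderiv
  rw [hd]
  change T n (fderiv 𝕜 F y h') = a * T n (fderiv 𝕜 F y h)
  rw [hFd y hy a ha h h' h0 h1, hT' n a ha]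

theorem IsSuperfunction.involute (hf : IsSuperfunction U q f) :
    IsSuperfunction U q fun n y => CliffordAlgebra.involute (f n y) :=
  hf.map (fun _ => CliffordAlgebra.involute.toLinearMap) (fun _ _ ρ a => (ρ.involute_map a).symm)
    fun _ a ha b => by
      simp only [AlgHom.toLinearMap_apply, map_mul, involute_mem_grEven ha]

theorem IsSuperfunction.const_smul (hf : IsSuperfunction U q f) (c : 𝕜) :
    IsSuperfunction U q fun n y => c • f n y :=
  hf.map (fun _ => c • LinearMap.id) (fun _ _ ρ a => (map_smul ρ.toAlgHom c a).symm)
    fun _ a _ b => (mul_smul_comm c a b).symm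

theorem isSuperfunction_scalar (U : Opens (Fin p → 𝕜)) (q : ℕ) (c : 𝕜) :
    IsSuperfunction U q fun n _ => algebraMap 𝕜 (Gr 𝕜 n) c :=
  isSuperfunction_const U q _ fun _ _ ρ => (ρ.toAlgHom.commutes c).symm

theorem IsSuperfunction.sum {ι : Type*} (s : Finset ι)
    {f : ι → ∀ n, (superdomain U q).pts n → Gr 𝕜 n} (hf : ∀ i ∈ s, IsSuperfunction U q (f i)) :
    IsSuperfunction U q fun n y => ∑ i ∈ s, f i n y := by
  classical
  induction s using Finset.induction_on with
  | empty => exact (isSuperfunction_scalar U q 0).congr fun n y => by simp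
  | insert i s hi ih =>
    refine ((hf i (Finset.mem_insert_self i s)).add
      (ih fun j hj => hf j (Finset.mem_insert_of_mem hj))).congr fun n y => ?_
    rw [Finset.sum_insert hi]

/-- Smoothness is inherited from inversion of operators, and linearity of the derivative over the
even part follows by differentiating `F * G = 1`. -/
theorem IsSuperfunction.inverse (hf : IsSuperfunction U q f) (hu : ∀ n y, IsUnit (f n y)) :
    IsSuperfunction U q fun n y => Ring.inverse (f n y) := by
  refine ⟨fun n m ρ y => by dsimp only; rw [hf.1, map_inverse _ (hu n y)], fun n => ?_⟩
  obtain ⟨F, hF, hFs, hFd⟩ := hf.2 n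
  have huF (y) (hy : y ∈ domSet U q n) : IsUnit (F y) := by
    have := hu n ⟨y, hy⟩
    rwa [← hF ⟨y, hy⟩] at this
  -- The inverse is obtained by applying the inverse operator to `1`. Outside the domain `F y` need
  -- not be a unit, and the value there plays no role.
  let G : Coord 𝕜 p q n → Gr 𝕜 n := fun y => Ring.inverse (grMul 𝕜 n (F y)) 1
  have hG (y) (hy : y ∈ domSet U q n) : G y = Ring.inverse (F y) := by
    change Ring.inverse (grMul 𝕜 n (F y)) 1 = _
    rw [inverse_grMul (huF y hy), grMul_apply, mul_one]
  have hGs : ContDiffOn 𝕜 ∞ G (domSet U q n) := by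
    have : CompleteSpace (Gr 𝕜 n) := FiniteDimensional.complete 𝕜 _
    refine ContDiffOn.clm_apply (fun y hy => ?_) contDiffOn_const
    obtain ⟨b, hb⟩ := isUnit_grMul (huF y hy)
    have h1 := contDiffAt_ringInverse 𝕜 (n := ∞) b
    rw [hb] at h1
    exact h1.comp_contDiffWithinAt y ((grMul 𝕜 n).contDiff.comp_contDiffOn hFs y hy)
  refine ⟨G, fun y => (hG y.1 y.2).trans (congrArg Ring.inverse (hF y)), hGs, ?_⟩
  intro y hy a ha h h' h0 h1
  have h1' : (fun z => grMul 𝕜 n (F z) (G z)) =ᶠ[nhds y] fun _ => 1 := by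
    filter_upwards [(isOpen_domSet U q n).mem_nhds hy] with z hz
    rw [hG z hz, grMul_apply, Ring.mul_inverse_cancel _ (huF z hz)]
  have key (k : Coord 𝕜 p q n) : F y * fderiv 𝕜 G y k = -(fderiv 𝕜 F y k * G y) := by
    have := fderiv_grMul (differentiableAt_of_contDiffOn hFs hy)
      (differentiableAt_of_contDiffOn hGs hy) k
    rw [h1'.fderiv_eq, fderiv_const_apply, zero_apply] at this
    exact eq_neg_of_add_eq_zero_left this.symm
  -- By `key`, multiplying by the unit `F y` turns the derivative of `G` into that of `F`, whose
  -- linearity is known.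
  refine (huF y hy).mul_left_cancel ?_
  rw [key, hFd y hy a ha h h' h0 h1, ← mul_assoc, ← grEven_comm ha (F y), mul_assoc a (F y), key,
    mul_neg, mul_assoc]

theorem isSuperfunction_even (U : Opens (Fin p → 𝕜)) (q : ℕ) (i : Fin p) :
    IsSuperfunction U q fun n y => (y.1.1 i : Gr 𝕜 n) := by
  refine ⟨fun _ _ _ _ => rfl, fun n => ?_⟩
  let T : Coord 𝕜 p q n →L[𝕜] Gr 𝕜 n := (grEven 𝕜 n).subtypeL.comp
    ((ContinuousLinearMap.proj i).comp (ContinuousLinearMap.fst 𝕜 _ _))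
  refine ⟨T, fun _ => rfl, T.contDiff.contDiffOn, ?_⟩
  intro y _ a _ h h' h0 _
  rw [T.fderiv]
  exact h0 i

theorem isSuperfunction_odd (U : Opens (Fin p → 𝕜)) (q : ℕ) (j : Fin q) :
    IsSuperfunction U q fun n y => (y.1.2 j : Gr 𝕜 n) := by
  refine ⟨fun _ _ _ _ => rfl, fun n => ?_⟩
  let T : Coord 𝕜 p q n →L[𝕜] Gr 𝕜 n := (grOdd 𝕜 n).subtypeL.comp
    ((ContinuousLinearMap.proj j).comp (ContinuousLinearMap.snd 𝕜 _ _))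
  refine ⟨T, fun _ => rfl, T.contDiff.contDiffOn, ?_⟩
  intro y _ a _ h h' _ h1
  rw [T.fderiv]
  exact h1 j

theorem superdomainPt_body {n : ℕ} (y : (superdomain U q).pts n) :
    superdomainPt U q ⟨_, y.2⟩ = (superdomain U q).map (GrHom.aug 𝕜 n) y := by
  refine Subtype.ext (Prod.ext (funext fun i => Subtype.ext ?_)
    (funext fun j => Subtype.ext ?_))
  · change algebraMap 𝕜 _ (body (y.1.1 i : Gr 𝕜 n)) = (GrHom.aug 𝕜 n).toAlgHom (y.1.1 i)
    rw [← GrHom.body_map (GrHom.aug 𝕜 n), ← gr_zero_eq]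
  · exact (odd_zero_eq ((GrHom.aug 𝕜 n).map_odd _ (y.1.2 j).2)).symm

theorem continuous_superdomainPt (U : Opens (Fin p → 𝕜)) (q : ℕ) :
    Continuous fun a : U => (superdomainPt U q a).1 := by
  refine Continuous.prodMk (continuous_pi fun i => ?_) continuous_const
  refine Continuous.subtype_mk ?_ _
  exact (LinearMap.continuous_of_finiteDimensional (Algebra.linearMap 𝕜 (Gr 𝕜 0))).comp
    ((continuous_apply i).comp continuous_subtype_val)

theorem IsSuperfunction.continuous_body (hf : IsSuperfunction U q f) :
    Continuous fun a : U => body (f 0 (superdomainPt U q a)) := by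
  obtain ⟨g, hg, hgs, -⟩ := hf.2 0
  refine (LinearMap.continuous_of_finiteDimensional (body (𝕜 := 𝕜) (n := 0)).toLinearMap).comp ?_
  have h2 := hgs.continuousOn.comp_continuous (continuous_superdomainPt U q)
    fun a => (superdomainPt U q a).2
  exact h2.congr fun a => hg _

end Superfunctions

/-! ### Superspaces: ordinary points, isomorphisms, quotients, topology and atlases. -/

section Spaces

variable {𝕜 : Type u} [RCLike 𝕜]

theorem GrFunctor.Hom.ext {M : GrFunctor.{u, v} 𝕜} {N : GrFunctor.{u, w} 𝕜} {f g : M.Hom N}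
    (h : ∀ n y, f.app n y = g.app n y) : f = g := by
  obtain ⟨f, _⟩ := f
  obtain ⟨g, _⟩ := g
  obtain rfl : f = g := funext fun n => funext fun y => h n y
  rfl

theorem GrFunctor.Hom.base_app {M : GrFunctor.{u, v} 𝕜} {N : GrFunctor.{u, w} 𝕜} (f : M.Hom N)
    {n : ℕ} (y : M.pts n) : N.base (f.app n y) = f.app 0 (M.base y) := (f.natural _ y).symm

theorem GrFunctor.Hom.base_app_superdomain {p q : ℕ} {U : Opens (Fin p → 𝕜)}
    {M : GrFunctor.{u, v} 𝕜} (f : (superdomain U q).Hom M) {n : ℕ} (y : (superdomain U q).pts n) :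
    M.base (f.app n y) = f.app 0 (superdomainPt U q ⟨_, y.2⟩) := by
  rw [superdomainPt_body]
  exact f.base_app y

theorem GrFunctor.base_zero (M : GrFunctor.{u, v} 𝕜) (y : M.pts 0) : M.base y = y := by
  unfold GrFunctor.base
  rw [← GrHom.to_zero_eq (GrHom.id 𝕜 0), M.map_id]

theorem superdomainPt_body_zero {p q : ℕ} {U : Opens (Fin p → 𝕜)} (y : (superdomain U q).pts 0) :
    superdomainPt U q ⟨_, y.2⟩ = y := by
  rw [superdomainPt_body]
  exact (superdomain U q).base_zero y

theorem superdomainPt_injective {p : ℕ} (U : Opens (Fin p → 𝕜)) (q : ℕ) :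
    Function.Injective (superdomainPt U q) := by
  intro a b h
  refine Subtype.ext (funext fun i => ?_)
  have h1 := congrArg (fun y => body (y.1.1 i : Gr 𝕜 0)) h
  have h2 (c : U) : body ((superdomainPt U q c).1.1 i : Gr 𝕜 0) = c.1 i := AlgHom.commutes _ _
  rwa [h2, h2] at h1

namespace Space

variable {M : Space.{u, v} 𝕜} {N : Space.{u, w} 𝕜}

/-! ### Isomorphisms -/

/-- The composition of smooth maps. -/
def Hom.comp {K : Space.{u, x} 𝕜} (g : N.Hom K) (f : M.Hom N) : M.Hom K where
  toHom := g.toHom.comp f.toHom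
  smooth φ hφ := g.smooth _ (f.smooth φ hφ)

/-- A bijective smooth map that detects plots is an isomorphism. -/
def Iso.ofBijective (f : M.Hom N) (hf : ∀ n, Function.Bijective (f.app n))
    (hp : ∀ {p q : ℕ} {U : Opens (Fin p → 𝕜)} (φ : (superdomain U q).Hom M.toGrFunctor),
      N.IsPlot (f.toHom.comp φ) → M.IsPlot φ) : M.Iso N where
  hom := f
  inv :=
    { app := fun n => (Equiv.ofBijective _ (hf n)).symm
      natural := fun {n m} ρ y => by
        obtain ⟨z, rfl⟩ := (hf n).2 y
        rw [← f.natural]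
        erw [Equiv.ofBijective_symm_apply_apply, Equiv.ofBijective_symm_apply_apply]
      -- The inverse followed by `f` is the identity, so `hp` applies to the inverse image of a
      -- plot.
      smooth := fun φ hφ => hp _ (by
        convert hφ using 1
        exact GrFunctor.Hom.ext fun n y => Equiv.ofBijective_apply_symm_apply _ (hf n) _) }
  inv_hom n y := Equiv.ofBijective_symm_apply_apply _ (hf n) y
  hom_inv n y := Equiv.ofBijective_apply_symm_apply _ (hf n) y

/-- The inverse isomorphism. -/
def Iso.symm (f : M.Iso N) : N.Iso M := ⟨f.inv, f.hom, f.hom_inv, f.inv_hom⟩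

/-- The composition of isomorphisms. -/
def Iso.trans {K : Space.{u, x} 𝕜} (f : M.Iso N) (g : N.Iso K) : M.Iso K where
  hom := g.hom.comp f.hom
  inv := f.inv.comp g.inv
  inv_hom n y := (congrArg (f.inv.app n) (g.inv_hom n _)).trans (f.inv_hom n y)
  hom_inv n y := (congrArg (g.hom.app n) (f.hom_inv n _)).trans (g.hom_inv n y)

universe v' w'

/-- The product of isomorphisms. -/
def Iso.prodCongr {M' : Space.{u, v'} 𝕜} {N' : Space.{u, w'} 𝕜} (f : M.Iso N) (g : M'.Iso N') :
    (M.prod M').Iso (N.prod N') where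
  hom :=
    { app := fun n y => (f.hom.app n y.1, g.hom.app n y.2)
      natural := fun ρ y => Prod.ext (f.hom.natural ρ y.1) (g.hom.natural ρ y.2)
      smooth := fun _ hφ => ⟨f.hom.smooth _ hφ.1, g.hom.smooth _ hφ.2⟩ }
  inv :=
    { app := fun n y => (f.inv.app n y.1, g.inv.app n y.2)
      natural := fun ρ y => Prod.ext (f.inv.natural ρ y.1) (g.inv.natural ρ y.2)
      smooth := fun _ hφ => ⟨f.inv.smooth _ hφ.1, g.inv.smooth _ hφ.2⟩ }
  inv_hom n y := Prod.ext (f.inv_hom n y.1) (g.inv_hom n y.2)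
  hom_inv n y := Prod.ext (f.hom_inv n y.1) (g.hom_inv n y.2)

theorem base_app (f : M.Hom N) {n : ℕ} (y : M.pts n) :
    N.base (f.app n y) = f.app 0 (M.base y) := f.toHom.base_app y

/-- The restriction of an isomorphism to the preimage of a set of points. -/
def Iso.restrict (f : M.Iso N) (A : Set (N.pts 0)) :
    (M.restrict (f.hom.app 0 ⁻¹' A)).Iso (N.restrict A) where
  hom :=
    { app := fun n y => ⟨f.hom.app n y.1, by
        have h : f.hom.app 0 (M.base y.1) ∈ A := y.2
        rwa [← base_app] at h⟩
      natural := fun ρ y => Subtype.ext (f.hom.natural ρ y.1)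
      smooth := fun _ hφ => f.hom.smooth _ hφ }
  inv :=
    { app := fun n y => ⟨f.inv.app n y.1, by
        change f.hom.app 0 (M.base (f.inv.app n y.1)) ∈ A
        rw [← base_app, f.hom_inv]
        exact y.2⟩
      natural := fun ρ y => Subtype.ext (f.inv.natural ρ y.1)
      smooth := fun _ hφ => f.inv.smooth _ hφ }
  inv_hom n y := Subtype.ext (f.inv_hom n y.1)
  hom_inv n y := Subtype.ext (f.hom_inv n y.1)

/-- The restriction to the set of all points. -/
def restrictUniv (M : Space.{u, v} 𝕜) : M.Iso (M.restrict Set.univ) where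
  hom := ⟨⟨fun _ y => ⟨y, trivial⟩, fun _ _ => rfl⟩, fun _ hφ => hφ⟩
  inv := ⟨⟨fun _ y => y.1, fun _ _ => rfl⟩, fun _ hφ => hφ⟩
  inv_hom _ _ := rfl
  hom_inv _ _ := rfl

/-- The product of two open sets of coordinates. -/
def prodOpens {p r : ℕ} (U : Opens (Fin p → 𝕜)) (U' : Opens (Fin r → 𝕜)) :
    Opens (Fin (p + r) → 𝕜) where
  carrier := {a | (fun i => a (Fin.castAdd r i)) ∈ U ∧ (fun i => a (Fin.natAdd p i)) ∈ U'}
  is_open' := (U.isOpen.preimage (by fun_prop)).inter (U'.isOpen.preimage (by fun_prop))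

/-- The product of two superdomains is a superdomain. -/
def prodDomain {p r : ℕ} (U : Opens (Fin p → 𝕜)) (U' : Opens (Fin r → 𝕜)) (q s : ℕ) :
    (ofDomain (prodOpens U U') (q + s)).Iso ((ofDomain U q).prod (ofDomain U' s)) :=
  Iso.ofBijective
    { app := fun n y =>
        (⟨(fun i => y.1.1 (Fin.castAdd r i), fun j => y.1.2 (Fin.castAdd s j)), y.2.1⟩,
          ⟨(fun i => y.1.1 (Fin.natAdd p i), fun j => y.1.2 (Fin.natAdd q j)), y.2.2⟩)
      natural := fun _ _ => rfl
      smooth := fun _ hφ =>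
        ⟨⟨fun _ => hφ.1 _, fun _ => hφ.2 _⟩, fun _ => hφ.1 _, fun _ => hφ.2 _⟩ }
    (fun n => by
      constructor
      · intro y z h
        have h1 := congrArg (fun t => t.1.1) h
        have h2 := congrArg (fun t => t.2.1) h
        exact Subtype.ext (Prod.ext
          (funext fun i => Fin.addCases (congrFun (congrArg Prod.fst h1))
            (congrFun (congrArg Prod.fst h2)) i)
          (funext fun i => Fin.addCases (congrFun (congrArg Prod.snd h1))
            (congrFun (congrArg Prod.snd h2)) i))
      · intro y
        refine ⟨⟨(Fin.append y.1.1.1 y.2.1.1, Fin.append y.1.1.2 y.2.1.2), ?_⟩, ?_⟩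
        · constructor
          · simp only [Fin.append_left]
            exact y.1.2
          · simp only [Fin.append_right]
            exact y.2.2
        · exact Prod.ext
            (Subtype.ext (Prod.ext (funext fun i => Fin.append_left _ _ i)
              (funext fun i => Fin.append_left _ _ i)))
            (Subtype.ext (Prod.ext (funext fun i => Fin.append_right _ _ i)
              (funext fun i => Fin.append_right _ _ i))))
    fun _ hφ => ⟨fun i => Fin.addCases hφ.1.1 hφ.2.1 i, fun i => Fin.addCases hφ.1.2 hφ.2.2 i⟩

/-- A smooth map that is compatible with the equivalence relations defines a smooth map on the
quotient. -/
def quotLift (r : ∀ n, Setoid (M.pts n))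
    (hr : ∀ (n m : ℕ) (ρ : GrHom 𝕜 n m) (y z : M.pts n), r n y z → r m (M.map ρ y) (M.map ρ z))
    (f : M.Hom N) (hf : ∀ n (y z : M.pts n), r n y z → f.app n y = f.app n z) :
    (M.quot r hr).Hom N where
  app n := Quotient.lift (s := r n) (f.app n) (hf n)
  natural := by
    rintro n m ρ ⟨y⟩
    exact f.natural ρ y
  smooth φ hφ := by
    -- A plot of the quotient lifts only locally, so the locality axiom of the target is needed.
    refine N.plot_local _ fun a ha => ?_
    obtain ⟨U', hU, ψ, ha', hψ, hψφ⟩ := hφ a ha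
    refine ⟨U', hU, ha', ?_⟩
    have h := f.smooth ψ hψ
    convert h using 1
    refine GrFunctor.Hom.ext fun n y => ?_
    have h1 := congrArg (fun χ => χ.app n y) hψφ
    exact congrArg (Quotient.lift (s := r n) (f.app n) (hf n)) h1.symm

/-- The projection to the quotient. -/
def quotProj (r : ∀ n, Setoid (M.pts n))
    (hr : ∀ (n m : ℕ) (ρ : GrHom 𝕜 n m) (y z : M.pts n), r n y z → r m (M.map ρ y) (M.map ρ z)) :
    M.Hom (M.quot r hr) where
  toHom := M.toGrFunctor.quotMk r hr
  smooth {_ _ U} φ hφ _ ha := ⟨U, le_rfl, φ, ha, hφ, rfl⟩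

/-! ### Topology -/

theorem isOpen_iff {s : Set (M.pts 0)} : IsOpen[M.topology] s ↔
    ∀ (p q : ℕ) (U : Opens (Fin p → 𝕜)) (φ : (superdomain U q).Hom M.toGrFunctor), M.IsPlot φ →
      IsOpen ((fun a : U => φ.app 0 (superdomainPt U q a)) ⁻¹' s) := by
  simp only [isOpen_iSup_iff, isOpen_coinduced, Subtype.forall]

theorem continuous_of_plots {X : Type*} [TopologicalSpace X] {f : M.pts 0 → X}
    (hf : ∀ (p q : ℕ) (U : Opens (Fin p → 𝕜)) (φ : (superdomain U q).Hom M.toGrFunctor),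
      M.IsPlot φ → Continuous fun a : U => f (φ.app 0 (superdomainPt U q a))) :
    Continuous[M.topology, _] f := by
  let := M.topology
  exact ⟨fun s hs => isOpen_iff.2 fun p q U φ hφ => hs.preimage (hf p q U φ hφ)⟩

theorem continuous_plot {p q : ℕ} {U : Opens (Fin p → 𝕜)}
    {φ : (superdomain U q).Hom M.toGrFunctor} (hφ : M.IsPlot φ) :
    Continuous[inferInstance, M.topology] fun a : U => φ.app 0 (superdomainPt U q a) := by
  let := M.topology
  exact ⟨fun _ hs => isOpen_iff.1 hs p q U φ hφ⟩

theorem Hom.continuous (f : M.Hom N) : Continuous[M.topology, N.topology] (f.app 0) := by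
  let := M.topology
  let := N.topology
  exact ⟨fun _ hs => isOpen_iff.2 fun p q U φ hφ => isOpen_iff.1 hs p q U _ (f.smooth φ hφ)⟩

/-- Openness in the plot topology is tested on plots of the quotient. Near each parameter such a
plot lifts to `M`, where the hypothesis provides an open neighbourhood. -/
theorem isOpen_quot {r : ∀ n, Setoid (M.pts n)}
    {hr : ∀ (n m : ℕ) (ρ : GrHom 𝕜 n m) (y z : M.pts n), r n y z → r m (M.map ρ y) (M.map ρ z)}
    {s : Set ((M.quot r hr).pts 0)} (hs : IsOpen[M.topology] (Quotient.mk (r 0) ⁻¹' s)) :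
    IsOpen[(M.quot r hr).topology] s := by
  refine isOpen_iff.2 fun p q U φ hφ => isOpen_iff_mem_nhds.2 fun a ha => ?_
  obtain ⟨U', hU, ψ, ha', hψ, hψφ⟩ := hφ a a.2
  have h1 := isOpen_iff.1 hs p q U' ψ hψ
  have h2 (b : U') : Quotient.mk (r 0) (ψ.app 0 (superdomainPt U' q b)) =
      φ.app 0 (superdomainPt U q ⟨b, hU b.2⟩) :=
    congrArg (fun χ => χ.app 0 (superdomainPt U' q b)) hψφ
  have h3 : IsOpen (Set.inclusion hU '' ((fun b : U' => ψ.app 0 (superdomainPt U' q b)) ⁻¹'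
      (Quotient.mk (r 0) ⁻¹' s))) :=
    (Opens.isOpenEmbedding_of_le hU).isOpenMap _ h1
  refine Filter.mem_of_superset (h3.mem_nhds ⟨⟨a, ha'⟩, ?_, rfl⟩) ?_
  · change Quotient.mk (r 0) (ψ.app 0 (superdomainPt U' q ⟨a, ha'⟩)) ∈ s
    rw [h2]
    exact ha
  · rintro _ ⟨b, hb, rfl⟩
    change Quotient.mk (r 0) (ψ.app 0 (superdomainPt U' q b)) ∈ s at hb
    rw [h2] at hb
    exact hb

theorem continuous_quot {X : Type*} [TopologicalSpace X] {r : ∀ n, Setoid (M.pts n)}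
    {hr : ∀ (n m : ℕ) (ρ : GrHom 𝕜 n m) (y z : M.pts n), r n y z → r m (M.map ρ y) (M.map ρ z)}
    {f : (M.quot r hr).pts 0 → X}
    (hf : Continuous[M.topology, _] fun y => f (Quotient.mk (r 0) y)) :
    Continuous[(M.quot r hr).topology, _] f := by
  let := M.topology
  let := (M.quot r hr).topology
  exact ⟨fun _ hs => isOpen_quot (hs.preimage hf)⟩

/-- The restriction of a map from a superdomain to an open set that is mapped to `A`. -/
def codRestrict {p q : ℕ} {U U' : Opens (Fin p → 𝕜)} (φ : (superdomain U q).Hom M.toGrFunctor)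
    (h : U' ≤ U) (A : Set (M.pts 0))
    (hA : ∀ a : U', φ.app 0 (superdomainPt U q ⟨a.1, h a.2⟩) ∈ A) :
    (superdomain U' q).Hom (M.restrict A).toGrFunctor where
  app n y := ⟨φ.app n ((superdomainIncl h q).app n y), by
    change M.base _ ∈ A
    rw [φ.base_app_superdomain]
    exact hA ⟨_, y.2⟩⟩
  natural ρ y := Subtype.ext (φ.natural ρ ((superdomainIncl h q).app _ y))

theorem isPlot_incl {p q : ℕ} {U U' : Opens (Fin p → 𝕜)} {φ : (superdomain U q).Hom M.toGrFunctor}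
    (hφ : M.IsPlot φ) (h : U' ≤ U) : M.IsPlot (φ.comp (superdomainIncl h q)) :=
  M.plot_comp _ _ ⟨fun i => isSuperfunction_even U' q i, fun j => isSuperfunction_odd U' q j⟩ hφ

/-- Openness must be tested against every plot `φ` of `M`. Where `φ` meets `A`, composing it with
the inverse chart gives a morphism of superdomains; its base map is continuous, and the required
preimage is the preimage of `O` under that base map. -/
theorem isOpen_image_chart {p q : ℕ} {U : Opens (Fin p → 𝕜)} {A : Set (M.pts 0)}
    (hA : IsOpen[M.topology] A) (f : (ofDomain U q).Iso (M.restrict A)) {O : Set U}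
    (hO : IsOpen O) :
    IsOpen[M.topology] ((fun a : U => (f.hom.app 0 (superdomainPt U q a)).1) '' O) := by
  refine isOpen_iff.2 fun r s V φ hφ => ?_
  have hV := isOpen_iff.1 hA r s V φ hφ
  let V' : Opens (Fin r → 𝕜) := ⟨_, V.isOpen.isOpenMap_subtype_val _ hV⟩
  have hle : V' ≤ V := by
    rintro _ ⟨c, -, rfl⟩
    exact c.2
  have hV' : ∀ a : V', φ.app 0 (superdomainPt V s ⟨a, hle a.2⟩) ∈ A := by
    rintro ⟨_, c, hc, rfl⟩
    exact hc
  let χ := codRestrict φ hle A hV'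
  have hχ : (M.restrict A).IsPlot χ := isPlot_incl hφ hle
  have hs : IsSupersmooth (f.inv.toHom.comp χ) := f.inv.smooth χ hχ
  -- `β` is the plot `φ` expressed in the coordinates of the chart, on ordinary points.
  let β : V' → U := fun a => ⟨baseMap (f.inv.toHom.comp χ) a,
    (f.inv.app 0 (χ.app 0 (superdomainPt V' s a))).2⟩
  have hβc : Continuous β := (continuous_baseMap hs).subtype_mk _
  have hβ (a : V') : superdomainPt U q (β a) = f.inv.app 0 (χ.app 0 (superdomainPt V' s a)) :=
    superdomainPt_body_zero _
  have hβ' (a : V') : (f.hom.app 0 (superdomainPt U q (β a))).1 =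
      φ.app 0 (superdomainPt V s ⟨a, hle a.2⟩) := by
    rw [hβ, f.hom_inv]
    rfl
  have hset : (fun a : V => φ.app 0 (superdomainPt V s a)) ⁻¹'
      ((fun a : U => (f.hom.app 0 (superdomainPt U q a)).1) '' O) =
      Set.inclusion (SetLike.coe_subset_coe.2 hle) '' (β ⁻¹' O) := ?_
  · rw [hset]
    exact (Opens.isOpenEmbedding_of_le hle).isOpenMap _ (hO.preimage hβc)
  ext a
  constructor
  · rintro ⟨u, hu, hua⟩
    have haA : φ.app 0 (superdomainPt V s a) ∈ A := by
      have h := (f.hom.app 0 (superdomainPt U q u)).2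
      change M.base _ ∈ A at h
      rw [M.toGrFunctor.base_zero] at h
      exact (congrArg (· ∈ A) hua).mp h
    refine ⟨⟨a, a, haA, rfl⟩, ?_, rfl⟩
    have h1 := hβ' ⟨a, a, haA, rfl⟩
    have h2 : superdomainPt U q (β ⟨a, a, haA, rfl⟩) = superdomainPt U q u := by
      rw [← f.inv_hom 0 (superdomainPt U q (β _)), ← f.inv_hom 0 (superdomainPt U q u)]
      exact congrArg _ (Subtype.ext (h1.trans hua.symm))
    rw [Set.mem_preimage, superdomainPt_injective U q h2]
    exact hu
  · rintro ⟨b, hb, rfl⟩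
    exact ⟨β b, hb, hβ' b⟩

/-- A Hausdorff space with a countable atlas is a supermanifold. -/
theorem isSupermanifold_of_countable_atlas {ι : Type*} [Countable ι] (hT : @T2Space _ M.topology)
    (A : ι → Set (M.pts 0)) (hA : ∀ i, IsOpen[M.topology] (A i)) (hc : ∀ a, ∃ i, a ∈ A i)
    (hf : ∀ i, ∃ (p q : ℕ) (U : Opens (Fin p → 𝕜)),
      Nonempty ((ofDomain U q).Iso (M.restrict (A i)))) : M.IsSupermanifold := by
  refine ⟨hT, ?_, fun a => ?_⟩
  · let := M.topology
    -- On ordinary points the chart is an open embedding with image `A i`, so `A i` is homeomorphic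
    -- to an open subset of a finite-dimensional space.
    have hsc (i : ι) : SecondCountableTopology (A i) := by
      obtain ⟨p, q, U, ⟨f⟩⟩ := hf i
      let c : U → M.pts 0 := fun a => (f.hom.app 0 (superdomainPt U q a)).1
      -- The chart itself is a plot, being the image of the identity plot of the superdomain, and
      -- plots are continuous by the choice of topology.
      have hcont : Continuous c := continuous_plot (M := M) (φ := ⟨fun n y => (f.hom.app n y).1,
        fun ρ y => congrArg Subtype.val (f.hom.natural ρ y)⟩)
        (f.hom.smooth ⟨fun _ y => y, fun _ _ => rfl⟩
          ⟨fun i => isSuperfunction_even U q i, fun j => isSuperfunction_odd U q j⟩)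
      have hinj : Function.Injective c := fun a b h => by
        apply superdomainPt_injective U q
        rw [← f.inv_hom 0 (superdomainPt U q a), ← f.inv_hom 0 (superdomainPt U q b)]
        exact congrArg _ (Subtype.ext h)
      have hopen : IsOpenMap c := fun O hO => isOpen_image_chart (hA i) f hO
      have hr : Set.range c = A i := by
        ext a
        constructor
        · rintro ⟨u, rfl⟩
          have h := (f.hom.app 0 (superdomainPt U q u)).2
          change M.base _ ∈ A i at h
          rwa [M.toGrFunctor.base_zero] at h
        · intro ha
          have ha' : M.base a ∈ A i := by rwa [M.toGrFunctor.base_zero]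
          let y : (superdomain U q).pts 0 := f.inv.app 0 ⟨a, ha'⟩
          refine ⟨⟨_, y.2⟩, ?_⟩
          change (f.hom.app 0 (superdomainPt U q ⟨_, y.2⟩)).1 = a
          rw [superdomainPt_body_zero]
          exact congrArg Subtype.val (f.hom_inv 0 ⟨a, ha'⟩)
      rw [← hr]
      have : SecondCountableTopology U := inferInstance
      have he := (Topology.IsOpenEmbedding.of_continuous_injective_isOpenMap hcont hinj
        hopen).isEmbedding
      exact he.toHomeomorph.symm.secondCountableTopology
    exact TopologicalSpace.secondCountableTopology_of_countable_cover hA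
      (Set.iUnion_eq_univ_iff.2 hc)
  · obtain ⟨i, hi⟩ := hc a
    exact ⟨A i, hA i, hi, hf i⟩

/-- For the plot topology it is easier to exhibit a continuous complete invariant of points than to
separate them by open sets; this is how the Hausdorff property is proved throughout. -/
theorem t2Space_of_injective {X : Type*} [TopologicalSpace X] [T2Space X] {f : M.pts 0 → X}
    (hf : Continuous[M.topology, _] f) (hi : Function.Injective f) : @T2Space _ M.topology := by
  let := M.topology
  exact T2Space.of_injective_continuous hi hf

end Space

end Spaces

/-! ### Maps to and from parts of a superspace. -/

namespace Space

variable {𝕜 : Type u} [RCLike 𝕜] {M : Space.{u, v} 𝕜} {N : Space.{u, w} 𝕜}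

/-- A smooth map whose values lie over a set of ordinary points. -/
def Hom.codRestrict (f : M.Hom N) (A : Set (N.pts 0)) (hA : ∀ y, f.app 0 y ∈ A) :
    M.Hom (N.restrict A) where
  app n y := ⟨f.app n y, by
    change N.base (f.app n y) ∈ A
    rw [base_app]
    exact hA _⟩
  natural ρ y := Subtype.ext (f.natural ρ y)
  smooth _ hφ := f.smooth _ hφ

/-- The inclusion of a part of a superspace. -/
def restrictIncl (M : Space.{u, v} 𝕜) (A : Set (M.pts 0)) : (M.restrict A).Hom M where
  app _ y := y.1
  natural _ _ := rfl
  smooth _ hφ := hφ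

end Space

namespace VectorSuperspace

variable {𝕜 : Type u} [RCLike 𝕜] (V : VectorSuperspace.{u, v} 𝕜) (W : VectorSuperspace.{u, w} 𝕜)

/-! ### Coordinates on a vector superspace -/

/-- The dimension of the even part. -/
abbrev evenDim : ℕ := Module.finrank 𝕜 V.even

/-- The dimension of the odd part. -/
abbrev oddDim : ℕ := Module.finrank 𝕜 V.odd

/-- A basis of the even part. -/
def evenVec (i : Fin V.evenDim) : V.carrier := (Module.finBasis 𝕜 V.even i : V.carrier)

/-- A basis of the odd part. -/
def oddVec (j : Fin V.oddDim) : V.carrier := (Module.finBasis 𝕜 V.odd j : V.carrier)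

/-- The even coordinate functionals. -/
def evenFun (i : Fin V.evenDim) : V.carrier →ₗ[𝕜] 𝕜 :=
  (Module.finBasis 𝕜 V.even).coord i ∘ₗ Submodule.projectionOnto _ _ V.isCompl

/-- The odd coordinate functionals. -/
def oddFun (j : Fin V.oddDim) : V.carrier →ₗ[𝕜] 𝕜 :=
  (Module.finBasis 𝕜 V.odd).coord j ∘ₗ Submodule.projectionOnto _ _ V.isCompl.symm

theorem evenFun_of_even (i : Fin V.evenDim) (y : V.even) :
    V.evenFun i y = (Module.finBasis 𝕜 V.even).coord i y := by
  simp only [evenFun, LinearMap.comp_apply, Submodule.projectionOnto_apply_left]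

theorem oddFun_of_odd (j : Fin V.oddDim) (y : V.odd) :
    V.oddFun j y = (Module.finBasis 𝕜 V.odd).coord j y := by
  simp only [oddFun, LinearMap.comp_apply, Submodule.projectionOnto_apply_left]

theorem evenFun_of_mem_odd (i : Fin V.evenDim) {y : V.carrier} (hy : y ∈ V.odd) :
    V.evenFun i y = 0 := by
  have := Submodule.projectionOnto_apply_right V.isCompl ⟨y, hy⟩
  simp only [evenFun, LinearMap.comp_apply, this, map_zero]

theorem oddFun_of_mem_even (j : Fin V.oddDim) {y : V.carrier} (hy : y ∈ V.even) :
    V.oddFun j y = 0 := by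
  have := Submodule.projectionOnto_apply_right V.isCompl.symm ⟨y, hy⟩
  simp only [oddFun, LinearMap.comp_apply, this, map_zero]

theorem evenFun_evenVec (i k : Fin V.evenDim) :
    V.evenFun i (V.evenVec k) = if k = i then 1 else 0 := by
  rw [evenVec, evenFun_of_even, Module.Basis.coord_apply, Module.Basis.repr_self,
    Finsupp.single_apply]

theorem oddFun_oddVec (i k : Fin V.oddDim) :
    V.oddFun i (V.oddVec k) = if k = i then 1 else 0 := by
  rw [oddVec, oddFun_of_odd, Module.Basis.coord_apply, Module.Basis.repr_self,
    Finsupp.single_apply]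

theorem evenVec_mem (i : Fin V.evenDim) : V.evenVec i ∈ V.even := Subtype.property _

theorem oddVec_mem (j : Fin V.oddDim) : V.oddVec j ∈ V.odd := Subtype.property _

theorem eq_sum (y : V.carrier) :
    y = ∑ i, V.evenFun i y • V.evenVec i + ∑ j, V.oddFun j y • V.oddVec j := by
  obtain ⟨b, hb, c, hc, rfl⟩ := Submodule.mem_sup.1
    (V.isCompl.sup_eq_top.ge (Submodule.mem_top (x := y)))
  have h1 (i) : V.evenFun i (b + c) = (Module.finBasis 𝕜 V.even).repr ⟨b, hb⟩ i := by
    rw [map_add, V.evenFun_of_mem_odd i hc, add_zero]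
    exact V.evenFun_of_even i ⟨b, hb⟩
  have h2 (j) : V.oddFun j (b + c) = (Module.finBasis 𝕜 V.odd).repr ⟨c, hc⟩ j := by
    rw [map_add, V.oddFun_of_mem_even j hb, zero_add]
    exact V.oddFun_of_odd j ⟨c, hc⟩
  simp only [h1, h2, evenVec, oddVec]
  congr 1
  · have := congrArg V.even.subtype ((Module.finBasis 𝕜 V.even).sum_repr ⟨b, hb⟩)
    rw [map_sum] at this
    exact this.symm
  · have := congrArg V.odd.subtype ((Module.finBasis 𝕜 V.odd).sum_repr ⟨c, hc⟩)
    rw [map_sum] at this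
    exact this.symm

variable {n m : ℕ}

theorem coord_tmul (b : V.carrier →ₗ[𝕜] 𝕜) (a : Gr 𝕜 n) (y : V.carrier) :
    V.coord b n (a ⊗ₜ y) = b y • a := by
  simp [coord]

theorem coord_smul (b : V.carrier →ₗ[𝕜] 𝕜) (a : Gr 𝕜 n) (y : V.Ext n) :
    V.coord b n (a • y) = a * V.coord b n y := by
  induction y using TensorProduct.induction_on with
  | zero => simp only [map_zero, smul_zero, mul_zero]
  | add y z hy hz => simp only [map_add, smul_add, hy, hz, mul_add]
  | tmul c z => rw [TensorProduct.smul_tmul', coord_tmul, coord_tmul, smul_eq_mul, mul_smul_comm]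

theorem ext_eq_sum (y : V.Ext n) :
    y = ∑ i, V.coord (V.evenFun i) n y ⊗ₜ V.evenVec i +
      ∑ j, V.coord (V.oddFun j) n y ⊗ₜ V.oddVec j := by
  induction y using TensorProduct.induction_on with
  | zero => simp
  | add y z hy hz =>
    simp only [map_add, TensorProduct.add_tmul, Finset.sum_add_distrib]
    rw [add_add_add_comm, ← hy, ← hz]
  | tmul c z =>
    simp only [coord_tmul, TensorProduct.smul_tmul]
    rw [← TensorProduct.tmul_sum, ← TensorProduct.tmul_sum, ← TensorProduct.tmul_add, ← V.eq_sum]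

/-- Every coordinate is a constant combination of those of a homogeneous basis, so smoothness has to
be checked only for the latter. -/
theorem coord_eq_sum (b : V.carrier →ₗ[𝕜] 𝕜) (y : V.Ext n) :
    V.coord b n y = ∑ i, b (V.evenVec i) • V.coord (V.evenFun i) n y +
      ∑ j, b (V.oddVec j) • V.coord (V.oddFun j) n y := by
  conv_lhs => rw [V.ext_eq_sum y]
  simp only [map_add, map_sum, coord_tmul]

theorem ext_of_coord {y z : V.Ext n}
    (h0 : ∀ i, V.coord (V.evenFun i) n y = V.coord (V.evenFun i) n z)
    (h1 : ∀ j, V.coord (V.oddFun j) n y = V.coord (V.oddFun j) n z) : y = z := by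
  rw [V.ext_eq_sum y, V.ext_eq_sum z]
  simp only [h0, h1]

theorem tmul_mem_points_of_even {a : Gr 𝕜 n} (ha : a ∈ grEven 𝕜 n) {y : V.carrier}
    (hy : y ∈ V.even) : a ⊗ₜ y ∈ V.points n :=
  Submodule.mem_sup_left ⟨⟨a, ha⟩ ⊗ₜ ⟨y, hy⟩, rfl⟩

theorem tmul_mem_points_of_odd {a : Gr 𝕜 n} (ha : a ∈ grOdd 𝕜 n) {y : V.carrier}
    (hy : y ∈ V.odd) : a ⊗ₜ y ∈ V.points n :=
  Submodule.mem_sup_right ⟨⟨a, ha⟩ ⊗ₜ ⟨y, hy⟩, rfl⟩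

-- This reduces statements on points to pure tensors whose two factors have the same parity, where
-- all signs are explicit.
variable {V} in
@[elab_as_elim]
theorem points_induction {P : ∀ y : V.Ext n, y ∈ V.points n → Prop} (zero : P 0 (zero_mem _))
    (add : ∀ y z hy hz, P y hy → P z hz → P (y + z) (add_mem hy hz))
    (even : ∀ a (ha : a ∈ grEven 𝕜 n) y (hy : y ∈ V.even),
      P (a ⊗ₜ y) (V.tmul_mem_points_of_even ha hy))
    (odd : ∀ a (ha : a ∈ grOdd 𝕜 n) y (hy : y ∈ V.odd),
      P (a ⊗ₜ y) (V.tmul_mem_points_of_odd ha hy)) {y : V.Ext n} (hy : y ∈ V.points n) :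
    P y hy := by
  obtain ⟨_, ⟨b, rfl⟩, _, ⟨c, rfl⟩, rfl⟩ := Submodule.mem_sup.1 hy
  refine add _ _ (Submodule.mem_sup_left ⟨b, rfl⟩) (Submodule.mem_sup_right ⟨c, rfl⟩) ?_ ?_
  · clear hy
    induction b using TensorProduct.induction_on with
    | zero => simpa only [map_zero] using zero
    | add b c hb hc => simpa only [map_add] using add _ _ _ _ hb hc
    | tmul a y => exact even a a.2 y y.2
  · clear hy
    induction c using TensorProduct.induction_on with
    | zero => simpa only [map_zero] using zero
    | add b c hb hc => simpa only [map_add] using add _ _ _ _ hb hc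
    | tmul a y => exact odd a a.2 y y.2

theorem coord_mem_grEven {b : V.carrier →ₗ[𝕜] 𝕜} (hb : ∀ y ∈ V.odd, b y = 0) {y : V.Ext n}
    (hy : y ∈ V.points n) : V.coord b n y ∈ grEven 𝕜 n := by
  induction hy using points_induction with
  | zero => rw [map_zero]; exact zero_mem _
  | add y z _ _ hy hz => rw [map_add]; exact add_mem hy hz
  | even a ha y hy => rw [coord_tmul]; exact Submodule.smul_mem _ _ ha
  | odd a ha y hy => rw [coord_tmul, hb y hy, zero_smul]; exact zero_mem _

theorem coord_mem_grOdd {b : V.carrier →ₗ[𝕜] 𝕜} (hb : ∀ y ∈ V.even, b y = 0) {y : V.Ext n}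
    (hy : y ∈ V.points n) : V.coord b n y ∈ grOdd 𝕜 n := by
  induction hy using points_induction with
  | zero => rw [map_zero]; exact zero_mem _
  | add y z _ _ hy hz => rw [map_add]; exact add_mem hy hz
  | even a ha y hy => rw [coord_tmul, hb y hy, zero_smul]; exact zero_mem _
  | odd a ha y hy => rw [coord_tmul]; exact Submodule.smul_mem _ _ ha

theorem coord_evenFun_mem (i : Fin V.evenDim) {y : V.Ext n} (hy : y ∈ V.points n) :
    V.coord (V.evenFun i) n y ∈ grEven 𝕜 n :=
  V.coord_mem_grEven (fun _ => V.evenFun_of_mem_odd i) hy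

theorem coord_oddFun_mem (j : Fin V.oddDim) {y : V.Ext n} (hy : y ∈ V.points n) :
    V.coord (V.oddFun j) n y ∈ grOdd 𝕜 n :=
  V.coord_mem_grOdd (fun _ => V.oddFun_of_mem_even j) hy

theorem smul_mem_points {a : Gr 𝕜 n} (ha : a ∈ grEven 𝕜 n) {y : V.Ext n} (hy : y ∈ V.points n) :
    a • y ∈ V.points n := by
  induction hy using points_induction with
  | zero => rw [smul_zero]; exact zero_mem _
  | add y z _ _ hy hz => rw [smul_add]; exact add_mem hy hz
  | even b hb y hy => exact V.tmul_mem_points_of_even (mul_mem_grEven ha hb) hy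
  | odd b hb y hy => exact V.tmul_mem_points_of_odd (mul_mem_grOdd ha hb) hy

/-- The vector with given coordinates. -/
def ofCoord (c : Coord 𝕜 V.evenDim V.oddDim n) : V.Ext n :=
  ∑ i, (c.1 i : Gr 𝕜 n) ⊗ₜ V.evenVec i + ∑ j, (c.2 j : Gr 𝕜 n) ⊗ₜ V.oddVec j

theorem ofCoord_mem (c : Coord 𝕜 V.evenDim V.oddDim n) : V.ofCoord c ∈ V.points n :=
  add_mem (sum_mem fun i _ => V.tmul_mem_points_of_even (c.1 i).2 (V.evenVec_mem i))
    (sum_mem fun j _ => V.tmul_mem_points_of_odd (c.2 j).2 (V.oddVec_mem j))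

theorem coord_evenFun_ofCoord (c : Coord 𝕜 V.evenDim V.oddDim n) (i : Fin V.evenDim) :
    V.coord (V.evenFun i) n (V.ofCoord c) = c.1 i := by
  simp [ofCoord, coord_tmul, evenFun_evenVec, V.evenFun_of_mem_odd i (V.oddVec_mem _)]

theorem coord_oddFun_ofCoord (c : Coord 𝕜 V.evenDim V.oddDim n) (j : Fin V.oddDim) :
    V.coord (V.oddFun j) n (V.ofCoord c) = c.2 j := by
  simp [ofCoord, coord_tmul, oddFun_oddVec, V.oddFun_of_mem_even j (V.evenVec_mem _)]

/-- A map to a vector superspace is a plot if its coordinates are superfunctions. -/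
theorem isPlot_toSpace {p q : ℕ} {U : Opens (Fin p → 𝕜)}
    {φ : (superdomain U q).Hom V.toSpace.toGrFunctor}
    (h0 : ∀ i, IsSuperfunction U q fun n y => V.coord (V.evenFun i) n (φ.app n y).1)
    (h1 : ∀ j, IsSuperfunction U q fun n y => V.coord (V.oddFun j) n (φ.app n y).1) :
    V.toSpace.IsPlot φ := fun b =>
  ((IsSuperfunction.sum Finset.univ fun i _ => (h0 i).const_smul (b (V.evenVec i))).add
    (IsSuperfunction.sum Finset.univ fun j _ => (h1 j).const_smul (b (V.oddVec j)))).congr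
      fun _ _ => V.coord_eq_sum b _

/-- The map from a superdomain to a vector superspace given by coordinates. -/
def ofCoordHom (U : Opens (Fin V.evenDim → 𝕜)) :
    (Space.ofDomain U V.oddDim).Hom V.toSpace where
  app n y := ⟨V.ofCoord y.1, V.ofCoord_mem y.1⟩
  natural ρ y := by
    refine Subtype.ext (V.ext_of_coord (fun i => ?_) fun j => ?_)
    · change _ = V.coord _ _ (V.extMap ρ (V.ofCoord y.1))
      rw [coord_extMap]
      simp only [coord_evenFun_ofCoord]
      rfl
    · change _ = V.coord _ _ (V.extMap ρ (V.ofCoord y.1))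
      rw [coord_extMap]
      simp only [coord_oddFun_ofCoord]
      rfl
  smooth φ hφ := V.isPlot_toSpace
    (fun i => (hφ.1 i).congr fun _ _ => V.coord_evenFun_ofCoord _ i)
    fun j => (hφ.2 j).congr fun _ _ => V.coord_oddFun_ofCoord _ j

/-! ### Ordinary points -/

/-- The ordinary vector that underlies an element of an extension of scalars, in coordinates. -/
def bodyVec (y : V.Ext n) (i : Fin V.evenDim) : 𝕜 := body (V.coord (V.evenFun i) n y)

theorem bodyVec_extMap (ρ : GrHom 𝕜 n m) (y : V.Ext n) : V.bodyVec (V.extMap ρ y) = V.bodyVec y :=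
  funext fun i => by rw [bodyVec, coord_extMap, GrHom.body_map, bodyVec]

theorem bodyVec_smul (a : Gr 𝕜 n) (y : V.Ext n) : V.bodyVec (a • y) = body a • V.bodyVec y :=
  funext fun i => by rw [bodyVec, coord_smul, map_mul]; rfl

theorem bodyVec_zero : V.bodyVec (0 : V.Ext n) = 0 :=
  funext fun i => by rw [bodyVec, map_zero, map_zero]; rfl

/-- Without generators the Grassmann algebra is just `𝕜`: odd coordinates vanish and even ones equal
their bodies. -/
theorem ext_of_bodyVec {y z : V.Ext 0} (hy : y ∈ V.points 0) (hz : z ∈ V.points 0)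
    (h : V.bodyVec y = V.bodyVec z) : y = z := by
  refine V.ext_of_coord (fun i => ?_) fun j => ?_
  · rw [gr_zero_eq (V.coord _ 0 y), gr_zero_eq (V.coord _ 0 z)]
    exact congrArg _ (congrFun h i)
  · rw [odd_zero_eq (V.coord_oddFun_mem j hy), odd_zero_eq (V.coord_oddFun_mem j hz)]

/-- An ordinary point is determined by its even body coordinates, and the augmentation does not
change bodies. Membership in `V_0` thus becomes a condition on `bodyVec`. -/
theorem base_ne_zero_iff (y : V.points n) :
    (V.toSpace.base (n := n) y).1 ≠ 0 ↔ V.bodyVec y.1 ≠ 0 := by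
  change V.extMap (GrHom.aug 𝕜 n) y.1 ≠ 0 ↔ _
  rw [← V.bodyVec_extMap (GrHom.aug 𝕜 n) y.1, not_iff_not]
  constructor
  · intro h
    rw [h, bodyVec_zero]
  · intro h
    exact V.ext_of_bodyVec (V.extMap_mem _ _ y.2) (zero_mem _) (h.trans V.bodyVec_zero.symm)

theorem bodyVec_ne_zero (y : V.nonzero.pts n) : V.bodyVec y.1.1 ≠ 0 :=
  (V.base_ne_zero_iff y.1).1 y.2

/-- A point with nonvanishing body as a point of the space of nonzero vectors. -/
def nonzeroMk (y : V.Ext n) (hy : y ∈ V.points n) (h : V.bodyVec y ≠ 0) : V.nonzero.pts n :=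
  ⟨⟨y, hy⟩, (V.base_ne_zero_iff ⟨y, hy⟩).2 h⟩

theorem continuous_bodyVec_nonzero :
    Continuous[V.nonzero.topology, _] fun y : V.nonzero.pts 0 => V.bodyVec y.1.1 :=
  Space.continuous_of_plots fun _ _ _ _ hφ =>
    continuous_pi fun i => (hφ (V.evenFun i)).continuous_body

/-- The open set of nonzero coordinate vectors. -/
def nonzeroOpens (p : ℕ) : Opens (Fin p → 𝕜) := ⟨{a | a ≠ 0}, isOpen_ne⟩

theorem bodyVec_ofCoord (c : Coord 𝕜 V.evenDim V.oddDim n) :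
    V.bodyVec (V.ofCoord c) = fun i => body (c.1 i : Gr 𝕜 n) :=
  funext fun i => by rw [bodyVec, coord_evenFun_ofCoord]

/-- The space of nonzero vectors is isomorphic to a superdomain. -/
def nonzeroChart : (Space.ofDomain (nonzeroOpens V.evenDim) V.oddDim).Iso V.nonzero :=
  Space.Iso.ofBijective
    ((V.ofCoordHom (nonzeroOpens V.evenDim)).codRestrict _ fun y => by
      change (V.ofCoord y.1) ≠ 0
      intro h
      have h1 := V.bodyVec_ofCoord y.1
      rw [h, bodyVec_zero] at h1
      exact y.2 h1.symm)
    (fun n => by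
      constructor
      · intro y z h
        have h1 : V.ofCoord y.1 = V.ofCoord z.1 := congrArg (fun t => t.1.1) h
        refine Subtype.ext (Prod.ext (funext fun i => Subtype.ext ?_)
          (funext fun j => Subtype.ext ?_))
        · rw [← coord_evenFun_ofCoord, h1, coord_evenFun_ofCoord]
        · rw [← coord_oddFun_ofCoord, h1, coord_oddFun_ofCoord]
      · intro y
        refine ⟨⟨(fun i => ⟨V.coord (V.evenFun i) n y.1.1, V.coord_evenFun_mem i y.1.2⟩,
          fun j => ⟨V.coord (V.oddFun j) n y.1.1, V.coord_oddFun_mem j y.1.2⟩),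
          V.bodyVec_ne_zero y⟩, ?_⟩
        exact Subtype.ext (Subtype.ext (V.ext_eq_sum y.1.1).symm))
    fun φ hφ =>
      ⟨fun i => (hφ (V.evenFun i)).congr fun _ _ => (V.coord_evenFun_ofCoord _ i).symm,
      fun j => (hφ (V.oddFun j)).congr fun _ _ => (V.coord_oddFun_ofCoord _ j).symm⟩

theorem isSupermanifold_nonzero : V.nonzero.IsSupermanifold := by
  refine Space.isSupermanifold_of_countable_atlas (ι := Unit)
    (Space.t2Space_of_injective V.continuous_bodyVec_nonzero fun y z h =>
      Subtype.ext (Subtype.ext (V.ext_of_bodyVec y.1.2 z.1.2 h)))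
    (fun _ => Set.univ) (fun _ => ?_) (fun _ => ⟨(), trivial⟩)
    fun _ => ⟨_, _, _, ⟨V.nonzeroChart.trans V.nonzero.restrictUniv⟩⟩
  let := V.nonzero.topology
  exact isOpen_univ

/-! ### Tensor products -/

theorem superTmul_smul_left (c : Gr 𝕜 n) (y : V.Ext n) (z : W.Ext n) :
    V.superTmul W (c • y) z = c • V.superTmul W y z := by
  induction y using TensorProduct.induction_on with
  | zero => simp only [map_zero, smul_zero, LinearMap.zero_apply]
  | add y y' hy hy' => simp only [map_add, smul_add, LinearMap.add_apply, hy, hy']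
  | tmul a y =>
    induction z using TensorProduct.induction_on with
    | zero => simp only [map_zero, smul_zero]
    | add z z' hz hz' => simp only [map_add, smul_add, hz, hz']
    | tmul b z =>
      simp only [TensorProduct.smul_tmul', superTmul_tmul, smul_add, smul_eq_mul, mul_assoc]

theorem superTmul_even_tmul (a b : Gr 𝕜 n) {y : V.carrier} (hy : y ∈ V.even) (z : W.carrier) :
    V.superTmul W (a ⊗ₜ y) (b ⊗ₜ z) = (a * b) ⊗ₜ (y ⊗ₜ z) := by
  have h0 : V.evenProj y = y := Submodule.projection_apply_left V.isCompl ⟨y, hy⟩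
  have h1 : V.oddProj y = 0 := Submodule.projection_apply_right V.isCompl.symm ⟨y, hy⟩
  rw [superTmul_tmul, h0, h1, TensorProduct.zero_tmul, TensorProduct.tmul_zero, add_zero]

theorem superTmul_odd_tmul (a b : Gr 𝕜 n) {y : V.carrier} (hy : y ∈ V.odd) (z : W.carrier) :
    V.superTmul W (a ⊗ₜ y) (b ⊗ₜ z) = (a * CliffordAlgebra.involute b) ⊗ₜ (y ⊗ₜ z) := by
  have h0 : V.oddProj y = y := Submodule.projection_apply_left V.isCompl.symm ⟨y, hy⟩
  have h1 : V.evenProj y = 0 := Submodule.projection_apply_right V.isCompl ⟨y, hy⟩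
  rw [superTmul_tmul, h0, h1, TensorProduct.zero_tmul, TensorProduct.tmul_zero, zero_add]

/-- Since `y` is even in total degree, its odd vectors carry odd coefficients. The sign from moving
`c` past an odd vector is cancelled by the sign from moving `c` past its odd coefficient
(`grOdd_mul_involute`). -/
theorem superTmul_smul_right (c : Gr 𝕜 n) {y : V.Ext n} (hy : y ∈ V.points n) (z : W.Ext n) :
    V.superTmul W y (c • z) = c • V.superTmul W y z := by
  induction hy using points_induction with
  | zero => simp only [map_zero, smul_zero, LinearMap.zero_apply]
  | add y y' _ _ hy hy' => simp only [map_add, smul_add, LinearMap.add_apply, hy, hy']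
  | even a ha y hy =>
    induction z using TensorProduct.induction_on with
    | zero => simp only [map_zero, smul_zero]
    | add z z' hz hz' => simp only [map_add, smul_add, hz, hz']
    | tmul b z =>
      rw [TensorProduct.smul_tmul', superTmul_even_tmul V W _ _ hy, superTmul_even_tmul V W _ _ hy,
        TensorProduct.smul_tmul', smul_eq_mul, smul_eq_mul, ← mul_assoc, ← mul_assoc,
        grEven_comm ha]
  | odd a ha y hy =>
    induction z using TensorProduct.induction_on with
    | zero => simp only [map_zero, smul_zero]
    | add z z' hz hz' => simp only [map_add, smul_add, hz, hz']
    | tmul b z =>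
      rw [TensorProduct.smul_tmul', superTmul_odd_tmul V W _ _ hy, superTmul_odd_tmul V W _ _ hy,
        TensorProduct.smul_tmul', smul_eq_mul, smul_eq_mul, map_mul, ← mul_assoc,
        grOdd_mul_involute ha, mul_assoc]

theorem grOdd_mul_grOdd {a b : Gr 𝕜 n} (ha : a ∈ grOdd 𝕜 n) (hb : b ∈ grOdd 𝕜 n) :
    a * b ∈ grEven 𝕜 n := by
  rw [mem_grOdd] at ha hb
  rw [mem_grEven, map_mul, ha, hb, neg_mul_neg]

theorem grOdd_mul_grEven {a b : Gr 𝕜 n} (ha : a ∈ grOdd 𝕜 n) (hb : b ∈ grEven 𝕜 n) :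
    a * b ∈ grOdd 𝕜 n := by
  rw [← grEven_comm hb]
  exact mul_mem_grOdd hb ha

theorem superTmul_mem_points {y : V.Ext n} (hy : y ∈ V.points n) {z : W.Ext n}
    (hz : z ∈ W.points n) : V.superTmul W y z ∈ (V.tensor W).points n := by
  induction hy using points_induction with
  | zero => rw [map_zero, LinearMap.zero_apply]; exact zero_mem _
  | add y y' _ _ hy hy' => rw [map_add, LinearMap.add_apply]; exact add_mem hy hy'
  | even a ha y hy =>
    induction hz using points_induction with
    | zero => rw [map_zero]; exact zero_mem _
    | add z z' _ _ hz hz' => rw [map_add]; exact add_mem hz hz'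
    | even b hb z hz =>
      rw [superTmul_even_tmul V W _ _ hy]
      exact (V.tensor W).tmul_mem_points_of_even (mul_mem_grEven ha hb)
        (Submodule.mem_sup_left ⟨⟨y, hy⟩ ⊗ₜ ⟨z, hz⟩, rfl⟩)
    | odd b hb z hz =>
      rw [superTmul_even_tmul V W _ _ hy]
      exact (V.tensor W).tmul_mem_points_of_odd (mul_mem_grOdd ha hb)
        (Submodule.mem_sup_left ⟨⟨y, hy⟩ ⊗ₜ ⟨z, hz⟩, rfl⟩)
  | odd a ha y hy =>
    induction hz using points_induction with
    | zero => rw [map_zero]; exact zero_mem _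
    | add z z' _ _ hz hz' => rw [map_add]; exact add_mem hz hz'
    | even b hb z hz =>
      rw [superTmul_odd_tmul V W _ _ hy, involute_mem_grEven hb]
      exact (V.tensor W).tmul_mem_points_of_odd (grOdd_mul_grEven ha hb)
        (Submodule.mem_sup_right ⟨⟨y, hy⟩ ⊗ₜ ⟨z, hz⟩, rfl⟩)
    | odd b hb z hz =>
      rw [superTmul_odd_tmul V W _ _ hy, involute_mem_grOdd hb, mul_neg]
      exact (V.tensor W).tmul_mem_points_of_even (neg_mem (grOdd_mul_grOdd ha hb))
        (Submodule.mem_sup_right ⟨⟨y, hy⟩ ⊗ₜ ⟨z, hz⟩, rfl⟩)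

/-- The coordinates of a product are polynomial in the coordinates of the factors, up to the parity
involution; this is what makes the tensor product smooth. -/
theorem coord_superTmul (f : V.carrier →ₗ[𝕜] 𝕜) (g : W.carrier →ₗ[𝕜] 𝕜) (y : V.Ext n)
    (z : W.Ext n) :
    (V.tensor W).coord (TensorProduct.dualDistrib 𝕜 _ _ (f ⊗ₜ g)) n (V.superTmul W y z) =
      V.coord (f ∘ₗ V.evenProj) n y * W.coord g n z +
        V.coord (f ∘ₗ V.oddProj) n y * CliffordAlgebra.involute (W.coord g n z) := by
  induction y using TensorProduct.induction_on with
  | zero => simp only [map_zero, LinearMap.zero_apply, zero_mul, add_zero]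
  | add y y' hy hy' =>
    simp only [map_add, LinearMap.add_apply, hy, hy', add_mul]
    abel
  | tmul a y =>
    induction z using TensorProduct.induction_on with
    | zero => simp only [map_zero, mul_zero, add_zero]
    | add z z' hz hz' =>
      simp only [map_add, hz, hz', mul_add]
      abel
    | tmul b z =>
      rw [superTmul_tmul, map_add, coord_tmul, coord_tmul, coord_tmul, coord_tmul, coord_tmul,
        TensorProduct.dualDistrib_apply, TensorProduct.dualDistrib_apply, map_smul, smul_mul_smul_comm,
        smul_mul_smul_comm]
      rfl

/-- The contraction with an even coordinate of the first factor. -/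
def contract (i : Fin V.evenDim) (n : ℕ) : (V.tensor W).Ext n →ₗ[𝕜] W.Ext n :=
  LinearMap.lTensor (Gr 𝕜 n)
    ((TensorProduct.lid 𝕜 W.carrier).toLinearMap ∘ₗ LinearMap.rTensor W.carrier (V.evenFun i))

theorem contract_tmul (i : Fin V.evenDim) (a : Gr 𝕜 n) (y : V.carrier) (z : W.carrier) :
    V.contract W i n (a ⊗ₜ (y ⊗ₜ z)) = a ⊗ₜ (V.evenFun i y • z) := rfl

/-- An even coordinate kills the odd vectors of `V`, so only terms without a sign survive. Where
`v_i` is invertible, the identity recovers `w` from `v ⊗ w`. -/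
theorem contract_superTmul (i : Fin V.evenDim) {y : V.Ext n} (hy : y ∈ V.points n) (z : W.Ext n) :
    V.contract W i n (V.superTmul W y z) = V.coord (V.evenFun i) n y • z := by
  induction hy using points_induction with
  | zero => simp only [map_zero, LinearMap.zero_apply, zero_smul]
  | add y y' _ _ hy hy' => simp only [map_add, LinearMap.add_apply, hy, hy', add_smul]
  | even a ha y hy =>
    induction z using TensorProduct.induction_on with
    | zero => simp only [map_zero, smul_zero]
    | add z z' hz hz' => simp only [map_add, smul_add, hz, hz']
    | tmul b z =>
      rw [superTmul_even_tmul V W _ _ hy, contract_tmul, coord_tmul, TensorProduct.smul_tmul',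
        smul_eq_mul, smul_mul_assoc, TensorProduct.smul_tmul]
  | odd a ha y hy =>
    induction z using TensorProduct.induction_on with
    | zero => simp only [map_zero, smul_zero]
    | add z z' hz hz' => simp only [map_add, smul_add, hz, hz']
    | tmul b z =>
      rw [superTmul_odd_tmul V W _ _ hy, contract_tmul, coord_tmul, V.evenFun_of_mem_odd i hy,
        zero_smul, TensorProduct.tmul_zero, zero_smul, zero_smul]

theorem coord_contract (i : Fin V.evenDim) (g : W.carrier →ₗ[𝕜] 𝕜) (t : (V.tensor W).Ext n) :
    W.coord g n (V.contract W i n t) =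
      (V.tensor W).coord (TensorProduct.dualDistrib 𝕜 _ _ (V.evenFun i ⊗ₜ g)) n t := by
  induction t using TensorProduct.induction_on with
  | zero => simp only [map_zero]
  | add t t' h h' => simp only [map_add, h, h']
  | tmul a t =>
    induction t using TensorProduct.induction_on with
    | zero => simp only [map_zero, TensorProduct.tmul_zero]
    | add t t' h h' => simp only [map_add, TensorProduct.tmul_add, h, h']
    | tmul y z =>
      rw [contract_tmul, coord_tmul, coord_tmul, TensorProduct.dualDistrib_apply, map_smul,
        smul_eq_mul]

theorem extMap_contract (i : Fin V.evenDim) (ρ : GrHom 𝕜 n m) (t : (V.tensor W).Ext n) :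
    W.extMap ρ (V.contract W i n t) = V.contract W i m ((V.tensor W).extMap ρ t) := by
  induction t using TensorProduct.induction_on with
  | zero => simp only [map_zero]
  | add t t' h h' => simp only [map_add, h, h']
  | tmul a t => rfl

/-- The contraction preserves parity: of the two summands in each parity of `V ⊗ W`, the one with
odd first factor is annihilated, and the other is sent to vectors of the parity of its second
factor. -/
theorem contract_mem_points (i : Fin V.evenDim) {t : (V.tensor W).Ext n}
    (ht : t ∈ (V.tensor W).points n) : V.contract W i n t ∈ W.points n := by
  have hl (b : V.even ⊗[𝕜] W.even) : (TensorProduct.lid 𝕜 W.carrier)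
      (LinearMap.rTensor W.carrier (V.evenFun i)
        (TensorProduct.map V.even.subtype W.even.subtype b)) ∈ W.even := by
    induction b using TensorProduct.induction_on with
    | zero => simp only [map_zero, zero_mem]
    | add b c hb hc => simp only [map_add]; exact add_mem hb hc
    | tmul y z => exact W.even.smul_mem _ z.2
  have hl' (b : V.even ⊗[𝕜] W.odd) : (TensorProduct.lid 𝕜 W.carrier)
      (LinearMap.rTensor W.carrier (V.evenFun i)
        (TensorProduct.map V.even.subtype W.odd.subtype b)) ∈ W.odd := by
    induction b using TensorProduct.induction_on with
    | zero => simp only [map_zero, zero_mem]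
    | add b c hb hc => simp only [map_add]; exact add_mem hb hc
    | tmul y z => exact W.odd.smul_mem _ z.2
  have hr (S : Submodule 𝕜 W.carrier) (b : V.odd ⊗[𝕜] S) : (TensorProduct.lid 𝕜 W.carrier)
      (LinearMap.rTensor W.carrier (V.evenFun i)
        (TensorProduct.map V.odd.subtype S.subtype b)) = 0 := by
    induction b using TensorProduct.induction_on with
    | zero => simp only [map_zero]
    | add b c hb hc => simp only [map_add, hb, hc, add_zero]
    | tmul y z =>
      change V.evenFun i y • (z : W.carrier) = 0
      rw [V.evenFun_of_mem_odd i y.2, zero_smul]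
  induction ht using points_induction with
  | zero => rw [map_zero]; exact zero_mem _
  | add y z _ _ hy hz => rw [map_add]; exact add_mem hy hz
  | even a ha y hy =>
    obtain ⟨_, ⟨b, rfl⟩, _, ⟨c, rfl⟩, rfl⟩ := Submodule.mem_sup.1 hy
    refine W.tmul_mem_points_of_even ha ?_
    rw [map_add]
    refine add_mem (hl b) ?_
    change (TensorProduct.lid 𝕜 W.carrier) (LinearMap.rTensor W.carrier (V.evenFun i) _) ∈ _
    rw [hr]
    exact zero_mem _
  | odd a ha y hy =>
    obtain ⟨_, ⟨b, rfl⟩, _, ⟨c, rfl⟩, rfl⟩ := Submodule.mem_sup.1 hy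
    refine W.tmul_mem_points_of_odd ha ?_
    rw [map_add]
    refine add_mem (hl' b) ?_
    change (TensorProduct.lid 𝕜 W.carrier) (LinearMap.rTensor W.carrier (V.evenFun i) _) ∈ _
    rw [hr]
    exact zero_mem _

/-- Contraction with an even coordinate, as a smooth map. -/
def contractHom (i : Fin V.evenDim) : (V.tensor W).toSpace.Hom W.toSpace where
  app n t := ⟨V.contract W i n t.1, V.contract_mem_points W i t.2⟩
  natural ρ t := Subtype.ext (V.extMap_contract W i ρ t.1).symm
  smooth _ hφ g := (hφ _).congr fun _ _ => V.coord_contract W i g _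

/-- The tensor product of vectors, as a smooth map. -/
def tensorHom : (V.toSpace.prod W.toSpace).Hom (V.tensor W).toSpace where
  app n t := ⟨V.superTmul W t.1.1 t.2.1, V.superTmul_mem_points W t.1.2 t.2.2⟩
  natural ρ t := Subtype.ext (V.extMap_superTmul W ρ t.1.1 t.2.1).symm
  smooth φ hφ b := by
    -- By finite-dimensionality every functional on `V ⊗ W` is a sum of products of functionals, so
    -- induction reduces to a single product.
    obtain ⟨t, rfl⟩ := (TensorProduct.dualDistribEquiv 𝕜 V.carrier W.carrier).surjective b
    change IsSuperfunction _ _ fun n y => (V.tensor W).coord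
      (TensorProduct.dualDistrib 𝕜 V.carrier W.carrier t) n
      (V.superTmul W (φ.app n y).1.1 (φ.app n y).2.1)
    induction t using TensorProduct.induction_on with
    | zero =>
      refine (isSuperfunction_scalar _ _ 0).congr fun n y => ?_
      rw [map_zero, map_zero, coord, LinearMap.lTensor_zero, LinearMap.comp_zero,
        LinearMap.zero_apply]
    | add t t' h h' =>
      refine (h.add h').congr fun n y => ?_
      rw [map_add, coord, LinearMap.lTensor_add, LinearMap.comp_add, LinearMap.add_apply]
      rfl
    | tmul f g =>
      exact (((hφ.1 (f ∘ₗ V.evenProj)).mul (hφ.2 g)).add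
        ((hφ.1 (f ∘ₗ V.oddProj)).mul (hφ.2 g).involute)).congr fun n y =>
          V.coord_superTmul W f g _ _

end VectorSuperspace

/-! ### Lines in coordinate space -/

section Lines

variable {𝕜 : Type u} [RCLike 𝕜] {p : ℕ}

/-- The Hermitian projection to the line spanned by a vector, as a matrix. -/
def lineMatrix (y : Fin p → 𝕜) (k l : Fin p) : 𝕜 :=
  y k * starRingEnd 𝕜 (y l) / ∑ i, y i * starRingEnd 𝕜 (y i)

theorem sum_mul_conj_ne_zero {y : Fin p → 𝕜} (hy : y ≠ 0) :
    ∑ i, y i * starRingEnd 𝕜 (y i) ≠ 0 := by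
  simp only [RCLike.mul_conj]
  norm_cast
  intro h
  rw [Finset.sum_eq_zero_iff_of_nonneg fun i _ => by positivity] at h
  refine hy (funext fun i => ?_)
  simpa using h i (Finset.mem_univ i)

theorem lineMatrix_smul {c : 𝕜} (hc : c ≠ 0) (y : Fin p → 𝕜) :
    lineMatrix (c • y) = lineMatrix y := by
  funext k l
  have h0 : c * starRingEnd 𝕜 c ≠ 0 := mul_ne_zero hc ((map_ne_zero _).2 hc)
  have h1 : ∑ i, (c • y) i * starRingEnd 𝕜 ((c • y) i) =
      c * starRingEnd 𝕜 c * ∑ i, y i * starRingEnd 𝕜 (y i) := by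
    rw [Finset.mul_sum]
    refine Finset.sum_congr rfl fun i _ => ?_
    simp only [Pi.smul_apply, smul_eq_mul, map_mul]
    ring
  rw [lineMatrix, lineMatrix, h1, ← mul_div_mul_left (y k * starRingEnd 𝕜 (y l)) _ h0]
  simp only [Pi.smul_apply, smul_eq_mul, map_mul]
  ring

/-- A column of the projection matrix is a multiple of the vector. Choosing an index `l` with `z l ≠
0` and comparing the `l`-th columns expresses `z` through `y`. -/
theorem exists_smul_of_lineMatrix_eq {y z : Fin p → 𝕜} (hy : y ≠ 0) (hz : z ≠ 0)
    (h : lineMatrix y = lineMatrix z) : ∃ c : 𝕜, c ≠ 0 ∧ z = c • y := by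
  obtain ⟨l, hl⟩ := Function.ne_iff.1 hz
  have hN := sum_mul_conj_ne_zero hy
  have hN' := sum_mul_conj_ne_zero hz
  have hl' : starRingEnd 𝕜 (z l) ≠ 0 := (map_ne_zero _).2 hl
  have key : z = (starRingEnd 𝕜 (y l) / (∑ i, y i * starRingEnd 𝕜 (y i)) *
      (∑ i, z i * starRingEnd 𝕜 (z i)) / starRingEnd 𝕜 (z l)) • y := by
    funext k
    have h1 := congrFun (congrFun h k) l
    rw [lineMatrix, lineMatrix] at h1
    rw [Pi.smul_apply, smul_eq_mul]
    field_simp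
    field_simp at h1
    linear_combination -h1
  refine ⟨_, fun h0 => hz ?_, key⟩
  rw [key, h0, zero_smul]

theorem continuous_lineMatrix {X : Type*} [TopologicalSpace X] {f : X → Fin p → 𝕜}
    (hf : Continuous f) (h0 : ∀ a, f a ≠ 0) : Continuous fun a => lineMatrix (f a) := by
  refine continuous_pi fun k => continuous_pi fun l => ?_
  have hc (i) : Continuous fun a => f a i := (continuous_apply i).comp hf
  exact ((hc k).mul (RCLike.continuous_conj.comp (hc l))).div
    (continuous_finsetSum _ fun i _ => (hc i).mul (RCLike.continuous_conj.comp (hc i)))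
    fun a => sum_mul_conj_ne_zero (h0 a)

end Lines

namespace VectorSuperspace

variable {𝕜 : Type u} [RCLike 𝕜] (V : VectorSuperspace.{u, v} 𝕜) (W : VectorSuperspace.{u, w} 𝕜)
variable {n m : ℕ}

theorem isUnit_coord {i : Fin V.evenDim} {y : V.Ext n} (hy : y ∈ V.points n)
    (h : V.bodyVec y i ≠ 0) : IsUnit (V.coord (V.evenFun i) n y) :=
  isUnit_of_body_ne_zero (V.coord_evenFun_mem i hy) h

theorem exists_bodyVec_ne_zero (y : V.nonzero.pts n) : ∃ i, V.bodyVec y.1.1 i ≠ 0 :=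
  Function.ne_iff.1 (V.bodyVec_ne_zero y)

theorem projMk_eq_iff {y z : V.nonzero.pts n} :
    V.projMk y = V.projMk z ↔ ∃ c : Gm 𝕜 n, z.1.1 = c.val • y.1.1 :=
  Quotient.eq (r := V.projSetoid n)

theorem wprojMk_eq_iff {y y' : V.nonzero.pts n} {z z' : W.nonzero.pts n} :
    V.wprojMk W y z = V.wprojMk W y' z' ↔
      ∃ c : Gm 𝕜 n, y'.1.1 = c.val • y.1.1 ∧ z'.1.1 = c⁻¹.val • z.1.1 :=
  Quotient.eq (r := V.wprojSetoid W n)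

theorem exists_projMk (l : V.proj.pts n) : ∃ y, V.projMk y = l := Quotient.exists_rep l

theorem exists_wprojMk (l : (V.wproj W).pts n) : ∃ y z, V.wprojMk W y z = l := by
  obtain ⟨⟨y, z⟩, h⟩ := Quotient.exists_rep l
  exact ⟨y, z, h⟩

theorem proj_base_mk (y : V.nonzero.pts n) :
    V.proj.base (V.projMk y) = V.projMk (V.nonzero.base y) := rfl

theorem bodyVec_base (y : V.nonzero.pts n) :
    V.bodyVec (V.nonzero.base y).1.1 = V.bodyVec y.1.1 := V.bodyVec_extMap _ _

/-! ### Affine charts of the projective superspace -/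

/-- The set of lines on which an even coordinate does not vanish. -/
def affineSet (i : Fin V.evenDim) : Set (V.proj.pts 0) :=
  {l | ∃ y, V.projMk y = l ∧ V.bodyVec y.1.1 i ≠ 0}

/-- The condition does not depend on the representative, because elements of `Gm` have nonzero body.
-/
theorem projMk_mem_affineSet {i : Fin V.evenDim} {y : V.nonzero.pts 0} :
    V.projMk y ∈ V.affineSet i ↔ V.bodyVec y.1.1 i ≠ 0 := by
  refine ⟨?_, fun h => ⟨y, rfl, h⟩⟩
  rintro ⟨z, hz, h⟩
  obtain ⟨c, hc⟩ := V.projMk_eq_iff.1 hz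
  rw [hc, bodyVec_smul]
  exact mul_ne_zero c.body_ne_zero h

theorem base_projMk_mem_affineSet {i : Fin V.evenDim} {y : V.nonzero.pts n} :
    V.proj.base (V.projMk y) ∈ V.affineSet i ↔ V.bodyVec y.1.1 i ≠ 0 := by
  rw [proj_base_mk, projMk_mem_affineSet, bodyVec_base]

theorem exists_mem_affineSet (l : V.proj.pts 0) : ∃ i, l ∈ V.affineSet i := by
  obtain ⟨y, rfl⟩ := V.exists_projMk l
  obtain ⟨i, hi⟩ := V.exists_bodyVec_ne_zero y
  exact ⟨i, y, rfl, hi⟩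

theorem isOpen_affineSet (i : Fin V.evenDim) : IsOpen[V.proj.topology] (V.affineSet i) := by
  refine Space.isOpen_quot ?_
  have h : (Quotient.mk (V.projSetoid 0) ⁻¹' V.affineSet i) =
      {y : V.nonzero.pts 0 | V.bodyVec y.1.1 i ≠ 0} := by
    ext y
    exact V.projMk_mem_affineSet
  rw [h]
  let := V.nonzero.topology
  exact isOpen_ne.preimage ((continuous_apply i).comp V.continuous_bodyVec_nonzero)

/-- The projection from the nonzero vectors to the projective superspace. -/
def projHom : V.nonzero.Hom V.proj := Space.quotProj _ _

/-- The Hermitian projection matrix of the underlying ordinary vector is a continuous invariant of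
the line, and it determines the line. -/
theorem t2Space_proj : @T2Space _ V.proj.topology := by
  let f : V.proj.pts 0 → Fin V.evenDim → Fin V.evenDim → 𝕜 :=
    Quotient.lift (s := V.projSetoid 0) (fun y => lineMatrix (V.bodyVec y.1.1)) (by
      rintro y z ⟨c, hc⟩
      rw [hc, bodyVec_smul, lineMatrix_smul c.body_ne_zero])
  refine Space.t2Space_of_injective (f := f) (Space.continuous_quot ?_) ?_
  · let := V.nonzero.topology
    exact continuous_lineMatrix V.continuous_bodyVec_nonzero V.bodyVec_ne_zero
  · intro l l' h
    obtain ⟨y, rfl⟩ := V.exists_projMk l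
    obtain ⟨z, rfl⟩ := V.exists_projMk l'
    obtain ⟨c, hc, hcz⟩ := exists_smul_of_lineMatrix_eq (V.bodyVec_ne_zero y)
      (V.bodyVec_ne_zero z) h
    obtain ⟨d, hd, -⟩ := exists_gm (a := algebraMap 𝕜 (Gr 𝕜 0) c) (algebraMap_mem_grEven c)
      (by rwa [AlgHom.commutes])
    refine V.projMk_eq_iff.2 ⟨d, V.ext_of_bodyVec z.1.2 (V.smul_mem_points d.val_mem y.1.2) ?_⟩
    rw [hcz, bodyVec_smul, hd, AlgHom.commutes]
    rfl

variable {V} {d : ℕ} {i : Fin V.evenDim}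

/-- The inclusion of the affine hyperplane on which an even coordinate is equal to one, in
coordinates. -/
def affineCoord (σ : Fin d ≃ {k : Fin V.evenDim // k ≠ i}) (y : Coord 𝕜 d V.oddDim n) :
    Coord 𝕜 V.evenDim V.oddDim n :=
  (fun k => if h : k = i then ⟨1, by rw [mem_grEven, map_one]⟩ else y.1 (σ.symm ⟨k, h⟩), y.2)

theorem affineCoord_self (σ : Fin d ≃ {k : Fin V.evenDim // k ≠ i}) (y : Coord 𝕜 d V.oddDim n) :
    ((affineCoord σ y).1 i : Gr 𝕜 n) = 1 := congrArg Subtype.val (dif_pos rfl)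

theorem affineCoord_apply (σ : Fin d ≃ {k : Fin V.evenDim // k ≠ i}) (y : Coord 𝕜 d V.oddDim n)
    (k : Fin d) : ((affineCoord σ y).1 (σ k) : Gr 𝕜 n) = y.1 k :=
  congrArg Subtype.val ((dif_neg (σ k).2).trans (by
    rw [Subtype.coe_eta, Equiv.symm_apply_apply]))

theorem eq_or_exists_eq (σ : Fin d ≃ {k : Fin V.evenDim // k ≠ i}) (k : Fin V.evenDim) :
    k = i ∨ ∃ l, k = σ l := by
  by_cases h : k = i
  · exact Or.inl h
  · exact Or.inr ⟨σ.symm ⟨k, h⟩, by rw [Equiv.apply_symm_apply]⟩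

/-- The inclusion of the affine hyperplane on which an even coordinate is equal to one. -/
def affineHom (σ : Fin d ≃ {k : Fin V.evenDim // k ≠ i}) :
    (Space.ofDomain (⊤ : Opens (Fin d → 𝕜)) V.oddDim).Hom
      (Space.ofDomain (⊤ : Opens (Fin V.evenDim → 𝕜)) V.oddDim) where
  app n y := ⟨affineCoord σ y.1, trivial⟩
  natural {n m} ρ y := by
    refine Subtype.ext (Prod.ext (funext fun k => Subtype.ext ?_) rfl)
    change Subtype.val ((affineCoord σ _).1 k) = ρ.toAlgHom (Subtype.val ((affineCoord σ y.1).1 k))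
    obtain rfl | ⟨l, rfl⟩ := eq_or_exists_eq σ k
    · rw [affineCoord_self, affineCoord_self, map_one]
    · rw [affineCoord_apply, affineCoord_apply]
      rfl
  smooth φ hφ := by
    refine ⟨fun k => ?_, hφ.2⟩
    obtain rfl | ⟨l, rfl⟩ := eq_or_exists_eq σ k
    · exact (isSuperfunction_scalar _ _ 1).congr fun n y =>
        (affineCoord_self σ _).trans (map_one _).symm
    · exact (hφ.1 l).congr fun n y => affineCoord_apply σ _ l

/-- The vector with given affine coordinates. -/
def affineVec (σ : Fin d ≃ {k : Fin V.evenDim // k ≠ i}) (y : Coord 𝕜 d V.oddDim n) : V.Ext n :=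
  V.ofCoord (affineCoord σ y)

theorem coord_affineVec_self (σ : Fin d ≃ {k : Fin V.evenDim // k ≠ i})
    (y : Coord 𝕜 d V.oddDim n) : V.coord (V.evenFun i) n (affineVec σ y) = 1 :=
  (V.coord_evenFun_ofCoord _ i).trans (affineCoord_self σ y)

theorem coord_affineVec (σ : Fin d ≃ {k : Fin V.evenDim // k ≠ i})
    (y : Coord 𝕜 d V.oddDim n) (k : Fin d) :
    V.coord (V.evenFun (σ k)) n (affineVec σ y) = y.1 k :=
  (V.coord_evenFun_ofCoord _ _).trans (affineCoord_apply σ y k)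

theorem coord_odd_affineVec (σ : Fin d ≃ {k : Fin V.evenDim // k ≠ i})
    (y : Coord 𝕜 d V.oddDim n) (j : Fin V.oddDim) :
    V.coord (V.oddFun j) n (affineVec σ y) = y.2 j :=
  V.coord_oddFun_ofCoord _ j

theorem bodyVec_affineVec (σ : Fin d ≃ {k : Fin V.evenDim // k ≠ i})
    (y : Coord 𝕜 d V.oddDim n) : V.bodyVec (affineVec σ y) i = 1 := by
  rw [bodyVec, coord_affineVec_self, map_one]

theorem affineVec_injective (σ : Fin d ≃ {k : Fin V.evenDim // k ≠ i}) :
    Function.Injective (affineVec σ (n := n)) := by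
  intro y z h
  refine Prod.ext (funext fun k => Subtype.ext ?_) (funext fun j => Subtype.ext ?_)
  · rw [← coord_affineVec σ y, h, coord_affineVec]
  · rw [← coord_odd_affineVec σ y, h, coord_odd_affineVec]

theorem exists_affineVec_eq (σ : Fin d ≃ {k : Fin V.evenDim // k ≠ i}) {z : V.Ext n}
    (hz : z ∈ V.points n) (h : V.coord (V.evenFun i) n z = 1) : ∃ y, affineVec σ y = z := by
  refine ⟨(fun k => ⟨_, V.coord_evenFun_mem (σ k) hz⟩, fun j => ⟨_, V.coord_oddFun_mem j hz⟩),
    V.ext_of_coord (fun k => ?_) fun j => coord_odd_affineVec σ _ j⟩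
  obtain rfl | ⟨l, rfl⟩ := eq_or_exists_eq σ k
  · rw [coord_affineVec_self, h]
  · rw [coord_affineVec]

/-- The parametrization of an affine chart by nonzero vectors. -/
def affineNonzeroHom (σ : Fin d ≃ {k : Fin V.evenDim // k ≠ i}) :
    (Space.ofDomain (⊤ : Opens (Fin d → 𝕜)) V.oddDim).Hom V.nonzero :=
  ((V.ofCoordHom ⊤).comp (affineHom σ)).codRestrict _ fun y h => by
    change affineVec σ y.1 = 0 at h
    have h1 := bodyVec_affineVec σ y.1
    rw [h, bodyVec_zero] at h1
    exact zero_ne_one h1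

/-- The parametrization of an affine chart of the projective superspace. -/
def affineChartHom (σ : Fin d ≃ {k : Fin V.evenDim // k ≠ i}) :
    (Space.ofDomain (⊤ : Opens (Fin d → 𝕜)) V.oddDim).Hom (V.proj.restrict (V.affineSet i)) :=
  (V.projHom.comp (affineNonzeroHom σ)).codRestrict _ fun y =>
    V.projMk_mem_affineSet.2 (by
      have h1 := bodyVec_affineVec σ y.1
      exact fun h => one_ne_zero (h1.symm.trans h))

/-- A line has at most one representative with `i`-th coordinate one, found by dividing any
representative by that coordinate. This formula gives both injectivity of the chart and smoothness
of its inverse. -/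
theorem affineVec_eq_smul (σ : Fin d ≃ {k : Fin V.evenDim // k ≠ i})
    (y : (superdomain (⊤ : Opens (Fin d → 𝕜)) V.oddDim).pts n) {z : V.nonzero.pts n}
    (h : V.projMk z = ((affineChartHom σ).app n y).1) :
    affineVec σ y.1 = Ring.inverse (V.coord (V.evenFun i) n z.1.1) • z.1.1 := by
  obtain ⟨c, hc⟩ := V.projMk_eq_iff.1 h
  change affineVec σ y.1 = _ at hc
  have h1 := congrArg (V.coord (V.evenFun i) n) hc
  rw [coord_affineVec_self, coord_smul] at h1
  -- By `h1` the scalar `c` is an inverse of the `i`-th coordinate of `z`, since the normalized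
  -- coordinate is one.
  have h2 : IsUnit (V.coord (V.evenFun i) n z.1.1) :=
    ⟨⟨_, c.val, by rw [grEven_comm (V.coord_evenFun_mem i z.1.2), h1], h1.symm⟩, rfl⟩
  rw [hc]
  congr 1
  refine h2.mul_right_cancel ?_
  rw [← h1, Ring.inverse_mul_cancel _ h2]

/-- The affine charts of the projective superspace. -/
def affineChart (σ : Fin d ≃ {k : Fin V.evenDim // k ≠ i}) :
    (Space.ofDomain (⊤ : Opens (Fin d → 𝕜)) V.oddDim).Iso (V.proj.restrict (V.affineSet i)) :=
  Space.Iso.ofBijective (affineChartHom σ)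
    (fun n => by
      constructor
      · intro y z h
        have h1 : affineVec σ z.1 =
            Ring.inverse (V.coord (V.evenFun i) n (affineVec σ y.1)) • affineVec σ y.1 :=
          affineVec_eq_smul σ z (z := (affineNonzeroHom σ).app n y) (congrArg Subtype.val h)
        rw [coord_affineVec_self, Ring.inverse_one, one_smul] at h1
        exact Subtype.ext (affineVec_injective σ h1.symm)
      · rintro ⟨l, hl⟩
        obtain ⟨z, rfl⟩ := V.exists_projMk l
        have h0 := V.base_projMk_mem_affineSet.1 hl
        have hu := V.isUnit_coord z.1.2 h0
        obtain ⟨c, hc, hc'⟩ := exists_gm (V.coord_evenFun_mem i z.1.2) h0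
        obtain ⟨y, hy⟩ := exists_affineVec_eq σ (V.smul_mem_points c⁻¹.val_mem z.1.2)
          (by rw [coord_smul, hc', Ring.inverse_mul_cancel _ hu])
        refine ⟨⟨y, trivial⟩, Subtype.ext (V.projMk_eq_iff.2 ⟨c, ?_⟩)⟩
        change _ = c.val • affineVec σ y
        rw [hy, smul_smul, Gm.val_mul_inv, one_smul])
    fun {p q U} φ hφ => by
      refine Space.plot_local (Space.ofDomain _ _) φ fun a ha => ?_
      obtain ⟨U', hU, ψ, ha', hψ, hψφ⟩ := hφ a ha
      have h1 (n : ℕ) (y : (superdomain U' q).pts n) : V.projMk (ψ.app n y) =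
          ((affineChartHom σ).app n (φ.app n ((superdomainIncl hU q).app n y))).1 :=
        congrArg (fun χ => χ.app n y) hψφ
      have h2 (n : ℕ) (y : (superdomain U' q).pts n) := affineVec_eq_smul σ _ (h1 n y)
      have hu (n : ℕ) (y : (superdomain U' q).pts n) :
          IsUnit (V.coord (V.evenFun i) n (ψ.app n y).1.1) := by
        refine V.isUnit_coord (ψ.app n y).1.2 (V.base_projMk_mem_affineSet.1 ?_)
        rw [h1]
        exact ((affineChartHom σ).app n _).2
      have hinv := (hψ (V.evenFun i)).inverse hu
      -- The affine coordinates are the quotients of the coordinates of the local lift `ψ` by its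
      -- invertible `i`-th coordinate.
      refine ⟨U', hU, ha', fun k => ?_, fun j => ?_⟩
      · refine (hinv.mul (hψ (V.evenFun (σ k)))).congr fun n y => ?_
        have h3 := congrArg (V.coord (V.evenFun (σ k)) n) (h2 n y)
        rwa [coord_affineVec, coord_smul] at h3
      · refine (hinv.mul (hψ (V.oddFun j))).congr fun n y => ?_
        have h3 := congrArg (V.coord (V.oddFun j) n) (h2 n y)
        rwa [coord_odd_affineVec, coord_smul] at h3

variable (V)

theorem exists_affineChart (i : Fin V.evenDim) : ∃ (p q : ℕ) (U : Opens (Fin p → 𝕜)),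
    Nonempty ((Space.ofDomain U q).Iso (V.proj.restrict (V.affineSet i))) :=
  ⟨_, _, _, ⟨affineChart (Fintype.equivFin {k : Fin V.evenDim // k ≠ i}).symm⟩⟩

theorem isSupermanifold_proj : V.proj.IsSupermanifold :=
  Space.isSupermanifold_of_countable_atlas V.t2Space_proj V.affineSet V.isOpen_affineSet
    V.exists_mem_affineSet V.exists_affineChart

end VectorSuperspace

/-! ### Maps into and out of products, and maps into subfunctors. -/

namespace Space

variable {𝕜 : Type u} [RCLike 𝕜] {M : Space.{u, v} 𝕜} {N : Space.{u, w} 𝕜}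

/-- The first projection of a product. -/
def fst (M : Space.{u, v} 𝕜) (N : Space.{u, w} 𝕜) : (M.prod N).Hom M where
  app _ y := y.1
  natural _ _ := rfl
  smooth _ hφ := hφ.1

/-- The second projection of a product. -/
def snd (M : Space.{u, v} 𝕜) (N : Space.{u, w} 𝕜) : (M.prod N).Hom N where
  app _ y := y.2
  natural _ _ := rfl
  smooth _ hφ := hφ.2

/-- The smooth map to a product with given components. -/
def Hom.prodMk {K : Space.{u, x} 𝕜} (f : K.Hom M) (g : K.Hom N) : K.Hom (M.prod N) where
  app n y := (f.app n y, g.app n y)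
  natural ρ y := Prod.ext (f.natural ρ y) (g.natural ρ y)
  smooth φ hφ := ⟨f.smooth φ hφ, g.smooth φ hφ⟩

theorem mem_of_restrict {A : Set (M.pts 0)} (y : (M.restrict A).pts 0) : y.1 ∈ A := by
  have h : M.base y.1 ∈ A := y.2
  rwa [M.base_zero] at h

/-- A smooth map with values in a subfunctor. -/
def Hom.codSub (f : M.Hom N) (S : ∀ n, Set (N.pts n))
    (hS : ∀ (n m : ℕ) (ρ : GrHom 𝕜 n m), ∀ y ∈ S n, N.map ρ y ∈ S m)
    (h : ∀ n y, f.app n y ∈ S n) : M.Hom (N.sub S hS) where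
  app n y := ⟨f.app n y, h n y⟩
  natural ρ y := Subtype.ext (f.natural ρ y)
  smooth _ hφ := f.smooth _ hφ

end Space

namespace VectorSuperspace

variable {𝕜 : Type u} [RCLike 𝕜] (V : VectorSuperspace.{u, v} 𝕜) (W : VectorSuperspace.{u, w} 𝕜)
variable {n m : ℕ}

/-! ### The projection of the weighted projective superspace and its local trivializations -/

/-- The projection `[v‖w] ↦ [v]`. -/
def wprojFst : (V.wproj W).Hom V.proj :=
  Space.quotLift _ _ (V.projHom.comp (Space.fst V.nonzero W.nonzero)) (by
    rintro n ⟨y, z⟩ ⟨y', z'⟩ ⟨c, hc, -⟩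
    exact V.projMk_eq_iff.2 ⟨c, hc⟩)

/-- The map `(v, w) ↦ vᵢ w`. -/
def scaleHom (i : Fin V.evenDim) : (V.nonzero.prod W.nonzero).Hom W.toSpace where
  app n t := ⟨V.coord (V.evenFun i) n t.1.1.1 • t.2.1.1,
    W.smul_mem_points (V.coord_evenFun_mem i t.1.1.2) t.2.1.2⟩
  natural ρ t := Subtype.ext (by
    change V.coord (V.evenFun i) _ (V.extMap ρ t.1.1.1) • W.extMap ρ t.2.1.1 = W.extMap ρ _
    rw [coord_extMap, extMap_smul])
  smooth _ hφ b := ((hφ.1 (V.evenFun i)).mul (hφ.2 b)).congr fun _ _ => W.coord_smul b _ _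

/-- The map `[v‖w] ↦ vᵢ w`. -/
def wprojScale (i : Fin V.evenDim) : (V.wproj W).Hom W.toSpace :=
  Space.quotLift _ _ (V.scaleHom W i) (by
    rintro n ⟨y, z⟩ ⟨y', z'⟩ ⟨c, hc, hc'⟩
    refine Subtype.ext ?_
    change V.coord (V.evenFun i) n y.1.1 • z.1.1 = V.coord (V.evenFun i) n y'.1.1 • z'.1.1
    rw [hc, hc', coord_smul, smul_smul, grEven_comm c.val_mem, mul_assoc, c.val_mul_inv, mul_one])

theorem wprojScale_mk (i : Fin V.evenDim) (y : V.nonzero.pts n) (z : W.nonzero.pts n) :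
    ((V.wprojScale W i).app n (V.wprojMk W y z)).1 = V.coord (V.evenFun i) n y.1.1 • z.1.1 := rfl

theorem bodyVec_coord_smul (i : Fin V.evenDim) (y : V.Ext n) (z : W.Ext n) :
    W.bodyVec (V.coord (V.evenFun i) n y • z) = V.bodyVec y i • W.bodyVec z :=
  W.bodyVec_smul _ _

/-- The line determines `v` up to a unit `c`. After that, equality of the scaled vectors can be
divided by the invertible `v_i`, which forces `w` to change by `c⁻¹`. -/
theorem wprojMk_eq_of_scale_eq {y y' : V.nonzero.pts n} {z z' : W.nonzero.pts n}
    {i : Fin V.evenDim} (hi : V.bodyVec y.1.1 i ≠ 0) (h : V.projMk y = V.projMk y')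
    (h' : V.coord (V.evenFun i) n y.1.1 • z.1.1 = V.coord (V.evenFun i) n y'.1.1 • z'.1.1) :
    V.wprojMk W y z = V.wprojMk W y' z' := by
  obtain ⟨c, hc⟩ := V.projMk_eq_iff.1 h
  refine (V.wprojMk_eq_iff W).2 ⟨c, hc, ?_⟩
  have hu := V.isUnit_coord y.1.2 hi
  rw [hc, coord_smul, grEven_comm c.val_mem, ← smul_smul] at h'
  rw [hu.smul_left_cancel.1 h', smul_smul, c.inv_mul_val, one_smul]

theorem wproj_eq_of_scale_eq {t t' : (V.wproj W).pts n} {i : Fin V.evenDim}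
    (hi : V.proj.base ((V.wprojFst W).app n t) ∈ V.affineSet i)
    (h : (V.wprojFst W).app n t = (V.wprojFst W).app n t')
    (h' : (V.wprojScale W i).app n t = (V.wprojScale W i).app n t') : t = t' := by
  obtain ⟨y, z, rfl⟩ := V.exists_wprojMk W t
  obtain ⟨y', z', rfl⟩ := V.exists_wprojMk W t'
  exact V.wprojMk_eq_of_scale_eq W (V.base_projMk_mem_affineSet.1 hi) h (congrArg Subtype.val h')

theorem bodyVec_wprojScale_ne_zero {t : (V.wproj W).pts n} {i : Fin V.evenDim}
    (hi : V.proj.base ((V.wprojFst W).app n t) ∈ V.affineSet i) :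
    W.bodyVec ((V.wprojScale W i).app n t).1 ≠ 0 := by
  obtain ⟨y, z, rfl⟩ := V.exists_wprojMk W t
  rw [wprojScale_mk, bodyVec_coord_smul]
  exact smul_ne_zero (V.base_projMk_mem_affineSet.1 hi) (W.bodyVec_ne_zero z)

theorem base_wprojFst_mem {i : Fin V.evenDim}
    (t : ((V.wproj W).restrict ((V.wprojFst W).app 0 ⁻¹' V.affineSet i)).pts n) :
    V.proj.base ((V.wprojFst W).app n t.1) ∈ V.affineSet i := by
  rw [Space.base_app]
  exact t.2

/-- The map that underlies the local trivialization over an affine chart. -/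
def affineTrivHom (i : Fin V.evenDim) :
    ((V.wproj W).restrict ((V.wprojFst W).app 0 ⁻¹' V.affineSet i)).Hom
      ((V.proj.restrict (V.affineSet i)).prod W.nonzero) :=
  (((V.wprojFst W).comp (Space.restrictIncl _ _)).codSub _ _ fun _ => V.base_wprojFst_mem W).prodMk
  (((V.wprojScale W i).comp (Space.restrictIncl _ _)).codSub _ _ fun _ t =>
    (W.base_ne_zero_iff _).2 (V.bodyVec_wprojScale_ne_zero W (V.base_wprojFst_mem W t)))

/-- A map to the weighted projective superspace is a plot if its projection and its scaled fibre
coordinate are plots. -/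
theorem isPlot_wproj_of_scale {i : Fin V.evenDim} {p q : ℕ} {U : Opens (Fin p → 𝕜)}
    {φ : (superdomain U q).Hom (V.wproj W).toGrFunctor}
    (hi : ∀ a : U, (V.wprojFst W).app 0 (φ.app 0 (superdomainPt U q a)) ∈ V.affineSet i)
    (h : V.proj.IsPlot ((V.wprojFst W).toHom.comp φ))
    (h' : W.toSpace.IsPlot ((V.wprojScale W i).toHom.comp φ)) : (V.wproj W).IsPlot φ := by
  intro a ha
  obtain ⟨U', hU, ψ, ha', hψ, hψφ⟩ := h a ha
  have h1 (n : ℕ) (y : (superdomain U' q).pts n) : V.projMk (ψ.app n y) =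
      (V.wprojFst W).app n (φ.app n ((superdomainIncl hU q).app n y)) :=
    congrArg (fun χ => χ.app n y) hψφ
  have hb (n : ℕ) (y : (superdomain U' q).pts n) : V.bodyVec (ψ.app n y).1.1 i ≠ 0 := by
    refine V.base_projMk_mem_affineSet.1 ?_
    rw [h1, Space.base_app]
    change (V.wprojFst W).app 0 ((V.wproj W).base _) ∈ _
    rw [φ.base_app_superdomain]
    exact hi _
  have hu (n : ℕ) (y : (superdomain U' q).pts n) := V.isUnit_coord (ψ.app n y).1.2 (hb n y)
  -- Once `[v]` is lifted to `v = ψ`, the second component is forced: `w` is the scaled coordinate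
  -- divided by `v_i`.
  let χ : (superdomain U' q).Hom W.nonzero.toGrFunctor :=
    { app := fun n y => W.nonzeroMk (Ring.inverse (V.coord (V.evenFun i) n (ψ.app n y).1.1) •
        ((V.wprojScale W i).app n (φ.app n ((superdomainIncl hU q).app n y))).1)
        (W.smul_mem_points (inverse_mem_grEven (V.coord_evenFun_mem i (ψ.app n y).1.2) (hb n y))
          ((V.wprojScale W i).app n _).2) (by
        rw [bodyVec_smul, body_inverse (hu n y)]
        refine smul_ne_zero (inv_ne_zero (hb n y)) (V.bodyVec_wprojScale_ne_zero W ?_)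
        rw [← h1]
        exact V.base_projMk_mem_affineSet.2 (hb n y))
      natural := fun {n m} ρ y => Subtype.ext (Subtype.ext (by
        have e1 : (ψ.app m ((superdomain U' q).map ρ y)).1.1 = V.extMap ρ (ψ.app n y).1.1 :=
          congrArg (fun t => t.1.1) (ψ.natural ρ y)
        have e2 : ((V.wprojScale W i).app m (φ.app m ((superdomainIncl hU q).app m
            ((superdomain U' q).map ρ y)))).1 = W.extMap ρ ((V.wprojScale W i).app n
            (φ.app n ((superdomainIncl hU q).app n y))).1 :=
          congrArg Subtype.val (((V.wprojScale W i).toHom.comp φ).natural ρ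
            ((superdomainIncl hU q).app n y))
        change Ring.inverse _ • _ = W.extMap ρ (Ring.inverse _ • _)
        rw [e1, e2, extMap_smul, coord_extMap, map_inverse _ (hu n y)])) }
  refine ⟨U', hU, ⟨fun n y => (ψ.app n y, χ.app n y), fun ρ y => Prod.ext (ψ.natural ρ y)
    (χ.natural ρ y)⟩, ha', ⟨hψ, fun b => ?_⟩, GrFunctor.Hom.ext fun n y => ?_⟩
  · exact (((hψ (V.evenFun i)).inverse hu).mul ((h' b).restrict hU)).congr
      fun n y => W.coord_smul b _ _
  · refine V.wproj_eq_of_scale_eq W (i := i) (t := V.wprojMk W (ψ.app n y) (χ.app n y))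
      (V.base_projMk_mem_affineSet.2 (hb n y)) (h1 n y) (Subtype.ext ?_)
    rw [wprojScale_mk]
    change _ • (Ring.inverse _ • _) = _
    rw [smul_smul, Ring.mul_inverse_cancel _ (hu n y), one_smul]
    rfl

/-- The local trivialization of the weighted projective superspace over an affine chart. -/
def affineTriv (i : Fin V.evenDim) :
    ((V.wproj W).restrict ((V.wprojFst W).app 0 ⁻¹' V.affineSet i)).Iso
      ((V.proj.restrict (V.affineSet i)).prod W.nonzero) :=
  Space.Iso.ofBijective (V.affineTrivHom W i)
    (fun n => by
      constructor
      · intro t t' h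
        exact Subtype.ext (V.wproj_eq_of_scale_eq W ((V.affineTrivHom W i).app n t).1.2
          (congrArg (fun s => s.1.1) h) (congrArg (fun s => s.2.1) h))
      · rintro ⟨⟨l, hl⟩, z⟩
        obtain ⟨y, rfl⟩ := V.exists_projMk l
        have h0 := V.base_projMk_mem_affineSet.1 hl
        have hu := V.isUnit_coord y.1.2 h0
        -- The preimage of `([y], z)` is the class of `y` and `y_i⁻¹ z`.
        refine ⟨⟨V.wprojMk W y (W.nonzeroMk
          (Ring.inverse (V.coord (V.evenFun i) n y.1.1) • z.1.1)
          (W.smul_mem_points (inverse_mem_grEven (V.coord_evenFun_mem i y.1.2) h0) z.1.2) ?_),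
          hl⟩, ?_⟩
        · rw [bodyVec_smul, body_inverse hu]
          exact smul_ne_zero (inv_ne_zero h0) (W.bodyVec_ne_zero z)
        · refine Prod.ext rfl (Subtype.ext (Subtype.ext ?_))
          change _ • (Ring.inverse _ • z.1.1) = z.1.1
          rw [smul_smul, Ring.mul_inverse_cancel _ hu, one_smul])
    fun φ hφ => V.isPlot_wproj_of_scale W
      (fun a => Space.mem_of_restrict (φ.app 0 (superdomainPt _ _ a))) hφ.1 hφ.2

/-- The line of `v` and the products `v_k w_l` are continuous invariants of the action. The first
yields a scalar `c` relating two choices of `v`, and the second then relates the choices of `w` by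
`c⁻¹`. -/
theorem t2Space_wproj : @T2Space _ (V.wproj W).topology := by
  let f : (V.wproj W).pts 0 → (Fin V.evenDim → Fin V.evenDim → 𝕜) ×
      (Fin V.evenDim → Fin W.evenDim → 𝕜) :=
    Quotient.lift (s := V.wprojSetoid W 0)
      (fun t => (lineMatrix (V.bodyVec t.1.1.1),
        fun k l => V.bodyVec t.1.1.1 k * W.bodyVec t.2.1.1 l)) (by
      rintro ⟨y, z⟩ ⟨y', z'⟩ ⟨c, hc, hc'⟩
      have h1 : body c.val * body c⁻¹.val = 1 := by rw [← map_mul, c.val_mul_inv, map_one]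
      dsimp only at hc hc' ⊢
      rw [hc, hc', bodyVec_smul, bodyVec_smul, lineMatrix_smul c.body_ne_zero]
      refine Prod.ext rfl (funext fun k => funext fun l => ?_)
      simp only [Pi.smul_apply, smul_eq_mul]
      linear_combination (-V.bodyVec y.1.1 k * W.bodyVec z.1.1 l) * h1)
  refine Space.t2Space_of_injective (f := f) (Space.continuous_quot ?_) ?_
  · let := (V.nonzero.prod W.nonzero).topology
    let := V.nonzero.topology
    let := W.nonzero.topology
    have h1 : Continuous fun t : (V.nonzero.prod W.nonzero).pts 0 => V.bodyVec t.1.1.1 :=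
      V.continuous_bodyVec_nonzero.comp (Space.fst V.nonzero W.nonzero).continuous
    have h2 : Continuous fun t : (V.nonzero.prod W.nonzero).pts 0 => W.bodyVec t.2.1.1 :=
      W.continuous_bodyVec_nonzero.comp (Space.snd V.nonzero W.nonzero).continuous
    exact (continuous_lineMatrix h1 fun t => V.bodyVec_ne_zero t.1).prodMk
      (continuous_pi fun k => continuous_pi fun l =>
        ((continuous_apply k).comp h1).mul ((continuous_apply l).comp h2))
  · intro t t' h
    obtain ⟨y, z, rfl⟩ := V.exists_wprojMk W t
    obtain ⟨y', z', rfl⟩ := V.exists_wprojMk W t'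
    have h1 : lineMatrix (V.bodyVec y.1.1) = lineMatrix (V.bodyVec y'.1.1) := congrArg Prod.fst h
    have h2 (k l) : V.bodyVec y.1.1 k * W.bodyVec z.1.1 l =
        V.bodyVec y'.1.1 k * W.bodyVec z'.1.1 l :=
      congrFun (congrFun (congrArg Prod.snd h) k) l
    obtain ⟨c, hc, hcy⟩ := exists_smul_of_lineMatrix_eq (V.bodyVec_ne_zero y)
      (V.bodyVec_ne_zero y') h1
    obtain ⟨k, hk⟩ := V.exists_bodyVec_ne_zero y
    obtain ⟨d, hd, -⟩ := exists_gm (a := algebraMap 𝕜 (Gr 𝕜 0) c) (algebraMap_mem_grEven c)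
      (by rwa [AlgHom.commutes])
    have hd' : body d.val = c := by rw [hd, AlgHom.commutes]; rfl
    have hd'' : body d.val * body d⁻¹.val = 1 := by rw [← map_mul, d.val_mul_inv, map_one]
    refine (V.wprojMk_eq_iff W).2 ⟨d,
      V.ext_of_bodyVec y'.1.2 (V.smul_mem_points d.val_mem y.1.2) ?_,
      W.ext_of_bodyVec z'.1.2 (W.smul_mem_points d⁻¹.val_mem z.1.2) (funext fun l => ?_)⟩
    · rw [hcy, bodyVec_smul, hd']
    · have h3 := h2 k l
      -- The index `k` has `v_k ≠ 0`, so this factor can be cancelled from `v_k w_l = c v_k w'_l`.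
      rw [hcy, Pi.smul_apply, smul_eq_mul, mul_comm c, mul_assoc] at h3
      have h4 := mul_left_cancel₀ hk h3
      rw [bodyVec_smul, Pi.smul_apply, smul_eq_mul, h4, ← mul_assoc, mul_comm _ c, ← hd', hd'',
        one_mul]

/-- A chart over an affine set is the product of the affine chart of `P(V)` with the global chart of
`W_0`, carried over by the local trivialization. -/
theorem isSupermanifold_wproj : (V.wproj W).IsSupermanifold := by
  refine Space.isSupermanifold_of_countable_atlas (V.t2Space_wproj W)
    (fun i => (V.wprojFst W).app 0 ⁻¹' V.affineSet i) (fun i => ?_)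
    (fun t => V.exists_mem_affineSet ((V.wprojFst W).app 0 t)) fun i => ?_
  · let := (V.wproj W).topology
    let := V.proj.topology
    exact (V.isOpen_affineSet i).preimage (V.wprojFst W).continuous
  · obtain ⟨p, q, U, ⟨f⟩⟩ := V.exists_affineChart i
    exact ⟨_, _, _, ⟨(Space.prodDomain U _ q _).trans
      ((f.prodCongr W.nonzeroChart).trans (V.affineTriv W i).symm)⟩⟩

theorem isFiberBundle_wprojFst : Space.IsFiberBundle (V.wprojFst W) W.nonzero := by
  refine ⟨V.isSupermanifold_wproj W, V.isSupermanifold_proj, W.isSupermanifold_nonzero,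
    fun b => ?_⟩
  obtain ⟨i, hi⟩ := V.exists_mem_affineSet b
  exact ⟨V.affineSet i, V.isOpen_affineSet i, hi, V.affineTriv W i, fun _ _ => rfl⟩

end VectorSuperspace

namespace VectorSuperspace

variable {𝕜 : Type u} [RCLike 𝕜] (V : VectorSuperspace.{u, v} 𝕜) (W : VectorSuperspace.{u, w} 𝕜)
variable {n m : ℕ}

/-! ### The isomorphism with the bundle of nonzero vectors -/

theorem superTmul_mem_tautTensorFiber (y : V.nonzero.pts n) (z : W.Ext n) :
    V.superTmul W y.1.1 z ∈ V.tautTensorFiber W (V.projMk y) :=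
  Submodule.subset_span ⟨y.1.1, Submodule.mem_span_singleton_self y.1.1, z, rfl⟩

/-- The fibre is defined as a span, but scalars on the line and scalars outside the product can both
be absorbed into the second factor. Hence products with the fixed vector `y` already form a
submodule. -/
theorem exists_superTmul_of_mem_tautTensorFiber (y : V.nonzero.pts n) {t : (V.tensor W).Ext n}
    (ht : t ∈ V.tautTensorFiber W (V.projMk y)) : ∃ z, V.superTmul W y.1.1 z = t := by
  induction ht using Submodule.span_induction with
  | mem t ht =>
    obtain ⟨y', hy, z, rfl⟩ := ht
    obtain ⟨c, rfl⟩ := Submodule.mem_span_singleton.1 hy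
    exact ⟨c • z, by rw [V.superTmul_smul_right W c y.1.2, superTmul_smul_left]⟩
  | zero => exact ⟨0, map_zero _⟩
  | add t t' _ _ ht ht' =>
    obtain ⟨z, rfl⟩ := ht
    obtain ⟨z', rfl⟩ := ht'
    exact ⟨z + z', map_add _ _ _⟩
  | smul c t _ ht =>
    obtain ⟨z, rfl⟩ := ht
    exact ⟨c • z, V.superTmul_smul_right W c y.1.2 z⟩

/-- The map `[v‖w] ↦ v ⊗ w`. -/
def wprojTensor : (V.wproj W).Hom (V.tensor W).toSpace :=
  Space.quotLift _ _ ((V.tensorHom W).comp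
    (((Space.restrictIncl _ _).comp (Space.fst V.nonzero W.nonzero)).prodMk
      ((Space.restrictIncl _ _).comp (Space.snd V.nonzero W.nonzero)))) (by
    rintro n ⟨y, z⟩ ⟨y', z'⟩ ⟨c, hc, hc'⟩
    refine Subtype.ext ?_
    change V.superTmul W y.1.1 z.1.1 = V.superTmul W y'.1.1 z'.1.1
    dsimp only at hc hc'
    rw [hc, hc', superTmul_smul_left, V.superTmul_smul_right W _ y.1.2, smul_smul, c.val_mul_inv,
      one_smul])

theorem wprojTensor_mk (y : V.nonzero.pts n) (z : W.nonzero.pts n) :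
    ((V.wprojTensor W).app n (V.wprojMk W y z)).1 = V.superTmul W y.1.1 z.1.1 := rfl

/-- The fibre coordinate of the local trivialization factors smoothly through `v ⊗ w`. This is what
makes `[v‖w] ↦ v ⊗ w` invertible. -/
theorem contract_wprojTensor (i : Fin V.evenDim) (t : (V.wproj W).pts n) :
    (V.contractHom W i).app n ((V.wprojTensor W).app n t) = (V.wprojScale W i).app n t := by
  obtain ⟨y, z, rfl⟩ := V.exists_wprojMk W t
  exact Subtype.ext (V.contract_superTmul W i y.1.2 z.1.1)

theorem wprojTensor_ne_zero (t : (V.wproj W).pts n) : ((V.wprojTensor W).app n t).1 ≠ 0 := by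
  obtain ⟨y, z, rfl⟩ := V.exists_wprojMk W t
  obtain ⟨i, hi⟩ := V.exists_bodyVec_ne_zero y
  intro h
  have h1 := V.contract_superTmul W i y.1.2 z.1.1
  rw [← wprojTensor_mk, h, map_zero] at h1
  refine smul_ne_zero hi (W.bodyVec_ne_zero z) ?_
  rw [← bodyVec_coord_smul, ← h1, bodyVec_zero]

/-- The map `[v‖w] ↦ ([v], v ⊗ w)`. -/
def tautHom : (V.wproj W).Hom (V.tautTensorNonzero W) :=
  (((V.wprojFst W).prodMk (V.wprojTensor W)).codSub _ _ (by
    intro n t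
    obtain ⟨y, z, rfl⟩ := V.exists_wprojMk W t
    exact V.superTmul_mem_tautTensorFiber W y z.1.1)).codRestrict _ (V.wprojTensor_ne_zero W)

theorem tautHom_bijective (n : ℕ) : Function.Bijective ((V.tautHom W).app n) := by
  constructor
  · intro t t' h
    have h1 : (V.wprojFst W).app n t = (V.wprojFst W).app n t' := congrArg (fun s => s.1.1.1) h
    have h2 : (V.wprojTensor W).app n t = (V.wprojTensor W).app n t' :=
      congrArg (fun s => s.1.1.2) h
    obtain ⟨i, hi⟩ := V.exists_mem_affineSet (V.proj.base ((V.wprojFst W).app n t))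
    refine V.wproj_eq_of_scale_eq W hi h1 ?_
    rw [← contract_wprojTensor, ← contract_wprojTensor, h2]
  · rintro ⟨⟨⟨l, t⟩, ht⟩, h0⟩
    obtain ⟨y, rfl⟩ := V.exists_projMk l
    obtain ⟨z, hz⟩ := V.exists_superTmul_of_mem_tautTensorFiber W y ht
    change (V.tensor W).extMap (GrHom.aug 𝕜 n) t.1 ≠ 0 at h0
    obtain ⟨i, hi⟩ := V.exists_bodyVec_ne_zero y
    have hu := V.isUnit_coord y.1.2 hi
    -- The fibre provides `z` without any parity condition. Its contraction `y_i z` is a point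
    -- because `t` is one, and dividing by the even unit `y_i` shows that `z` is a point.
    have hzm : z ∈ W.points n := by
      have h1 := V.contract_mem_points W i t.2
      rw [← hz, V.contract_superTmul W i y.1.2] at h1
      have h2 := W.smul_mem_points (inverse_mem_grEven (V.coord_evenFun_mem i y.1.2) hi) h1
      rwa [smul_smul, Ring.inverse_mul_cancel _ hu, one_smul] at h2
    -- If the body of `z` vanished, so would its ordinary vector, and hence the ordinary vector
    -- under `t`.
    have hz0 : W.bodyVec z ≠ 0 := by
      intro h
      have h1 : W.extMap (GrHom.aug 𝕜 n) z = 0 :=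
        W.ext_of_bodyVec (W.extMap_mem _ _ hzm) (zero_mem _)
          (by rw [bodyVec_extMap, h, bodyVec_zero])
      exact h0 (by rw [← hz, extMap_superTmul, h1, map_zero])
    refine ⟨V.wprojMk W y (W.nonzeroMk z hzm hz0), ?_⟩
    exact Subtype.ext (Subtype.ext (Prod.ext rfl (Subtype.ext hz)))

/-- The isomorphism `[v‖w] ↦ ([v], v ⊗ w)`. -/
def tautIso : (V.wproj W).Iso (V.tautTensorNonzero W) :=
  Space.Iso.ofBijective (V.tautHom W) (V.tautHom_bijective W) fun {p q U} φ hφ => by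
    have h1 : V.proj.IsPlot ((V.wprojFst W).toHom.comp φ) := hφ.1
    have h2 : (V.tensor W).toSpace.IsPlot ((V.wprojTensor W).toHom.comp φ) := hφ.2
    refine (V.wproj W).plot_local φ fun a ha => ?_
    -- No single coordinate is invertible along the whole plot. The index is chosen at the given
    -- point, and the domain is shrunk to the open set of parameters where that coordinate has
    -- nonzero body.
    obtain ⟨i, hi⟩ := V.exists_mem_affineSet
      ((V.wprojFst W).app 0 (φ.app 0 (superdomainPt U q ⟨a, ha⟩)))
    have hopen := Space.isOpen_iff.1 (V.isOpen_affineSet i) _ _ _ _ h1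
    have hle : (⟨_, U.isOpen.isOpenMap_subtype_val _ hopen⟩ : Opens (Fin p → 𝕜)) ≤ U := by
      rintro _ ⟨c, -, rfl⟩
      exact c.2
    refine ⟨_, hle, ⟨⟨a, ha⟩, hi, rfl⟩, V.isPlot_wproj_of_scale W (i := i) ?_
      (Space.isPlot_incl h1 hle) ?_⟩
    · rintro ⟨_, c, hc, rfl⟩
      exact hc
    · have h3 := (V.contractHom W i).smooth _ (Space.isPlot_incl h2 hle)
      convert h3 using 1
      exact GrFunctor.Hom.ext fun n y => (V.contract_wprojTensor W i _).symm

/-! ### Exchanging the two factors -/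

/-- The map `[v‖w] ↦ [w‖v]`. -/
def wprojSwapHom : (V.wproj W).Hom (W.wproj V) :=
  Space.quotLift _ _ ((Space.quotProj _ _).comp
    ((Space.snd V.nonzero W.nonzero).prodMk (Space.fst V.nonzero W.nonzero))) (by
    rintro n ⟨y, z⟩ ⟨y', z'⟩ ⟨c, hc, hc'⟩
    -- Exchanging the factors exchanges the weights, so the scalar is replaced by its inverse.
    exact (W.wprojMk_eq_iff V).2 ⟨c⁻¹, hc', hc.trans (by rw [inv_inv]; rfl)⟩)

theorem wprojSwapHom_swap (t : (V.wproj W).pts n) :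
    (W.wprojSwapHom V).app n ((V.wprojSwapHom W).app n t) = t := by
  obtain ⟨y, z, rfl⟩ := V.exists_wprojMk W t
  rfl

/-- The isomorphism `[v‖w] ↦ [w‖v]`. -/
def wprojSwap : (V.wproj W).Iso (W.wproj V) :=
  ⟨V.wprojSwapHom W, W.wprojSwapHom V, fun _ => V.wprojSwapHom_swap W,
    fun _ => W.wprojSwapHom_swap V⟩

end VectorSuperspace

/-- Fibre bundles can be transported along isomorphisms of their total spaces. -/
theorem Space.IsFiberBundle.comp_iso {𝕜 : Type u} [RCLike 𝕜] {E' : Space.{u, v} 𝕜}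
    {E : Space.{u, w} 𝕜} {B : Space.{u, x} 𝕜} {F : Space.{u} 𝕜} {π : E.Hom B}
    (h : Space.IsFiberBundle π F) (f : E'.Iso E) (hE' : E'.IsSupermanifold) :
    Space.IsFiberBundle (π.comp f.hom) F := by
  refine ⟨hE', h.2.1, h.2.2.1, fun b => ?_⟩
  obtain ⟨A, hA, hb, Θ, hΘ⟩ := h.2.2.2 b
  exact ⟨A, hA, hb, (f.restrict (π.app 0 ⁻¹' A)).trans Θ, fun n y => hΘ n _⟩

end Super

end

/-! ### The two bundle structures. -/

theorem mainTheorem1 {𝕜 : Type*} [RCLike 𝕜] (V W : Super.VectorSuperspace 𝕜) :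
    -- the weighted projective superspace is a supermanifold
    (V.wproj W).IsSupermanifold ∧
    -- it is a fibre bundle over `P(V)`, isomorphic to `(E_V ⊗ W)_0` via `[v‖w] ↦ ([v], v ⊗ w)`
    (∃ πV : (V.wproj W).Hom V.proj,
      (∀ (n : ℕ) (v : V.nonzero.pts n) (w : W.nonzero.pts n),
        πV.app n (V.wprojMk W v w) = V.projMk v) ∧
      Super.Space.IsFiberBundle πV W.nonzero ∧
      ∃ Φ : (V.wproj W).Iso (V.tautTensorNonzero W),
        (∀ (n : ℕ) (x : (V.wproj W).pts n),
          (V.tautTensorProj W).app n (Φ.hom.app n x) = πV.app n x) ∧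
        ∀ (n : ℕ) (v : V.nonzero.pts n) (w : W.nonzero.pts n),
          (Φ.hom.app n (V.wprojMk W v w)).1.1.2.1 = V.superTmul W v.1.1 w.1.1) ∧
    -- it is a fibre bundle over `P(W)`, isomorphic to `(E_W ⊗ V)_0` via `[v‖w] ↦ ([w], w ⊗ v)`
    (∃ πW : (V.wproj W).Hom W.proj,
      (∀ (n : ℕ) (v : V.nonzero.pts n) (w : W.nonzero.pts n),
        πW.app n (V.wprojMk W v w) = W.projMk w) ∧
      Super.Space.IsFiberBundle πW V.nonzero ∧
      ∃ Ψ : (V.wproj W).Iso (W.tautTensorNonzero V),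
        (∀ (n : ℕ) (x : (V.wproj W).pts n),
          (W.tautTensorProj V).app n (Ψ.hom.app n x) = πW.app n x) ∧
        ∀ (n : ℕ) (v : V.nonzero.pts n) (w : W.nonzero.pts n),
          (Ψ.hom.app n (V.wprojMk W v w)).1.1.2.1 = W.superTmul V w.1.1 v.1.1) := by
  -- All formulas on points hold by definition, because the maps are defined on representatives. The
  -- bundle over `P(W)` is the one for the pair `(W, V)` pulled back along the swap.
  refine ⟨V.isSupermanifold_wproj W, ⟨V.wprojFst W, fun _ _ _ => rfl, V.isFiberBundle_wprojFst W,
    V.tautIso W, fun _ _ => rfl, fun _ _ _ => rfl⟩, ⟨(W.wprojFst V).comp (V.wprojSwap W).hom,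
    fun _ _ _ => rfl, (W.isFiberBundle_wprojFst V).comp_iso (V.wprojSwap W)
      (V.isSupermanifold_wproj W),
    (V.wprojSwap W).trans (W.tautIso V), fun _ _ => rfl, fun _ _ _ => rfl⟩⟩
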